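/- Let $k$ be an algebraically closed field of arbitrary characteristic and let $C$ be a smooth projective (integral) curve over $k$ of genus $g=\dim_k H^1(C,\mathcal{O}_C)\ge 1$. Let $\mathcal{E}$ be a locally free sheaf of finite rank on $C$ that is generated by its global sections and satisfies $H^1(C,\mathcal{E})=0$. Then $\mathcal{E}$ is ample, i.e. the tautological line bundle $\mathcal{O}_{\mathbb{P}(\mathcal{E})}(1)$ is ample on the projective bundle $\mathbb{P}(\mathcal{E})=\mathbf{Proj}(\operatorname{Sym}\mathcal{E})\to C$ of invertible quotients of $\mathcal{E}$. -/

import Mathlib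

open CategoryTheory Limits TopologicalSpace AlgebraicGeometry Opposite

universe u

namespace AmpleBundle

noncomputable section

section Modules

variable {X : Scheme.{u}}

/-- The structure sheaf `𝒪_X`, as a module over itself. -/
def structureModule (X : Scheme.{u}) : X.Modules :=
  SheafOfModules.unit X.ringCatSheaf

/-- Locally free sheaves of finite rank (vector bundles; the rank need not be constant). -/
def IsVectorBundle (E : X.Modules) : Prop :=
  ∀ x : X, ∃ (U : X.Opens) (_ : x ∈ U) (r : ℕ),
    Nonempty (E.restrict U.ι ≅
      SheafOfModules.free (R := U.toScheme.ringCatSheaf) (ULift.{u} (Fin r)))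

/-- Invertible sheaves (line bundles). -/
def IsLineBundle (L : X.Modules) : Prop :=
  ∀ x : X, ∃ (U : X.Opens) (_ : x ∈ U),
    Nonempty (L.restrict U.ι ≅ structureModule U.toScheme)

/-- `E` is generated by its global sections: some family of global sections of `E` defines an
epimorphism of sheaves of modules from a free module onto `E`. -/
def IsGloballyGenerated (E : X.Modules) : Prop :=
  Nonempty (SheafOfModules.GeneratingSections (R := X.ringCatSheaf) E)

end Modules

section Cohomology

variable {X : Scheme.{u}}

/-- The sheaf of abelian groups underlying a sheaf of modules. -/
def toAbSheaf (M : X.Modules) : Sheaf (Opens.grothendieckTopology X) AddCommGrpCat.{u} :=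
  ⟨M.presheaf, M.isSheaf⟩

/-- The sheaf cohomology group `H^n(X, M)`. -/
def Cohomology (M : X.Modules) (n : ℕ) : Type u :=
  Sheaf.H (toAbSheaf M) n

instance (M : X.Modules) (n : ℕ) : AddCommGroup (Cohomology M n) :=
  inferInstanceAs (AddCommGroup (Sheaf.H (toAbSheaf M) n))

/-- Multiplication by a global function, as an endomorphism of the abelian sheaf of `M`. -/
def globalSMul (M : X.Modules) (r : Γ(X, ⊤)) : toAbSheaf M ⟶ toAbSheaf M where
  hom :=
    { app := fun U => M.smul (X.presheaf.map (homOfLE le_top).op r)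
      naturality := by
        intro U V i
        have h := Scheme.Modules.map_comp_smul (M := M) i.unop
          (X.presheaf.map (homOfLE (le_top : U.unop ≤ ⊤)).op r)
        rw [← CommRingCat.comp_apply, ← Functor.map_comp] at h
        exact h.symm }

lemma globalSMul_one (M : X.Modules) : globalSMul M 1 = 𝟙 _ := by
  apply Sheaf.hom_ext
  ext U x
  change X.presheaf.map (homOfLE (le_top : U.unop ≤ ⊤)).op 1 • (show Γ(M, U.unop) from x) = x
  rw [map_one, one_smul]

lemma globalSMul_mul (M : X.Modules) (r s : Γ(X, ⊤)) :
    globalSMul M (r * s) = globalSMul M s ≫ globalSMul M r := by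
  apply Sheaf.hom_ext
  ext U x
  change X.presheaf.map (homOfLE (le_top : U.unop ≤ ⊤)).op (r * s) •
    (show Γ(M, U.unop) from x) = X.presheaf.map (homOfLE (le_top : U.unop ≤ ⊤)).op r •
      X.presheaf.map (homOfLE (le_top : U.unop ≤ ⊤)).op s • (show Γ(M, U.unop) from x)
  rw [map_mul, mul_smul]

lemma globalSMul_add (M : X.Modules) (r s : Γ(X, ⊤)) :
    globalSMul M (r + s) = globalSMul M r + globalSMul M s := by
  apply Sheaf.hom_ext
  ext U x
  change X.presheaf.map (homOfLE (le_top : U.unop ≤ ⊤)).op (r + s) •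
    (show Γ(M, U.unop) from x) = X.presheaf.map (homOfLE (le_top : U.unop ≤ ⊤)).op r •
      (show Γ(M, U.unop) from x) +
      X.presheaf.map (homOfLE (le_top : U.unop ≤ ⊤)).op s • (show Γ(M, U.unop) from x)
  rw [map_add, add_smul]

/-- `H^n(X, M)` is a module over the ring of global functions, by functoriality. -/
instance (M : X.Modules) (n : ℕ) : Module Γ(X, ⊤) (Cohomology M n) where
  smul r x := Sheaf.H.map (globalSMul M r) n x
  one_smul x := by
    change Sheaf.H.map (globalSMul M 1) n x = x
    rw [globalSMul_one]
    exact Sheaf.H.map_id_apply x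
  mul_smul r s x := by
    change Sheaf.H.map (globalSMul M (r * s)) n x =
      Sheaf.H.map (globalSMul M r) n (Sheaf.H.map (globalSMul M s) n x)
    rw [globalSMul_mul]
    exact Sheaf.H.map_comp_apply _ _ x
  smul_zero r := map_zero (Sheaf.H.map (globalSMul M r) n)
  smul_add r x y := map_add (Sheaf.H.map (globalSMul M r) n) x y
  add_smul r s x := by
    change Sheaf.H.map (globalSMul M (r + s)) n x =
      Sheaf.H.map (globalSMul M r) n x + Sheaf.H.map (globalSMul M s) n x
    rw [globalSMul_add]
    exact Sheaf.H.map_add_apply _ _ x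
  zero_smul x := by
    have h : Sheaf.H.map (globalSMul M 0) n x =
        Sheaf.H.map (globalSMul M 0) n x + Sheaf.H.map (globalSMul M 0) n x := by
      conv_lhs => rw [← add_zero (0 : Γ(X, ⊤)), globalSMul_add]
      exact Sheaf.H.map_add_apply _ _ x
    exact left_eq_add.mp h

end Cohomology

section Curves

variable (k : Type u) [Field k]

instance (n : ℕ) : GradedAlgebra (MvPolynomial.homogeneousSubmodule (Fin (n + 1)) k) :=
  MvPolynomial.gradedAlgebra

/-- Projective space `ℙ^n` over the field `k`, as the `Proj` of a polynomial ring. -/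
def projectiveSpace (n : ℕ) : Scheme.{u} :=
  Proj (MvPolynomial.homogeneousSubmodule (Fin (n + 1)) k)

/-- The structure morphism `ℙ^n ⟶ Spec k`. -/
def projectiveSpaceToSpec (n : ℕ) : projectiveSpace k n ⟶ Spec (.of k) :=
  Proj.toSpecZero (MvPolynomial.homogeneousSubmodule (Fin (n + 1)) k) ≫
    Spec.map (CommRingCat.ofHom
      (algebraMap k (MvPolynomial.homogeneousSubmodule (Fin (n + 1)) k 0)))

variable {k}

/-- A `k`-scheme is projective if it is a closed subscheme of some `ℙ^n`. -/
def IsProjective {X : Scheme.{u}} (f : X ⟶ Spec (.of k)) : Prop :=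
  ∃ (n : ℕ) (i : X ⟶ projectiveSpace k n),
    IsClosedImmersion i ∧ i ≫ projectiveSpaceToSpec k n = f

/-- A smooth projective curve over `k`: a smooth projective integral `k`-scheme of dimension one. -/
structure IsSmoothProjectiveCurve {C : Scheme.{u}} (f : C ⟶ Spec (.of k)) : Prop where
  isIntegral : IsIntegral C
  smooth : Smooth f
  isProjective : IsProjective f
  dimension : topologicalKrullDim C = 1

/-- The ring map from `k` to the global functions of a `k`-scheme. -/
def scalarMap {X : Scheme.{u}} (f : X ⟶ Spec (.of k)) : k →+* Γ(X, ⊤) :=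
  ((Scheme.ΓSpecIso (.of k)).inv ≫ f.appTop).hom

/-- The dimension of the `k`-vector space `H^n(X, M)`. -/
def cohomologyDim {X : Scheme.{u}} (f : X ⟶ Spec (.of k)) (M : X.Modules) (n : ℕ) : ℕ :=
  letI : Module k (Cohomology M n) := Module.compHom _ (scalarMap f)
  Module.finrank k (Cohomology M n)

/-- The genus of a smooth projective curve over an algebraically closed field,
`g = dim_k H^1(C, 𝒪_C)`. -/
def genus {C : Scheme.{u}} (f : C ⟶ Spec (.of k)) : ℕ :=
  cohomologyDim f (structureModule C) 1

end Curves

section Ample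

variable {X : Scheme.{u}}

/-- The presheaf tensor power `U ↦ L(U)^{⊗ n}` over `𝒪_X(U)`. -/
def presheafTensorPower (L : X.Modules) :
    ℕ → _root_.PresheafOfModules.{u} (X.presheaf ⋙ forget₂ CommRingCat.{u} RingCat.{u})
  | 0 => MonoidalCategoryStruct.tensorUnit _
  | n + 1 => MonoidalCategoryStruct.tensorObj (presheafTensorPower L n) L.val

/-- The tensor power `L^{⊗ n}` over `𝒪_X`: the sheafification of the presheaf tensor power. -/
def tensorPower (L : X.Modules) (n : ℕ) : X.Modules :=
  (PresheafOfModules.sheafification (𝟙 X.ringCatSheaf.obj)).obj (presheafTensorPower L n)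

/-- The locus `X_s` where a global section `s` of an invertible sheaf `L` does not vanish, that
is, the largest open subset over which multiplication by `s` is an isomorphism `𝒪 ≅ L`. -/
def nonvanishingLocus (L : X.Modules) (s : Γ(L, ⊤)) : X.Opens :=
  sSup {V | ∀ W : X.Opens, W ≤ V →
    Function.Bijective fun a : Γ(X, W) => a • L.presheaf.map (homOfLE (le_top : W ≤ ⊤)).op s}

/-- Ample invertible sheaves: `X` is quasi-compact and is covered by the affine open subsets of
the form `X_s` for sections `s` of positive tensor powers of `L`. -/
structure IsAmpleLineBundle (L : X.Modules) : Prop where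
  isLineBundle : IsLineBundle L
  compactSpace : CompactSpace X
  exists_affine : ∀ x : X, ∃ (n : ℕ) (_ : 0 < n) (s : Γ(tensorPower L n, ⊤)),
    x ∈ nonvanishingLocus (tensorPower L n) s ∧
      IsAffineOpen (nonvanishingLocus (tensorPower L n) s)

end Ample

section ProjectiveBundle

variable {X : Scheme.{u}}

/-- The projective bundle `ℙ(E)` of one-dimensional quotients of `E`, with its projection
`π : ℙ(E) ⟶ X` and its universal quotient `π^* E ⟶ 𝒪(1)`. It is the scheme over `X`
representing the functor that sends `f : T ⟶ X` to the set of invertible quotients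
`f^* E ⟶ M`, up to isomorphism of quotients. -/
structure ProjectiveBundle (E : X.Modules) where
  /-- the total space `ℙ(E)` -/
  P : Scheme.{u}
  /-- the projection to the base -/
  π : P ⟶ X
  /-- the tautological invertible sheaf `𝒪(1)` -/
  O1 : P.Modules
  isLineBundle : IsLineBundle O1
  /-- the tautological quotient -/
  quot : (Scheme.Modules.pullback π).obj E ⟶ O1
  epi_quot : Epi quot
  existsUnique_lift : ∀ {T : Scheme.{u}} (f : T ⟶ X) (M : T.Modules) (_ : IsLineBundle M)
    (q : (Scheme.Modules.pullback f).obj E ⟶ M) (_ : Epi q),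
    ∃! g : T ⟶ P, ∃ (w : g ≫ π = f) (e : (Scheme.Modules.pullback g).obj O1 ≅ M),
      (Scheme.Modules.pullback g).map quot ≫ e.hom =
        (Scheme.Modules.pullbackComp g π).hom.app E ≫
          (Scheme.Modules.pullbackCongr w).hom.app E ≫ q

/-- A locally free sheaf `E` is ample if the projective bundle `ℙ(E)` has an ample tautological
sheaf `𝒪(1)`. (A projective bundle is unique up to unique isomorphism.) -/
def IsAmple (E : X.Modules) : Prop :=
  ∃ B : ProjectiveBundle E, IsAmpleLineBundle B.O1

end ProjectiveBundle

end

end AmpleBundle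

/-! Choose finitely many global sections `s j` generating `E`. In homogeneous coordinates `ℙ(E)` is
the subscheme of a projective space over `C` cut out by the relations among the `s j`. Each `s j`
becomes a section of `𝒪(1)` whose nonvanishing locus is the chart `Y j = {x_j = 1}`. So it suffices
that every `Y j` is affine: sections of `𝒪(1)` itself then witness ampleness.

The chart `Y j` is closed in the affine space `𝔸^J` over `C`, and `C` is proper over `k`, so the
projection `θ : Y j ⟶ 𝔸^J_k` is a closed map. Let `a` be a `k`-point of `𝔸^J`. If `a_j ≠ 1`, the
fibre over `a` is empty. If `a_j = 1` and `a` satisfied every relation among the `s i`, then `s i ↦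
a_i` would define a morphism `E ⟶ 𝒪_C` sending `s j` to `1`. This would split `𝒪_C` off `E` and make
`H^1(𝒪_C)` a retract of `H^1(E) = 0`, against `g ≥ 1` (`hom_structureModule_ne_one`). Hence some
local relation `∑ c_i s_i = 0` has `h = ∑ c_i a_i ≠ 0`. The fibre over `a` then lies over the
complement of `D(h)`, which is a proper closed subset of `C`, hence finite, hence contained in an
affine open `U₀`. Since `θ` is closed, `a` has a neighbourhood `D(g)` whose preimage lies over `U₀`;
as `Y j ⟶ C` is an affine morphism, this preimage is affine. By the Nullstellensatz such `g`
generate the unit ideal, so `Y j` is affine (`IsChart.isAffine`).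

The rest constructs `ℙ(E)` and its universal property (`exists_isChart`, `exists_isProjOf`,
`IsProjOf.isAmple`). Everything is expressed through sections instead of stalks: `IsJointlyEpi` and
`IsGen` for generation, `IsRel` for relations, `Cocycle` for line bundles with generating sections.
-/

namespace AmpleBundle

noncomputable section

/-! ### Restriction, gluing and morphisms in terms of sections. -/

section Sections

variable {X : Scheme.{u}}

/-- Restriction of functions to a smaller open subset. -/
def rs {U V : X.Opens} (h : V ≤ U) : Γ(X, U) →+* Γ(X, V) :=
  (X.presheaf.map (homOfLE h).op).hom

/-- Restriction of sections of a sheaf of modules to a smaller open subset. -/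
def res (M : X.Modules) {U V : X.Opens} (h : V ≤ U) : Γ(M, U) →+ Γ(M, V) :=
  (M.presheaf.map (homOfLE h).op).hom

lemma rs_rs {U V W : X.Opens} (h : V ≤ U) (h' : W ≤ V) (x : Γ(X, U)) :
    rs h' (rs h x) = rs (h'.trans h) x := by
  simp only [rs, ← CommRingCat.comp_apply, ← Functor.map_comp]
  rfl

@[simp] lemma rs_refl {U : X.Opens} (h : U ≤ U) (x : Γ(X, U)) : rs h x = x := by
  change X.presheaf.map (𝟙 _) x = x
  simp

lemma res_res {M : X.Modules} {U V W : X.Opens} (h : V ≤ U) (h' : W ≤ V) (x : Γ(M, U)) :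
    res M h' (res M h x) = res M (h'.trans h) x := by
  simp only [res]
  change (M.presheaf.map _ ≫ M.presheaf.map _) x = _
  rw [← Functor.map_comp]
  rfl

@[simp] lemma res_refl {M : X.Modules} {U : X.Opens} (h : U ≤ U) (x : Γ(M, U)) :
    res M h x = x := by
  change M.presheaf.map (𝟙 _) x = x
  simp

lemma res_smul {M : X.Modules} {U V : X.Opens} (h : V ≤ U) (r : Γ(X, U)) (x : Γ(M, U)) :
    res M h (r • x) = rs h r • res M h x :=
  M.map_smul (homOfLE h) r x

lemma app_res {M N : X.Modules} (φ : M ⟶ N) {U V : X.Opens} (h : V ≤ U) (x : Γ(M, U)) :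
    φ.app V (res M h x) = res N h (φ.app U x) :=
  ConcreteCategory.congr_hom (φ.mapPresheaf.naturality (homOfLE h).op) x

lemma res_sum {M : X.Modules} {ι : Type*} (s : Finset ι) {U V : X.Opens} (h : V ≤ U)
    (c : ι → Γ(X, U)) (x : ι → Γ(M, U)) :
    res M h (∑ i ∈ s, c i • x i) = ∑ i ∈ s, rs h (c i) • res M h (x i) := by
  simp [map_sum, res_smul]

lemma app_sum {M N : X.Modules} (φ : M ⟶ N) {ι : Type*} (s : Finset ι) {U : X.Opens}
    (c : ι → Γ(X, U)) (x : ι → Γ(M, U)) :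
    φ.app U (∑ i ∈ s, c i • x i) = ∑ i ∈ s, c i • φ.app U (x i) := by
  rw [map_sum]; simp

/-- Sections of a sheaf of modules that agree locally are equal. -/
lemma section_ext {M : X.Modules} {U : X.Opens} {x y : Γ(M, U)}
    (H : ∀ p ∈ U, ∃ (V : X.Opens) (h : V ≤ U), p ∈ V ∧ res M h x = res M h y) : x = y := by
  choose V h hp hxy using fun p : U => H p.1 p.2
  refine TopCat.Sheaf.eq_of_locally_eq' (C := Ab) ⟨M.presheaf, M.isSheaf⟩ V U
    (fun p => homOfLE (h p)) ?_ x y hxy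
  exact fun p hp' => Opens.mem_iSup.mpr ⟨⟨p, hp'⟩, hp ⟨p, hp'⟩⟩

lemma function_ext {U : X.Opens} {x y : Γ(X, U)}
    (H : ∀ p ∈ U, ∃ (V : X.Opens) (h : V ≤ U), p ∈ V ∧ rs h x = rs h y) : x = y := by
  choose V h hp hxy using fun p : U => H p.1 p.2
  refine TopCat.Sheaf.eq_of_locally_eq' X.sheaf V U (fun p => homOfLE (h p)) ?_ x y hxy
  exact fun p hp' => Opens.mem_iSup.mpr ⟨⟨p, hp'⟩, hp ⟨p, hp'⟩⟩

/-- Gluing of sections that are locally characterized by a predicate. -/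
lemma exists_section {M : X.Modules} {U : X.Opens} (Q : ∀ V : X.Opens, V ≤ U → Γ(M, V) → Prop)
    (compat : ∀ V V' hV hV' y y', Q V hV y → Q V' hV' y' →
      res M (inf_le_left : V ⊓ V' ≤ V) y = res M (inf_le_right : V ⊓ V' ≤ V') y')
    (loc : ∀ p ∈ U, ∃ V hV, p ∈ V ∧ ∃ y, Q V hV y) :
    ∃ y : Γ(M, U), ∀ V hV y', Q V hV y' → res M hV y = y' := by
  -- The cover is indexed by all solutions of `Q`, so no choice of local solutions is made and the
  -- glued section restricts to each of them.
  let I := Σ' (V : X.Opens) (hV : V ≤ U), {y : Γ(M, V) // Q V hV y}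
  have cov : U ≤ iSup fun i : I => i.1 := by
    intro p hp
    obtain ⟨V, hV, hpV, y, hy⟩ := loc p hp
    exact Opens.mem_iSup.mpr ⟨⟨V, hV, y, hy⟩, hpV⟩
  obtain ⟨y, hy, -⟩ := TopCat.Sheaf.existsUnique_gluing' (C := Ab) ⟨M.presheaf, M.isSheaf⟩
    (fun i : I => i.1) U (fun i => homOfLE i.2.1) cov (fun i => i.2.2.1)
    (fun i j => compat _ _ _ _ _ _ i.2.2.2 j.2.2.2)
  exact ⟨y, fun V hV y' h => hy ⟨V, hV, y', h⟩⟩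

lemma exists_function {U : X.Opens} (Q : ∀ V : X.Opens, V ≤ U → Γ(X, V) → Prop)
    (compat : ∀ V V' hV hV' y y', Q V hV y → Q V' hV' y' →
      rs (inf_le_left : V ⊓ V' ≤ V) y = rs (inf_le_right : V ⊓ V' ≤ V') y')
    (loc : ∀ p ∈ U, ∃ V hV, p ∈ V ∧ ∃ y, Q V hV y) :
    ∃ y : Γ(X, U), ∀ V hV y', Q V hV y' → rs hV y = y' := by
  let I := Σ' (V : X.Opens) (hV : V ≤ U), {y : Γ(X, V) // Q V hV y}
  have cov : U ≤ iSup fun i : I => i.1 := by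
    intro p hp
    obtain ⟨V, hV, hpV, y, hy⟩ := loc p hp
    exact Opens.mem_iSup.mpr ⟨⟨V, hV, y, hy⟩, hpV⟩
  obtain ⟨y, hy, -⟩ := TopCat.Sheaf.existsUnique_gluing' X.sheaf
    (fun i : I => i.1) U (fun i => homOfLE i.2.1) cov (fun i => i.2.2.1)
    (fun i j => compat _ _ _ _ _ _ i.2.2.2 j.2.2.2)
  exact ⟨y, fun V hV y' h => hy ⟨V, hV, y', h⟩⟩

/-- A morphism of sheaves of modules from its values on sections. -/
def mkHom {M N : X.Modules} (φ : ∀ U : X.Opens, Γ(M, U) → Γ(N, U))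
    (add : ∀ U x y, φ U (x + y) = φ U x + φ U y)
    (smul : ∀ U (r : Γ(X, U)) x, φ U (r • x) = r • φ U x)
    (nat : ∀ U V (h : V ≤ U) x, φ V (res M h x) = res N h (φ U x)) : M ⟶ N :=
  SheafOfModules.Hom.mk <| PresheafOfModules.homMk
    { app := fun U => AddCommGrpCat.ofHom (AddMonoidHom.mk' (φ U.unop) (add U.unop))
      naturality := by
        intro U V i
        ext x
        exact nat U.unop V.unop i.unop.le x }
    (fun U r m => smul U.unop r m)

@[simp] lemma mkHom_app {M N : X.Modules} (φ : ∀ U : X.Opens, Γ(M, U) → Γ(N, U))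
    (add smul nat) (U : X.Opens) (x : Γ(M, U)) :
    (mkHom φ add smul nat).app U x = φ U x := rfl

end Sections

/-! ### Generators, relations and the morphisms they define. -/

section Generators

variable {X : Scheme.{u}} {ι : Type*} [Fintype ι]

/-- The restriction of a global section. -/
abbrev rt (M : X.Modules) (U : X.Opens) (s : Γ(M, ⊤)) : Γ(M, U) := res M (le_top : U ≤ ⊤) s

lemma app_rt {M N : X.Modules} (φ : M ⟶ N) (V : X.Opens) (x : Γ(M, ⊤)) :
    φ.app V (rt M V x) = rt N V (φ.app ⊤ x) := app_res _ _ _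

lemma res_rt {M : X.Modules} {U V : X.Opens} (h : V ≤ U) (x : Γ(M, ⊤)) :
    res M h (rt M U x) = rt M V x := res_res _ _ _

/-- Every section of `M` is locally a linear combination of the global sections `s i`. -/
def IsGen (M : X.Modules) (s : ι → Γ(M, ⊤)) : Prop :=
  ∀ (U : X.Opens) (x : Γ(M, U)), ∀ p ∈ U, ∃ (V : X.Opens) (h : V ≤ U), p ∈ V ∧
    ∃ c : ι → Γ(X, V), res M h x = ∑ i, c i • rt M V (s i)

lemma IsGen.hom_ext {M N : X.Modules} {s : ι → Γ(M, ⊤)} (hs : IsGen M s) {φ ψ : M ⟶ N}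
    (h : ∀ i, φ.app ⊤ (s i) = ψ.app ⊤ (s i)) : φ = ψ := by
  ext U x
  refine section_ext fun p hp => ?_
  obtain ⟨V, hV, hpV, c, hc⟩ := hs U x p hp
  refine ⟨V, hV, hpV, ?_⟩
  rw [← app_res, ← app_res, hc, app_sum, app_sum]
  simp only [app_res, h]

/-- The relation `∑ c_i s_i = 0` over the open subset `U`. -/
def IsRel (M : X.Modules) (s : ι → Γ(M, ⊤)) (U : X.Opens) (c : ι → Γ(X, U)) : Prop :=
  ∑ i, c i • rt M U (s i) = 0

lemma IsRel.res {M : X.Modules} {s : ι → Γ(M, ⊤)} {U V : X.Opens} {c : ι → Γ(X, U)}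
    (hc : IsRel M s U c) (h : V ≤ U) : IsRel M s V fun i => rs h (c i) := by
  have := congrArg (AmpleBundle.res M h) hc
  rw [res_sum, map_zero] at this
  simpa only [IsRel, res_res] using this

/-- Sections of `N` that satisfy all local relations between generators of `M` define a
morphism `M ⟶ N`. -/
lemma IsGen.exists_hom {M N : X.Modules} {s : ι → Γ(M, ⊤)} (hs : IsGen M s) (t : ι → Γ(N, ⊤))
    (ht : ∀ U c, IsRel M s U c → IsRel N t U c) :
    ∃ φ : M ⟶ N, ∀ i, φ.app ⊤ (s i) = t i := by
  -- Two expressions of the same section differ by a relation, so the value prescribed by `t` does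
  -- not depend on the expression.
  have key : ∀ (U : X.Opens) (c d : ι → Γ(X, U)),
      ∑ i, c i • rt M U (s i) = ∑ i, d i • rt M U (s i) →
      ∑ i, c i • rt N U (t i) = ∑ i, d i • rt N U (t i) := by
    intro U c d h
    have := ht U (fun i => c i - d i) (by simp [IsRel, sub_smul, h])
    simpa [IsRel, sub_smul, sub_eq_zero] using this
  -- The value is pinned down by all local expressions at once; additivity, linearity and naturality
  -- then follow from uniqueness alone.
  have ex : ∀ (U : X.Opens) (x : Γ(M, U)), ∃ y : Γ(N, U), ∀ (V : X.Opens) (h : V ≤ U)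
      (c : ι → Γ(X, V)), AmpleBundle.res M h x = ∑ i, c i • rt M V (s i) →
      AmpleBundle.res N h y = ∑ i, c i • rt N V (t i) := by
    intro U x
    obtain ⟨y, hy⟩ := exists_section (M := N) (U := U)
      (fun V h y => ∃ c : ι → Γ(X, V),
        AmpleBundle.res M h x = ∑ i, c i • rt M V (s i) ∧ y = ∑ i, c i • rt N V (t i))
      (by
        rintro V V' hV hV' _ _ ⟨c, hc, rfl⟩ ⟨d, hd, rfl⟩
        rw [res_sum, res_sum]
        simp only [res_res]
        apply key
        have h1 := congrArg (AmpleBundle.res M (inf_le_left : V ⊓ V' ≤ V)) hc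
        have h2 := congrArg (AmpleBundle.res M (inf_le_right : V ⊓ V' ≤ V')) hd
        rw [res_sum] at h1 h2
        simp only [res_res] at h1 h2
        rw [← h1, ← h2])
      (fun p hp => by
        obtain ⟨V, hV, hpV, c, hc⟩ := hs U x p hp
        exact ⟨V, hV, hpV, _, c, hc, rfl⟩)
    exact ⟨y, fun V h c hc => hy V h _ ⟨c, hc, rfl⟩⟩
  choose φ hφ using ex
  have uniq : ∀ (U : X.Opens) (x : Γ(M, U)) (y : Γ(N, U)),
      (∀ p ∈ U, ∃ (V : X.Opens) (h : V ≤ U), p ∈ V ∧ ∃ (c : ι → Γ(X, V)),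
        AmpleBundle.res M h x = ∑ i, c i • rt M V (s i) ∧
        AmpleBundle.res N h y = ∑ i, c i • rt N V (t i)) → φ U x = y := by
    intro U x y H
    refine section_ext fun p hp => ?_
    obtain ⟨V, h, hpV, c, hc, hd⟩ := H p hp
    exact ⟨V, h, hpV, by rw [hφ U x V h c hc, hd]⟩
  refine ⟨mkHom φ ?_ ?_ ?_, fun i => ?_⟩
  · intro U x y
    refine uniq _ _ _ fun p hp => ?_
    obtain ⟨V, hV, hpV, c, hc⟩ := hs U x p hp
    obtain ⟨V', hV', hpV', d, hd⟩ := hs U y p hp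
    have h1 := congrArg (AmpleBundle.res M (inf_le_left : V ⊓ V' ≤ V)) hc
    have h2 := congrArg (AmpleBundle.res M (inf_le_right : V ⊓ V' ≤ V')) hd
    rw [res_sum] at h1 h2
    simp only [res_res] at h1 h2
    refine ⟨V ⊓ V', inf_le_left.trans hV, ⟨hpV, hpV'⟩,
      fun i => rs inf_le_left (c i) + rs inf_le_right (d i), ?_, ?_⟩
    · simp only [map_add, add_smul, Finset.sum_add_distrib, h1, h2]
    · rw [map_add, hφ U x _ _ _ h1, hφ U y _ _ _ h2]
      simp only [add_smul, Finset.sum_add_distrib]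
  · intro U r x
    refine uniq _ _ _ fun p hp => ?_
    obtain ⟨V, hV, hpV, c, hc⟩ := hs U x p hp
    refine ⟨V, hV, hpV, fun i => rs hV r * c i, ?_, ?_⟩
    · rw [res_smul, hc, Finset.smul_sum]; simp only [mul_smul]
    · rw [res_smul, hφ U x _ _ _ hc, Finset.smul_sum]; simp only [mul_smul]
  · intro U V h x
    refine uniq _ _ _ fun p hp => ?_
    obtain ⟨W, hW, hpW, c, hc⟩ := hs V (AmpleBundle.res M h x) p hp
    refine ⟨W, hW, hpW, c, hc, ?_⟩
    rw [res_res] at hc ⊢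
    exact hφ U x W _ c hc
  · classical
    refine uniq _ _ _ fun p hp => ⟨⊤, le_rfl, hp, fun j => if j = i then 1 else 0, ?_, ?_⟩ <;>
    simp

end Generators

end

end AmpleBundle

namespace AmpleBundle

noncomputable section

/-! ### Local bases of vector bundles and line bundles. -/

section LocalBases

variable {X : Scheme.{u}} {κ : Type*} [Fintype κ]

/-- The sections `e k` form a basis of `M` over the open subset `U`. -/
def IsBasisOn (M : X.Modules) (U : X.Opens) (e : κ → Γ(M, U)) : Prop :=
  ∀ (V : X.Opens) (h : V ≤ U), Function.Bijective
    fun c : κ → Γ(X, V) => ∑ k, c k • res M h (e k)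

lemma IsBasisOn.restrict {M : X.Modules} {U V : X.Opens} {e : κ → Γ(M, U)}
    (he : IsBasisOn M U e) (h : V ≤ U) : IsBasisOn M V fun k => res M h (e k) := by
  intro W hW
  simpa only [res_res] using he W (hW.trans h)

lemma IsBasisOn.exists_coords {M : X.Modules} {U V : X.Opens} {e : κ → Γ(M, U)}
    (he : IsBasisOn M U e) (h : V ≤ U) (x : Γ(M, V)) :
    ∃ c : κ → Γ(X, V), x = ∑ k, c k • res M h (e k) :=
  let ⟨c, hc⟩ := (he V h).2 x
  ⟨c, hc.symm⟩

lemma IsBasisOn.coords_unique {M : X.Modules} {U V : X.Opens} {e : κ → Γ(M, U)}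
    (he : IsBasisOn M U e) (h : V ≤ U) {c d : κ → Γ(X, V)}
    (hcd : ∑ k, c k • res M h (e k) = ∑ k, d k • res M h (e k)) : c = d :=
  (he V h).1 hcd

/-- Sections of the structure module are functions. -/
def unitEquiv (X : Scheme.{u}) (U : X.Opens) : Γ(structureModule X, U) ≃+ Γ(X, U) where
  toFun x := x
  invFun x := x
  left_inv _ := rfl
  right_inv _ := rfl
  map_add' _ _ := rfl

lemma unitEquiv_smul {U : X.Opens} (r : Γ(X, U)) (x : Γ(structureModule X, U)) :
    unitEquiv X U (r • x) = r * unitEquiv X U x := rfl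

lemma unitEquiv_res {U V : X.Opens} (h : V ≤ U) (x : Γ(structureModule X, U)) :
    unitEquiv X V (res (structureModule X) h x) = rs h (unitEquiv X U x) := rfl

lemma unitEquiv_symm_res {U V : X.Opens} (h : V ≤ U) (x : Γ(X, U)) :
    res (structureModule X) h ((unitEquiv X U).symm x) = (unitEquiv X V).symm (rs h x) := rfl

lemma unitEquiv_symm_smul {U : X.Opens} (r x : Γ(X, U)) :
    r • (unitEquiv X U).symm x = (unitEquiv X U).symm (r * x) := rfl

/-- Sections of a restriction are sections over the image. -/
def restrictEquiv {Y : Scheme.{u}} (f : Y ⟶ X) [IsOpenImmersion f] (M : X.Modules) (W : Y.Opens) :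
    Γ(M.restrict f, W) ≃+ Γ(M, f ''ᵁ W) where
  toFun x := x
  invFun x := x
  left_inv _ := rfl
  right_inv _ := rfl
  map_add' _ _ := rfl

lemma restrictEquiv_smul {Y : Scheme.{u}} (f : Y ⟶ X) [IsOpenImmersion f] (M : X.Modules)
    (W : Y.Opens) (r : Γ(Y, W)) (x : Γ(M.restrict f, W)) :
    restrictEquiv f M W (r • x) = (f.appIso W).inv r • restrictEquiv f M W x := rfl

lemma restrictEquiv_res {Y : Scheme.{u}} (f : Y ⟶ X) [IsOpenImmersion f] (M : X.Modules)
    {W W' : Y.Opens} (h : W' ≤ W) (x : Γ(M.restrict f, W)) :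
    restrictEquiv f M W' (res _ h x) = res M (f.image_mono h) (restrictEquiv f M W x) := rfl

lemma appIso_inv_rs {Y : Scheme.{u}} (f : Y ⟶ X) [IsOpenImmersion f] {W W' : Y.Opens}
    (h : W' ≤ W) (r : Γ(Y, W)) :
    (f.appIso W').inv (rs h r) = rs (f.image_mono h) ((f.appIso W).inv r) :=
  ConcreteCategory.congr_hom (f.appIso_inv_naturality (homOfLE h).op) r

/-- The free module on a set of generators. -/
def freeModule (X : Scheme.{u}) (κ : Type u) : X.Modules :=
  SheafOfModules.free (R := X.ringCatSheaf) κ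

/-- The coproduct of finitely many copies of the structure sheaf has a basis of global sections. -/
lemma exists_isBasisOn_free (X : Scheme.{u}) (κ : Type u) [Fintype κ] :
    ∃ e : κ → Γ(freeModule X κ, ⊤), IsBasisOn (freeModule X κ) ⊤ e := by
  classical
  let F : X.Modules := freeModule X κ
  let ι : ∀ _ : κ, structureModule X ⟶ F :=
    fun k => SheafOfModules.ιFree (R := X.ringCatSheaf) k
  -- Sections of a coproduct of sheaves are not directly accessible. For finite `κ` the coproduct is
  -- a biproduct, and these projections read off coordinates.
  let π : ∀ _ : κ, F ⟶ structureModule X := fun k =>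
    Cofan.IsColimit.desc (SheafOfModules.isColimitFreeCofan (R := X.ringCatSheaf) κ)
      fun j => if j = k then 𝟙 (structureModule X) else (0 : structureModule X ⟶ structureModule X)
  have hπ : ∀ j k, ι j ≫ π k = if j = k then 𝟙 _ else 0 := fun j k =>
    Cofan.IsColimit.fac (SheafOfModules.isColimitFreeCofan (R := X.ringCatSheaf) κ)
      (fun j => if j = k then 𝟙 (structureModule X) else (0 : structureModule X ⟶ structureModule X)) j
  have hsum : ∑ k, π k ≫ ι k = 𝟙 F := by
    refine Cofan.IsColimit.hom_ext (SheafOfModules.isColimitFreeCofan (R := X.ringCatSheaf) κ)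
      _ _ fun j => ?_
    change ι j ≫ (∑ k, π k ≫ ι k) = ι j ≫ 𝟙 F
    rw [Preadditive.comp_sum]
    simp only [← Category.assoc, hπ]
    rw [Finset.sum_eq_single j]
    · simp
    · intro k _ hk
      simp [hk.symm]
    · simp
  let one : ∀ U : X.Opens, Γ(structureModule X, U) := fun U => (unitEquiv X U).symm 1
  have hone : ∀ (U : X.Opens) (c : Γ(structureModule X, U)), c = unitEquiv X U c • one U := by
    intro U c
    rw [unitEquiv_symm_smul, mul_one, AddEquiv.symm_apply_apply]
  have hres : ∀ U : X.Opens, rt (structureModule X) U (one ⊤) = one U := by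
    intro U
    rw [rt, unitEquiv_symm_res, map_one]
  have app_sum' : ∀ (U : X.Opens) (s : Finset κ) (φ : κ → (F ⟶ F)) (x : Γ(F, U)),
      (∑ k ∈ s, φ k).app U x = ∑ k ∈ s, (φ k).app U x := by
    intro U s φ x
    induction s using Finset.induction_on with
    | empty => simp
    | insert a s ha ih =>
      rw [Finset.sum_insert ha, Finset.sum_insert ha, ← ih]; rfl
  have hcoord : ∀ (V : X.Opens) (c : κ → Γ(X, V)) (j : κ),
      unitEquiv X V ((π j).app V (∑ k, c k • rt F V ((ι k).app ⊤ (one ⊤)))) = c j := by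
    intro V c j
    rw [app_sum, Finset.sum_eq_single j]
    · rw [← app_rt, hres]
      have := congrArg (fun f => Scheme.Modules.Hom.app f V (one V)) (hπ j j)
      simp only [if_true] at this
      change (π j).app V ((ι j).app V (one V)) = one V at this
      rw [this, unitEquiv_smul, AddEquiv.apply_symm_apply, mul_one]
    · intro k _ hk
      rw [← app_rt, hres]
      have := congrArg (fun f => Scheme.Modules.Hom.app f V (one V)) (hπ k j)
      rw [if_neg hk] at this
      change (π j).app V ((ι k).app V (one V)) = 0 at this
      rw [this, smul_zero]
    · simp
  refine ⟨fun k => (ι k).app ⊤ (one ⊤), fun V h => ⟨fun c d hcd => ?_, fun x => ?_⟩⟩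
  · funext j
    have := congrArg (fun y => unitEquiv X V ((π j).app V y)) hcd
    exact (hcoord V c j).symm.trans (this.trans (hcoord V d j))
  · refine ⟨fun k => unitEquiv X V ((π k).app V x), ?_⟩
    have h1 := congrArg (fun f => Scheme.Modules.Hom.app f V x) hsum
    refine Eq.trans ?_ h1
    rw [app_sum']
    refine Finset.sum_congr rfl fun k _ => ?_
    change unitEquiv X V ((π k).app V x) • rt F V ((ι k).app ⊤ (one ⊤)) = _
    rw [← app_rt, hres]
    change _ = (ι k).app V ((π k).app V x)
    rw [← Scheme.Modules.Hom.app_smul, ← hone]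

lemma exists_isBasisOn_of_restrict_iso {M : X.Modules} {U : X.Opens} {N : U.toScheme.Modules}
    (φ : M.restrict U.ι ≅ N) {f : κ → Γ(N, ⊤)} (hf : IsBasisOn N ⊤ f) :
    ∃ e : κ → Γ(M, U), IsBasisOn M U e := by
  have hU : U ≤ U.ι ''ᵁ ⊤ := by simp
  have hmap : ∀ (W : U.toScheme.Opens), U.ι ''ᵁ W ≤ U.ι ''ᵁ ⊤ :=
    fun W => Scheme.Hom.image_mono _ le_top
  let e : κ → Γ(M, U) := fun k => res M hU (restrictEquiv U.ι M ⊤ (φ.inv.app ⊤ (f k)))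
  refine ⟨e, fun V hV => ?_⟩
  obtain ⟨W, rfl⟩ : ∃ W : U.toScheme.Opens, U.ι ''ᵁ W = V :=
    ⟨U.ι ⁻¹ᵁ V, by simp [Scheme.Hom.image_preimage_eq_opensRange_inf, hV]⟩
  have key : (fun c : κ → Γ(X, U.ι ''ᵁ W) => ∑ k, c k • res M hV (e k)) =
      restrictEquiv U.ι M W ∘ (fun y => φ.inv.app W y) ∘
      (fun c : κ → Γ(U.toScheme, W) => ∑ k, c k • res N le_top (f k)) ∘
        fun c k => (U.ι.appIso W).hom (c k) := by
    funext c
    simp only [Function.comp]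
    rw [app_sum, map_sum]
    refine Finset.sum_congr rfl fun k _ => ?_
    rw [restrictEquiv_smul, app_res, restrictEquiv_res, res_res]
    congr 1
    exact ((U.ι.appIso W).hom_inv_id_apply (c k)).symm
  rw [key]
  refine (restrictEquiv U.ι M W).bijective.comp (Function.Bijective.comp ?_ ((hf W le_top).comp ?_))
  · exact ConcreteCategory.bijective_of_isIso (φ.inv.app W)
  · refine Function.Bijective.piMap fun k => ?_
    exact ConcreteCategory.bijective_of_isIso (U.ι.appIso W).hom

lemma IsVectorBundle.exists_isBasisOn {E : X.Modules} (hE : IsVectorBundle E) (x : X) :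
    ∃ (U : X.Opens) (_ : x ∈ U) (r : ℕ) (e : ULift.{u} (Fin r) → Γ(E, U)), IsBasisOn E U e := by
  obtain ⟨U, hx, r, ⟨φ⟩⟩ := hE x
  obtain ⟨f, hf⟩ := exists_isBasisOn_free U.toScheme (ULift.{u} (Fin r))
  obtain ⟨e, he⟩ := exists_isBasisOn_of_restrict_iso φ hf
  exact ⟨U, hx, r, e, he⟩

lemma IsLineBundle.exists_isBasisOn {L : X.Modules} (hL : IsLineBundle L) (x : X) :
    ∃ (U : X.Opens) (_ : x ∈ U) (t : Γ(L, U)), IsBasisOn L U fun _ : Unit => t := by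
  obtain ⟨U, hx, ⟨φ⟩⟩ := hL x
  have hf : IsBasisOn (structureModule U.toScheme) ⊤
      fun _ : Unit => (unitEquiv U.toScheme ⊤).symm 1 := by
    intro V hV
    have : (fun c : Unit → Γ(U.toScheme, V) => ∑ k, c k • res (structureModule U.toScheme) hV
        ((unitEquiv U.toScheme ⊤).symm 1)) = fun c => (unitEquiv U.toScheme V).symm (c ()) := by
      funext c
      rw [Fintype.sum_unique, unitEquiv_symm_res, map_one, unitEquiv_symm_smul, mul_one]
    rw [this]
    exact (unitEquiv U.toScheme V).symm.bijective.comp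
      ⟨fun c d h => funext fun _ => h, fun x => ⟨fun _ => x, rfl⟩⟩
  obtain ⟨e, he⟩ := exists_isBasisOn_of_restrict_iso φ hf
  exact ⟨U, hx, e (), he⟩

/-- The trivialization over `U` is multiplication by the basis section, `1 ↦ t`. -/
lemma isLineBundle_of_isBasisOn {L : X.Modules}
    (hL : ∀ x : X, ∃ (U : X.Opens) (_ : x ∈ U) (t : Γ(L, U)), IsBasisOn L U fun _ : Unit => t) :
    IsLineBundle L := by
  intro x
  obtain ⟨U, hx, t, ht⟩ := hL x
  refine ⟨U, hx, ⟨?_⟩⟩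
  have hU : ∀ W : U.toScheme.Opens, U.ι ''ᵁ W ≤ U := fun W => by
    rintro _ ⟨y, -, rfl⟩; exact y.2
  let ψ : structureModule U.toScheme ⟶ L.restrict U.ι :=
    mkHom (fun W r => (restrictEquiv U.ι L W).symm
        ((U.ι.appIso W).inv (unitEquiv U.toScheme W r) • res L (hU W) t))
      (fun W a b => by
        rw [map_add, map_add, add_smul, map_add])
      (fun W r a => by
        apply (restrictEquiv U.ι L W).injective
        rw [restrictEquiv_smul, AddEquiv.apply_symm_apply, AddEquiv.apply_symm_apply,
          unitEquiv_smul, map_mul, mul_smul])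
      (fun W W' h a => by
        apply (restrictEquiv U.ι L W').injective
        rw [restrictEquiv_res, AddEquiv.apply_symm_apply, AddEquiv.apply_symm_apply,
          unitEquiv_res, appIso_inv_rs, res_smul, res_res])
  have : IsIso ψ := by
    rw [Scheme.Modules.Hom.isIso_iff_isIso_app]
    intro W
    rw [ConcreteCategory.isIso_iff_bijective]
    have h1 := ht (U.ι ''ᵁ W) (hU W)
    have h2 : (fun y => ψ.app W y) = (restrictEquiv U.ι L W).symm ∘
        (fun c : Unit → Γ(X, U.ι ''ᵁ W) => ∑ k, c k • res L (hU W) t) ∘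
        (fun y => fun _ : Unit => y) ∘ (fun y => (U.ι.appIso W).inv y) ∘ unitEquiv U.toScheme W := by
      funext y
      simp only [Function.comp, Fintype.sum_unique]
      rfl
    change Function.Bijective fun y => ψ.app W y
    rw [h2]
    refine (restrictEquiv U.ι L W).symm.bijective.comp (h1.comp (Function.Bijective.comp ?_
      (Function.Bijective.comp ?_ (unitEquiv U.toScheme W).bijective)))
    · exact ⟨fun a b h => congrFun h (), fun f => ⟨f (), rfl⟩⟩
    · exact ConcreteCategory.bijective_of_isIso (U.ι.appIso W).inv
  exact (asIso ψ).symm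

end LocalBases

end

end AmpleBundle

namespace AmpleBundle

noncomputable section

/-! ### Morphisms to pushforwards of structure sheaves. -/

section Pushforward

variable {X Y : Scheme.{u}}

/-- Sections of a pushforward are sections over the preimage. -/
def pushEquiv (f : X ⟶ Y) (M : X.Modules) (W : Y.Opens) :
    Γ((Scheme.Modules.pushforward f).obj M, W) ≃+ Γ(M, f ⁻¹ᵁ W) where
  toFun x := x
  invFun x := x
  left_inv _ := rfl
  right_inv _ := rfl
  map_add' _ _ := rfl

lemma pushEquiv_smul (f : X ⟶ Y) (M : X.Modules) {W : Y.Opens} (r : Γ(Y, W))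
    (x : Γ((Scheme.Modules.pushforward f).obj M, W)) :
    pushEquiv f M W (r • x) = f.app W r • pushEquiv f M W x := rfl

lemma pushEquiv_res (f : X ⟶ Y) (M : X.Modules) {W W' : Y.Opens} (h : W' ≤ W)
    (x : Γ((Scheme.Modules.pushforward f).obj M, W)) :
    pushEquiv f M W' (res _ h x) = res M (f.preimage_mono h) (pushEquiv f M W x) := rfl

lemma app_rs (f : X ⟶ Y) {W W' : Y.Opens} (h : W' ≤ W) (r : Γ(Y, W)) :
    f.app W' (rs h r) = rs (f.preimage_mono h) (f.app W r) :=
  ConcreteCategory.congr_hom (f.naturality (homOfLE h).op) r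

/-- A module with a basis over `U ∋ x` has maps to the pushforward of the structure sheaf along
`ξ : S ⟶ X` with image in `U` with any prescribed values on the basis. -/
lemma IsBasisOn.exists_hom_pushforward {M : Y.Modules} {U : Y.Opens} {κ : Type*} [Fintype κ]
    {e : κ → Γ(M, U)} (he : IsBasisOn M U e) (f : X ⟶ Y) (hf : f ⁻¹ᵁ U = ⊤)
    (l : κ → Γ(X, ⊤)) :
    ∃ g : M ⟶ (Scheme.Modules.pushforward f).obj (structureModule X),
      ∀ (W : Y.Opens) (v : Γ(M, W)) (c : κ → Γ(Y, W ⊓ U)),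
        res M inf_le_left v = ∑ k, c k • res M inf_le_right (e k) →
        rs (f.preimage_mono inf_le_left)
            (unitEquiv X _ (pushEquiv f (structureModule X) W (g.app W v))) =
          ∑ k, f.app (W ⊓ U) (c k) * rs le_top (l k) := by
  -- As `f` lands in `U`, functions on the preimages of `W` and of `W ⊓ U` are the same, so
  -- coordinates over `W ⊓ U` suffice to define the map on all of `M`.
  have hW : ∀ W : Y.Opens, f ⁻¹ᵁ W ≤ f ⁻¹ᵁ (W ⊓ U) := by
    intro W
    rw [Scheme.Hom.preimage_inf, hf, inf_top_eq]
  choose c hc using fun (W : Y.Opens) (v : Γ(M, W)) =>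
    he.exists_coords (inf_le_right : W ⊓ U ≤ U) (res M inf_le_left v)
  have huniq : ∀ (W : Y.Opens) (v : Γ(M, W)) (d : κ → Γ(Y, W ⊓ U)),
      res M inf_le_left v = ∑ k, d k • res M inf_le_right (e k) → c W v = d :=
    fun W v d hd => he.coords_unique _ ((hc W v).symm.trans hd)
  let φ : ∀ W : Y.Opens, Γ(M, W) → Γ(X, f ⁻¹ᵁ W) := fun W v =>
    rs (hW W) (∑ k, f.app (W ⊓ U) (c W v k) * rs le_top (l k))
  refine ⟨mkHom (fun W v => (pushEquiv f _ W).symm ((unitEquiv X _).symm (φ W v))) ?_ ?_ ?_, ?_⟩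
  · intro W x y
    have := huniq W (x + y) (fun k => c W x k + c W y k) (by
      rw [map_add, hc W x, hc W y]; simp only [add_smul, Finset.sum_add_distrib])
    rw [← map_add, ← map_add]
    congr 2
    simp only [φ, this, map_add, add_mul, Finset.sum_add_distrib]
  · intro W r x
    have := huniq W (r • x) (fun k => rs inf_le_left r * c W x k) (by
      rw [res_smul, hc W x, Finset.smul_sum]; simp only [mul_smul])
    apply (pushEquiv f _ W).injective
    rw [pushEquiv_smul, AddEquiv.apply_symm_apply, AddEquiv.apply_symm_apply, unitEquiv_symm_smul]
    congr 1
    simp only [φ, this, map_mul, mul_assoc, ← Finset.mul_sum]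
    congr 1
    rw [app_rs, rs_rs, rs_refl]
  · intro W W' h x
    have := huniq W' (res M h x) (fun k => rs (inf_le_inf_right U h) (c W x k)) (by
      have := congrArg (res M (inf_le_inf_right U h)) (hc W x)
      rw [res_sum, res_res] at this
      rw [res_res]
      simpa only [res_res] using this)
    apply (pushEquiv f _ W').injective
    rw [pushEquiv_res, AddEquiv.apply_symm_apply, AddEquiv.apply_symm_apply, unitEquiv_symm_res]
    congr 1
    simp only [φ, this, rs_rs, app_rs, map_sum, map_mul]
  · intro W v d hd
    have hd := huniq W v d hd
    change rs _ (φ W v) = _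
    simp only [φ, rs_rs, rs_refl, hd]

end Pushforward

/-! ### Nakayama's lemma for jointly epimorphic sections. -/

section Nakayama

variable {X : Scheme.{u}} {I : Type*}

/-- Morphisms out of `M` are determined by their values on the global sections `s i`. -/
def IsJointlyEpi (M : X.Modules) (s : I → Γ(M, ⊤)) : Prop :=
  ∀ (N : X.Modules) (g h : M ⟶ N), (∀ i, g.app ⊤ (s i) = h.app ⊤ (s i)) → g = h

/-- If the vectors `w i` span `K ^ κ`, some of them form an invertible square matrix. -/
lemma exists_det_ne_zero {K κ : Type*} [Field K] [Fintype κ] [DecidableEq κ] (w : I → κ → K)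
    (hw : Submodule.span K (Set.range w) = ⊤) :
    ∃ b : κ → I, (Matrix.of fun k => w (b k)).det ≠ 0 := by
  obtain ⟨s, hs, hsp, hli⟩ := exists_linearIndependent K (Set.range w)
  let B : Module.Basis s K (κ → K) := Module.Basis.mk hli (by
    rw [Subtype.range_coe, hsp, hw])
  have hfin : Finite s := Module.Finite.finite_basis B
  have := Fintype.ofFinite s
  have hcard : Fintype.card κ = Fintype.card s := by
    rw [← Module.finrank_eq_card_basis B, Module.finrank_fintype_fun_eq_card]
  let σ : κ ≃ s := Fintype.equivOfCardEq hcard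
  choose b hb using fun k => hs (σ k).2
  refine ⟨b, ?_⟩
  have : LinearIndependent K fun k => (Matrix.of fun k => w (b k)) k := by
    have h2 : (fun k => (Matrix.of fun k => w (b k)) k) = Subtype.val ∘ σ := funext hb
    rw [h2]
    exact hli.comp σ σ.injective
  have h3 := Matrix.linearIndependent_rows_iff_isUnit.mp this
  rw [Matrix.isUnit_iff_isUnit_det] at h3
  exact h3.ne_zero

/-- A proper subspace lies in the kernel of a nonzero functional, and `l` is that functional in
coordinates. It supplies the test morphism in the second case of `IsJointlyEpi.exists_combination`.
-/
lemma exists_dual_vector {K κ : Type*} [Field K] [Fintype κ] (w : I → κ → K)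
    (hw : Submodule.span K (Set.range w) ≠ ⊤) :
    ∃ l : κ → K, l ≠ 0 ∧ ∀ i, ∑ k, w i k * l k = 0 := by
  classical
  obtain ⟨f, hf, hle⟩ := Submodule.exists_le_ker_of_lt_top _ (lt_top_iff_ne_top.mpr hw)
  refine ⟨fun k => f (Pi.single k 1), fun h => hf ?_, fun i => ?_⟩
  · refine LinearMap.pi_ext' fun k => LinearMap.ext_ring ?_
    exact congrFun h k
  · have : f (w i) = 0 := hle (Submodule.subset_span ⟨i, rfl⟩)
    rw [← this]
    conv_rhs => rw [pi_eq_sum_univ' (w i), map_sum]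
    refine Finset.sum_congr rfl fun k _ => ?_
    rw [map_smul, smul_eq_mul]

/-- A version of Nakayama's lemma: near every point, a local basis is a linear combination of
finitely many sections from a jointly epimorphic family. -/
lemma IsJointlyEpi.exists_combination {M : X.Modules} {s : I → Γ(M, ⊤)} (hs : IsJointlyEpi M s)
    {U : X.Opens} {κ : Type*} [Fintype κ] {e : κ → Γ(M, U)} (he : IsBasisOn M U e)
    (x : X) (hx : x ∈ U) :
    ∃ (V : X.Opens) (h : V ≤ U) (_ : x ∈ V) (b : κ → I) (R : κ → κ → Γ(X, V)),
      ∀ k, res M h (e k) = ∑ l, R k l • rt M V (s (b l)) := by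
  classical
  choose c hc using fun i => he.exists_coords le_rfl (rt M U (s i))
  simp only [res_refl] at hc
  let ξ := X.fromSpecResidueField x
  let S := Spec (X.residueField x)
  have hξ : ξ ⁻¹ᵁ U = ⊤ := by
    apply top_unique
    intro p _
    have : ξ p ∈ Set.range ξ := ⟨p, rfl⟩
    rw [Scheme.range_fromSpecResidueField] at this
    change ξ p ∈ U
    rw [Set.mem_singleton_iff.mp this]
    exact hx
  let ε : Γ(S, ⊤) ≃+* X.residueField x :=
    (Scheme.ΓSpecIso (X.residueField x)).commRingCatIsoToRingEquiv
  -- Evaluation at `x`, written as pullback along `Spec κ(x) ⟶ X`.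
  let ev : Γ(X, U) →+* X.residueField x :=
    (ε : Γ(S, ⊤) →+* _).comp ((rs (X := S) hξ.ge).comp (ξ.app U).hom)
  have hev : ∀ a, ev a ≠ 0 → x ∈ X.basicOpen a := by
    intro a ha
    by_contra hxa
    apply ha
    have h1 : ξ ⁻¹ᵁ X.basicOpen a = ⊥ := by
      apply bot_unique
      intro p hp
      have : ξ p ∈ Set.range ξ := ⟨p, rfl⟩
      rw [Scheme.range_fromSpecResidueField] at this
      have h2 : ξ p ∈ X.basicOpen a := hp
      rw [Set.mem_singleton_iff.mp this] at h2
      exact (hxa h2).elim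
    rw [Scheme.preimage_basicOpen] at h1
    have h3 : ¬ IsUnit (ev a) := by
      intro hu
      have h4 : IsUnit (rs (X := S) hξ.ge (ξ.app U a)) :=
        (MulEquiv.isUnit_map (ε : Γ(S, ⊤) ≃* X.residueField x)).mp hu
      have h5 : S.basicOpen (rs (X := S) hξ.ge (ξ.app U a)) = ⊥ := by
        rw [eq_bot_iff, ← h1]
        exact (S.basicOpen_res _ _).le.trans inf_le_right
      rw [S.basicOpen_of_isUnit h4] at h5
      have : (IsLocalRing.closedPoint (X.residueField x) : S) ∈ (⊥ : S.Opens) := by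
        rw [← h5]; trivial
      exact this
    rwa [isUnit_iff_ne_zero, not_not] at h3
  -- If the values of the sections span the fibre at `x`, some square coordinate matrix has
  -- determinant nonzero at `x`, and it is invertible on the basic open set of that determinant.
  by_cases hw : Submodule.span (X.residueField x) (Set.range fun i k => ev (c i k)) = ⊤
  · obtain ⟨b, hb⟩ := exists_det_ne_zero _ hw
    let A : Matrix κ κ Γ(X, U) := Matrix.of fun k l => c (b k) l
    have hA : ev A.det ≠ 0 := by
      rw [RingHom.map_det]
      exact hb
    let V := X.basicOpen A.det
    have hVU : V ≤ U := X.basicOpen_le _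
    have hunit : IsUnit (A.map (rs hVU)) := by
      rw [Matrix.isUnit_iff_isUnit_det]
      have := RingHom.map_det (rs hVU) A
      rw [RingHom.mapMatrix_apply] at this
      rw [← this]
      exact X.toRingedSpace.isUnit_res_basicOpen A.det
    obtain ⟨R, hR⟩ := hunit.exists_left_inv
    refine ⟨V, hVU, hev _ hA, b, R, fun k => ?_⟩
    have h1 : ∀ l, rt M V (s (b l)) = ∑ m, A.map (rs hVU) l m • res M hVU (e m) := by
      intro l
      rw [← res_rt hVU, hc, res_sum]
      rfl
    simp only [h1, Finset.smul_sum]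
    rw [Finset.sum_comm]
    have h2 : ∀ m, ∑ l, R k l • A.map (rs hVU) l m • res M hVU (e m) =
        (if k = m then (1 : Γ(X, V)) else 0) • res M hVU (e m) := by
      intro m
      simp only [← mul_smul, ← Finset.sum_smul]
      rw [← Matrix.mul_apply, hR, Matrix.one_apply]
    simp only [h2]
    simp
  -- Otherwise a nonzero functional on the fibre kills every value of `s`. It extends to a morphism
  -- to the pushforward of the structure sheaf of `Spec κ(x)`; this morphism vanishes on every `s
  -- i`, hence is zero by joint epimorphy.
  · exfalso
    obtain ⟨l, hl, hl0⟩ := exists_dual_vector _ hw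
    obtain ⟨g, hg⟩ := he.exists_hom_pushforward ξ hξ fun k => ε.symm (l k)
    have hg0 : g = 0 := by
      apply hs
      intro i
      apply (pushEquiv ξ (structureModule S) ⊤).injective
      apply (unitEquiv S _).injective
      have htop : ∀ W : X.Opens, ξ ⁻¹ᵁ W ≤ ξ ⁻¹ᵁ (W ⊓ U) := by
        intro W
        rw [Scheme.Hom.preimage_inf, hξ, inf_top_eq]
      have h1 := hg ⊤ (s i) (fun k => rs inf_le_right (c i k)) (by
        have := congrArg (res M (inf_le_right : ⊤ ⊓ U ≤ U)) (hc i)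
        rw [res_rt, res_sum] at this
        exact this)
      have h2 : (0 : M ⟶ (Scheme.Modules.pushforward ξ).obj (structureModule S)).app ⊤ (s i) = 0 :=
        rfl
      rw [h2, map_zero, map_zero]
      have h3 := congrArg (rs (htop ⊤)) h1
      rw [rs_rs, rs_refl] at h3
      rw [h3]
      have h4 : ∑ k, rs (X := S) hξ.ge (ξ.app U (c i k)) * ε.symm (l k) = 0 := by
        apply ε.injective
        rw [map_sum, map_zero, ← hl0 i]
        refine Finset.sum_congr rfl fun k _ => ?_
        rw [map_mul, RingEquiv.apply_symm_apply]
        rfl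
      have h5 := congrArg (rs (le_top : ξ ⁻¹ᵁ (⊤ ⊓ U) ≤ ⊤)) h4
      rw [map_zero, map_sum] at h5
      rw [← map_zero (rs (htop ⊤)), ← h5]
      congr 1
      refine Finset.sum_congr rfl fun k _ => ?_
      rw [app_rs, map_mul, rs_rs]
    apply hl
    funext k
    -- Yet the morphism takes the value `l k` on `e k`, so `l` would vanish.
    have h1 := hg U (e k) (fun j => if j = k then 1 else 0) (by simp)
    have h2 : (0 : M ⟶ (Scheme.Modules.pushforward ξ).obj (structureModule S)).app U (e k) = 0 :=
      rfl
    rw [hg0, h2, map_zero, map_zero, map_zero, Finset.sum_eq_single k] at h1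
    · rw [if_pos rfl, map_one, one_mul] at h1
      have hle : ⊤ ≤ ξ ⁻¹ᵁ (U ⊓ U) := by rw [inf_idem, hξ]
      have h3 := congrArg (rs hle) h1
      rw [rs_rs, rs_refl, map_zero] at h3
      have h4 := congrArg ε h3
      rw [map_zero, RingEquiv.apply_symm_apply] at h4
      exact h4.symm
    · intro j _ hj
      simp [hj]
    · simp

end Nakayama

end

end AmpleBundle

namespace AmpleBundle

noncomputable section

/-! ### From global generation to finitely many generators. -/

section GlobalGeneration

variable {X : Scheme.{u}} {I : Type*}

lemma IsGen.isJointlyEpi {ι : Type*} [Fintype ι] {M : X.Modules} {s : ι → Γ(M, ⊤)}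
    (hs : IsGen M s) : IsJointlyEpi M s :=
  fun _ _ _ h => hs.hom_ext h

/-- A morphism out of a free module is the family of images of its generators, so right cancellation
by the epimorphism onto `E` becomes cancellation on sections. -/
lemma IsGloballyGenerated.exists_isJointlyEpi {E : X.Modules} (hE : IsGloballyGenerated E) :
    ∃ (I : Type u) (s : I → Γ(E, ⊤)), IsJointlyEpi E s := by
  obtain ⟨σ⟩ := hE
  let v : ∀ (_ : σ.I) (U : X.Opens), Γ(E, U) := fun i U => (σ.s i).val (op U)
  have hval : ∀ (i : σ.I) (U : X.Opens), v i U = rt E U (v i ⊤) :=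
    fun i U => ((σ.s i).property (homOfLE (le_top : U ≤ ⊤)).op).symm
  refine ⟨σ.I, fun i => v i ⊤, fun N g h H => ?_⟩
  refine σ.epi.left_cancellation (Z := N) g h ?_
  apply (SheafOfModules.freeHomEquiv (R := X.ringCatSheaf) N).injective
  funext i
  have hmap : ∀ g : SheafOfModules.Hom E N, SheafOfModules.freeHomEquiv (R := X.ringCatSheaf) N
      (σ.π ≫ g) i = SheafOfModules.sectionsMap (R := X.ringCatSheaf) g (σ.s i) :=
    fun g => (SheafOfModules.freeHomEquiv_comp_apply σ.π g i).trans
      (congrArg _ (congrFun (Equiv.apply_symm_apply _ σ.s) i))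
  refine (hmap g).trans (Eq.trans ?_ (hmap h).symm)
  refine Subtype.ext (funext fun U => ?_)
  change g.app U.unop (v i U.unop) = h.app U.unop (v i U.unop)
  rw [hval, app_rt, app_rt]
  exact congrArg _ (H i)

/-- Near every point, one of the members of a jointly epimorphic family of sections of a line
bundle is a basis. -/
lemma IsLineBundle.exists_isBasisOn_of_isJointlyEpi {L : X.Modules} (hL : IsLineBundle L)
    {s : I → Γ(L, ⊤)} (hs : IsJointlyEpi L s) (x : X) :
    ∃ (V : X.Opens) (_ : x ∈ V) (i : I), IsBasisOn L V fun _ : Unit => rt L V (s i) := by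
  obtain ⟨U, hx, t, ht⟩ := hL.exists_isBasisOn x
  obtain ⟨V, hV, hxV, b, R, hR⟩ := hs.exists_combination ht x hx
  have ht' := ht.restrict hV
  obtain ⟨c, hc⟩ := ht'.exists_coords le_rfl (rt L V (s (b ())))
  simp only [Fintype.sum_unique, res_refl, Unique.eq_default] at hc
  have hR := hR ()
  simp only [Fintype.sum_unique, Unique.eq_default] at hR
  refine ⟨V, hxV, b default, fun W hW => ?_⟩
  -- Here `s = c t` and `t = R s`, so `c` is a unit and `s` is a basis along with `t`.
  have hunit : c default * R default default = 1 := by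
    have := ht'.coords_unique le_rfl (c := fun _ => R default default * c default)
      (d := fun _ => 1)
      (by
        simp only [Fintype.sum_unique, res_refl, one_smul, mul_smul]
        rw [← hc]
        exact hR.symm)
    rw [mul_comm]
    exact congrFun this ()
  have hu : (rs hW (c default)) * rs hW (R default default) = 1 := by
    rw [← map_mul, hunit, map_one]
  have h2 : (fun d : Unit → Γ(X, W) => ∑ k, d k • res L hW (rt L V (s (b default)))) =
      (fun d : Unit → Γ(X, W) => ∑ k, d k • res L hW (res L hV t)) ∘
      fun d k => d k * rs hW (c default) := by
    funext d
    simp only [Function.comp, Fintype.sum_unique, mul_smul]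
    rw [hc, res_smul]
  rw [h2]
  refine (ht' W hW).comp ⟨fun d d' h => funext fun k => ?_, fun d => ⟨fun k =>
    d k * rs hW (R default default), funext fun k => ?_⟩⟩
  · have := congrArg (· * rs hW (R default default)) (congrFun h k)
    simpa only [mul_assoc, hu, mul_one] using this
  · simp only [mul_assoc]
    rw [mul_comm (rs hW (R _ _)), hu, mul_one]

/-- The presentation of `M` by the generators `s` is locally split: the matrix `A` is the
composite of the quotient map `𝒪 ^ ι ⟶ M` with a section of it. -/
def IsLocallySplit {ι : Type*} [Fintype ι] (M : X.Modules) (s : ι → Γ(M, ⊤)) : Prop :=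
  ∀ x : X, ∃ (U : X.Opens) (_ : x ∈ U) (A : ι → ι → Γ(X, U)),
    (∀ i, rt M U (s i) = ∑ l, A i l • rt M U (s l)) ∧
    ∀ (V : X.Opens) (h : V ≤ U) (c : ι → Γ(X, V)), IsRel M s V c →
      ∀ l, ∑ i, c i * rs h (A i l) = 0

/-- Near each point a local basis involves only finitely many of the sections, by Nakayama, and
quasi-compactness leaves finitely many in total. This also upgrades the cancellation property
`IsJointlyEpi` to the expressibility property `IsGen`. -/
lemma IsVectorBundle.exists_finite_generators [CompactSpace X] {E : X.Modules}
    (hE : IsVectorBundle E) {s : I → Γ(E, ⊤)} (hs : IsJointlyEpi E s) :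
    ∃ J : Finset I, IsGen E (fun j : J => s j) ∧ IsLocallySplit E fun j : J => s j := by
  classical
  choose U hxU r e he using hE.exists_isBasisOn
  choose V hVU hxV b R hR using fun x => hs.exists_combination (he x) x (hxU x)
  obtain ⟨t, ht⟩ := CompactSpace.elim_nhds_subcover (fun x => (V x : Set X))
    fun x => (V x).isOpen.mem_nhds (hxV x)
  let J : Finset I := t.biUnion fun x => Finset.univ.image (b x)
  have key : ∀ y : X, ∃ (W : X.Opens) (_ : y ∈ W) (r : ℕ) (f : ULift.{u} (Fin r) → Γ(E, W))
      (T : ULift.{u} (Fin r) → J → Γ(X, W)), IsBasisOn E W f ∧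
      ∀ k, f k = ∑ j, T k j • rt E W (s j) := by
    intro y
    obtain ⟨x, hx, hy⟩ : ∃ x ∈ t, y ∈ V x := by
      have : y ∈ (⊤ : Set X) := trivial
      rw [← ht] at this
      simpa using this
    refine ⟨V x, hy, r x, fun k => res E (hVU x) (e x k),
      fun k j => ∑ l, if b x l = j then R x k l else 0, (he x).restrict _, fun k => ?_⟩
    beta_reduce
    rw [hR]
    simp only [Finset.sum_smul]
    rw [Finset.sum_comm]
    refine Finset.sum_congr rfl fun l _ => ?_
    rw [Finset.sum_eq_single ⟨b x l, Finset.mem_biUnion.mpr ⟨x, hx,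
      Finset.mem_image_of_mem _ (Finset.mem_univ _)⟩⟩]
    · simp
    · intro j _ hj
      rw [if_neg, zero_smul]
      exact fun h => hj (Subtype.ext h.symm)
    · simp
  refine ⟨J, fun W x p hp => ?_, fun x => ?_⟩
  · obtain ⟨W', hpW', r, f, T, hf, hT⟩ := key p
    obtain ⟨d, hd⟩ := hf.exists_coords (inf_le_right : W ⊓ W' ≤ W') (res E inf_le_left x)
    refine ⟨W ⊓ W', inf_le_left, ⟨hp, hpW'⟩, fun j => ∑ k, d k * rs inf_le_right (T k j), ?_⟩
    rw [hd]
    simp only [hT, res_sum, res_rt, Finset.smul_sum, Finset.sum_smul, mul_smul]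
    exact Finset.sum_comm
  · obtain ⟨W, hxW, r, f, T, hf, hT⟩ := key x
    choose c hc using fun j : J => hf.exists_coords le_rfl (rt E W (s j))
    -- `c` gives the coordinates of the generators in the basis `f`, and `T` expresses `f` by the
    -- generators. The product `c T` reproduces the generators, and it kills a relation `d` because
    -- `d c = 0` already.
    refine ⟨W, hxW, fun i l => ∑ k, c i k * T k l, fun i => ?_, fun V hV d hd l => ?_⟩
    · conv_lhs => rw [hc]
      simp only [res_refl, hT, Finset.smul_sum, Finset.sum_smul, mul_smul]
      exact Finset.sum_comm
    · have h1 : (fun k => ∑ i, d i * rs hV (c i k)) = 0 := by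
        apply hf.coords_unique hV
        simp only [Pi.zero_apply, zero_smul, Finset.sum_const_zero]
        refine Eq.trans ?_ hd
        simp only [Finset.sum_smul, mul_smul]
        rw [Finset.sum_comm]
        refine Finset.sum_congr rfl fun i _ => ?_
        rw [← res_rt hV, hc, res_sum, Finset.smul_sum]
        simp only [res_refl]
      simp only [map_sum, map_mul, Finset.mul_sum]
      rw [Finset.sum_comm]
      refine Finset.sum_eq_zero fun k _ => ?_
      have := congrFun h1 k
      simp only [← mul_assoc, ← Finset.sum_mul]
      simp only [Pi.zero_apply] at this
      rw [this, zero_mul]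

end GlobalGeneration

end

end AmpleBundle

namespace AmpleBundle

noncomputable section

/-! ### Morphisms out of pullbacks, through their adjoints. -/

section PullbackSections

variable {X Y Z : Scheme.{u}}

/-- The value over `U` of the adjoint `E ⟶ f_* M` of a morphism `f^* E ⟶ M`. -/
def pullSec (f : X ⟶ Y) {E : Y.Modules} {M : X.Modules} (q : (Scheme.Modules.pullback f).obj E ⟶ M)
    (U : Y.Opens) (s : Γ(E, U)) : Γ(M, f ⁻¹ᵁ U) :=
  pushEquiv f M U
    ((((Scheme.Modules.pullbackPushforwardAdjunction f).homEquiv E M q).app U) s)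

/-- Global sections over the preimage of the whole space. -/
def topEquiv (f : X ⟶ Y) (M : X.Modules) : Γ(M, f ⁻¹ᵁ ⊤) ≃+ Γ(M, ⊤) where
  toFun x := x
  invFun x := x
  left_inv _ := rfl
  right_inv _ := rfl
  map_add' _ _ := rfl

lemma topEquiv_apply (f : X ⟶ Y) (M : X.Modules) (x : Γ(M, f ⁻¹ᵁ ⊤)) (h : ⊤ ≤ f ⁻¹ᵁ ⊤) :
    topEquiv f M x = res M h x := (res_refl (M := M) (U := ⊤) le_rfl x).symm

/-- The global section of `M` defined by a global section of `E` and a morphism `f^* E ⟶ M`. -/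
def pullTop (f : X ⟶ Y) {E : Y.Modules} {M : X.Modules} (q : (Scheme.Modules.pullback f).obj E ⟶ M)
    (s : Γ(E, ⊤)) : Γ(M, ⊤) :=
  topEquiv f M (pullSec f q ⊤ s)

lemma pullTop_eq (f : X ⟶ Y) {E : Y.Modules} {M : X.Modules}
    (q : (Scheme.Modules.pullback f).obj E ⟶ M) (s : Γ(E, ⊤)) :
    pullTop f q s = res M (le_of_eq (by rfl)) (pullSec f q ⊤ s) :=
  topEquiv_apply _ _ _ _

lemma res_pullSec (f : X ⟶ Y) {E : Y.Modules} {M : X.Modules}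
    (q : (Scheme.Modules.pullback f).obj E ⟶ M) (U : Y.Opens) (s : Γ(E, ⊤)) :
    pullSec f q U (rt E U s) = rt M (f ⁻¹ᵁ U) (pullTop f q s) := by
  rw [pullTop_eq, pullSec, app_rt, pushEquiv_res, rt, res_res]
  rfl

lemma pullTop_comp (f : X ⟶ Y) {E : Y.Modules} {M N : X.Modules}
    (q : (Scheme.Modules.pullback f).obj E ⟶ M) (e : M ⟶ N) (s : Γ(E, ⊤)) :
    pullTop f (q ≫ e) s = e.app ⊤ (pullTop f q s) := by
  simp only [pullTop, pullSec, Adjunction.homEquiv_naturality_right]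
  rfl

lemma pullSec_sum (f : X ⟶ Y) {E : Y.Modules} {M : X.Modules}
    (q : (Scheme.Modules.pullback f).obj E ⟶ M) {U : Y.Opens} {ι : Type*} (J : Finset ι)
    (c : ι → Γ(Y, U)) (s : ι → Γ(E, U)) :
    pullSec f q U (∑ i ∈ J, c i • s i) = ∑ i ∈ J, f.app U (c i) • pullSec f q U (s i) := by
  rw [pullSec, app_sum, map_sum]
  rfl

lemma IsRel.pullTop {f : X ⟶ Y} {E : Y.Modules} {M : X.Modules}
    (q : (Scheme.Modules.pullback f).obj E ⟶ M) {ι : Type*} [Fintype ι] {s : ι → Γ(E, ⊤)}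
    {U : Y.Opens} {c : ι → Γ(Y, U)} (hc : IsRel E s U c) :
    IsRel M (fun i => AmpleBundle.pullTop f q (s i)) (f ⁻¹ᵁ U) fun i => f.app U (c i) := by
  have := congrArg (pullSec f q U) hc
  rw [pullSec_sum] at this
  simp only [res_pullSec] at this
  refine this.trans ?_
  rw [pullSec, map_zero, map_zero]

/-- Prescribing the adjoint of a morphism out of a pullback. -/
lemma exists_pullback_hom (f : X ⟶ Y) {E : Y.Modules} {M : X.Modules} {ι : Type*} [Fintype ι]
    {s : ι → Γ(E, ⊤)} (hs : IsGen E s) (t : ι → Γ(M, ⊤))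
    (ht : ∀ U c, IsRel E s U c → IsRel M t (f ⁻¹ᵁ U) fun i => f.app U (c i)) :
    ∃ q : (Scheme.Modules.pullback f).obj E ⟶ M, ∀ i, pullTop f q (s i) = t i := by
  have htop : f ⁻¹ᵁ ⊤ ≤ (⊤ : X.Opens) := le_top
  obtain ⟨φ, hφ⟩ := hs.exists_hom (N := (Scheme.Modules.pushforward f).obj M)
    (fun i => (pushEquiv f M ⊤).symm (res M htop (t i))) (by
      intro U c hc
      apply (pushEquiv f M U).injective
      rw [map_sum, map_zero]
      refine Eq.trans ?_ (ht U c hc)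
      refine Finset.sum_congr rfl fun i _ => ?_
      rw [pushEquiv_smul, rt, pushEquiv_res, AddEquiv.apply_symm_apply, res_res])
  refine ⟨((Scheme.Modules.pullbackPushforwardAdjunction f).homEquiv E M).symm φ, fun i => ?_⟩
  rw [pullTop_eq, pullSec, Equiv.apply_symm_apply, hφ, AddEquiv.apply_symm_apply, res_res]
  simp

lemma IsJointlyEpi.pullback_hom_ext {f : X ⟶ Y} {E : Y.Modules} {M : X.Modules} {I : Type*}
    {s : I → Γ(E, ⊤)} (hs : IsJointlyEpi E s) {q q' : (Scheme.Modules.pullback f).obj E ⟶ M}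
    (h : ∀ i, pullTop f q (s i) = pullTop f q' (s i)) : q = q' := by
  apply ((Scheme.Modules.pullbackPushforwardAdjunction f).homEquiv E M).injective
  refine hs _ _ _ fun i => ?_
  exact (pushEquiv f M ⊤).injective ((topEquiv f M).injective (h i))

lemma IsJointlyEpi.of_epi {f : X ⟶ Y} {E : Y.Modules} {M : X.Modules} {I : Type*}
    {s : I → Γ(E, ⊤)} (hs : IsJointlyEpi E s) (q : (Scheme.Modules.pullback f).obj E ⟶ M)
    [hq : Epi q] : IsJointlyEpi M fun i => pullTop f q (s i) := by
  intro N g h H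
  apply hq.left_cancellation
  refine hs.pullback_hom_ext fun i => ?_
  rw [pullTop_comp, pullTop_comp]
  exact H i

lemma IsJointlyEpi.epi {f : X ⟶ Y} {E : Y.Modules} {M : X.Modules} {I : Type*}
    {s : I → Γ(E, ⊤)} (q : (Scheme.Modules.pullback f).obj E ⟶ M)
    (h : IsJointlyEpi M fun i => pullTop f q (s i)) : Epi q := by
  refine ⟨fun {N} g g' H => h _ _ _ fun i => ?_⟩
  rw [← pullTop_comp, ← pullTop_comp, H]

/-- Under the adjunctions `pullbackComp` corresponds to `pushforwardComp`, which does nothing to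
sections. A diagram of pullbacks can thus be tested on jointly epimorphic global sections. -/
lemma pullTop_pullbackComp (g : X ⟶ Y) (f : Y ⟶ Z) {E : Z.Modules} {L : Y.Modules} {M : X.Modules}
    (p : (Scheme.Modules.pullback f).obj E ⟶ L) (e : (Scheme.Modules.pullback g).obj L ⟶ M)
    (q : (Scheme.Modules.pullback (g ≫ f)).obj E ⟶ M) {I : Type*}
    {s : I → Γ(E, ⊤)} (hs : IsJointlyEpi E s) :
    (Scheme.Modules.pullback g).map p ≫ e = (Scheme.Modules.pullbackComp g f).hom.app E ≫ q ↔
      ∀ i, pullTop g e (pullTop f p (s i)) = pullTop (g ≫ f) q (s i) := by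
  let A := (Scheme.Modules.pullbackPushforwardAdjunction f).comp
    (Scheme.Modules.pullbackPushforwardAdjunction g)
  have h1 : ∀ i, (A.homEquiv E M ((Scheme.Modules.pullback g).map p ≫ e)).app ⊤ (s i) =
      pullTop g e (pullTop f p (s i)) := by
    intro i
    rw [Adjunction.comp_homEquiv]
    change (((Scheme.Modules.pullbackPushforwardAdjunction f).homEquiv _ _)
      (((Scheme.Modules.pullbackPushforwardAdjunction g).homEquiv _ _) _)).app ⊤ (s i) = _
    rw [Adjunction.homEquiv_naturality_left, Adjunction.homEquiv_naturality_right]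
    rfl
  have h2 : ∀ i, (A.homEquiv E M ((Scheme.Modules.pullbackComp g f).hom.app E ≫ q)).app ⊤ (s i) =
      pullTop (g ≫ f) q (s i) := by
    intro i
    have hu := unit_conjugateEquiv A (Scheme.Modules.pullbackPushforwardAdjunction (g ≫ f))
      (Scheme.Modules.pullbackComp g f).inv E
    rw [Scheme.Modules.conjugateEquiv_pullbackComp_inv] at hu
    have h3 : (Scheme.Modules.pullbackPushforwardAdjunction (g ≫ f)).homEquiv E M q =
        A.homEquiv E M ((Scheme.Modules.pullbackComp g f).hom.app E ≫ q) ≫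
          (Scheme.Modules.pushforwardComp g f).hom.app M := by
      rw [Adjunction.homEquiv_unit, Adjunction.homEquiv_unit, Category.assoc]
      erw [(Scheme.Modules.pushforwardComp g f).hom.naturality]
      rw [← Category.assoc]
      erw [hu]
      rw [Category.assoc, ← Functor.map_comp, Iso.inv_hom_id_app_assoc]
    rw [pullTop, pullSec, h3]
    rfl
  constructor
  · intro h i
    rw [← h1, ← h2, h]
  · intro h
    apply (A.homEquiv E M).injective
    refine hs _ _ _ fun i => ?_
    rw [h1, h2, h]

end PullbackSections

end

end AmpleBundle

namespace AmpleBundle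

noncomputable section

/-! ### Line bundles with generating sections from transition functions. -/

section Cocycle

/-- Transition functions for a line bundle with generating sections `t i`: the function `a i j`
on `U j` is the quotient `t i / t j`. -/
structure Cocycle (X : Scheme.{u}) (ι : Type u) where
  /-- the locus where `t j` generates -/
  U : ι → X.Opens
  /-- the function `t i / t j` -/
  a : ι → ∀ j, Γ(X, U j)
  diag : ∀ j, a j j = 1
  mul : ∀ i j k, rs inf_le_left (a i j) * rs inf_le_right (a j k) =
    (rs inf_le_right (a i k) : Γ(X, U j ⊓ U k))
  cover : ∀ x : X, ∃ j, x ∈ U j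

namespace Cocycle

variable {X : Scheme.{u}} {ι : Type u} (A : Cocycle X ι)

/-- Sections of the line bundle of a cocycle: families of functions `f j` with
`f j * t j = f k * t k`. -/
def sections (W : X.Opens) : AddSubgroup (∀ j, Γ(X, W ⊓ A.U j)) where
  carrier := {f | ∀ j k, rs inf_le_left (f j) * rs (inf_le_right.trans inf_le_right) (A.a j k) =
    (rs inf_le_right (f k) : Γ(X, (W ⊓ A.U j) ⊓ (W ⊓ A.U k)))}
  add_mem' {f g} hf hg j k := by
    simp only [Pi.add_apply, map_add, add_mul]
    rw [hf j k, hg j k]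
  zero_mem' j k := by simp
  neg_mem' {f} hf j k := by
    simp only [Pi.neg_apply, map_neg, neg_mul]
    rw [hf j k]

instance (W : X.Opens) : Module Γ(X, W) (A.sections W) where
  smul r f := ⟨fun j => rs inf_le_left r * f.1 j, fun j k => by
    rw [map_mul, map_mul, mul_assoc, f.2 j k, rs_rs, rs_rs]⟩
  one_smul f := Subtype.ext (funext fun j => by
    change rs inf_le_left 1 * f.1 j = f.1 j
    rw [map_one, one_mul])
  mul_smul r s f := Subtype.ext (funext fun j => by
    change rs inf_le_left (r * s) * f.1 j = rs inf_le_left r * (rs inf_le_left s * f.1 j)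
    rw [map_mul, mul_assoc])
  smul_zero r := Subtype.ext (funext fun j => mul_zero _)
  smul_add r f g := Subtype.ext (funext fun j => mul_add _ _ _)
  add_smul r s f := Subtype.ext (funext fun j => by
    change rs inf_le_left (r + s) * f.1 j = rs inf_le_left r * f.1 j + rs inf_le_left s * f.1 j
    rw [map_add, add_mul])
  zero_smul f := Subtype.ext (funext fun j => by
    change rs inf_le_left 0 * f.1 j = 0
    rw [map_zero, zero_mul])

lemma smul_val {W : X.Opens} (r : Γ(X, W)) (f : A.sections W) (j : ι) :
    (r • f).1 j = rs inf_le_left r * f.1 j := rfl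

/-- Restriction of sections. -/
def restrict {W W' : X.Opens} (h : W' ≤ W) : A.sections W →+ A.sections W' where
  toFun f := ⟨fun j => rs (inf_le_inf_right _ h) (f.1 j), fun j k => by
    have := congrArg (rs (inf_le_inf (inf_le_inf_right (A.U j) h) (inf_le_inf_right (A.U k) h)))
      (f.2 j k)
    simpa only [map_mul, rs_rs] using this⟩
  map_zero' := Subtype.ext (funext fun j => map_zero _)
  map_add' f g := Subtype.ext (funext fun j => map_add _ _ _)

lemma restrict_val {W W' : X.Opens} (h : W' ≤ W) (f : A.sections W) (j : ι) :
    (A.restrict h f).1 j = rs (inf_le_inf_right _ h) (f.1 j) := rfl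

lemma restrict_refl {W : X.Opens} (h : W ≤ W) (f : A.sections W) : A.restrict h f = f :=
  Subtype.ext (funext fun _ => rs_refl _ _)

lemma restrict_restrict {W W' W'' : X.Opens} (h : W' ≤ W) (h' : W'' ≤ W') (f : A.sections W) :
    A.restrict h' (A.restrict h f) = A.restrict (h'.trans h) f :=
  Subtype.ext (funext fun _ => rs_rs _ _ _)

/-- The presheaf of abelian groups of sections. -/
def abPresheaf : X.Opensᵒᵖ ⥤ Ab.{u} where
  obj W := AddCommGrpCat.of (A.sections W.unop)
  map h := AddCommGrpCat.ofHom (A.restrict h.unop.le)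
  map_id _ := ConcreteCategory.hom_ext _ _ fun f => A.restrict_refl le_rfl f
  map_comp h h' := ConcreteCategory.hom_ext _ _ fun f =>
    (A.restrict_restrict h.unop.le h'.unop.le f).symm

/-- Each component `f j` glues separately as a function, and the transition condition between
components can be checked locally. -/
lemma isSheaf_abPresheaf : TopCat.Presheaf.IsSheaf (X := X.carrier) A.abPresheaf := by
  rw [TopCat.Presheaf.isSheaf_iff_isSheafUniqueGluing]
  intro I V sf hsf
  let sf' : ∀ i, A.sections (V i) := sf
  have hcov : ∀ p ∈ iSup V, ∃ i, p ∈ V i := fun p hp => Opens.mem_iSup.mp hp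
  have hcomp : ∀ i i' j, rs (inf_le_inf_right (A.U j) inf_le_left) ((sf' i).1 j) =
      (rs (inf_le_inf_right (A.U j) inf_le_right) ((sf' i').1 j) :
        Γ(X, (V i ⊓ V i') ⊓ A.U j)) := fun i i' j =>
    congrFun (congrArg Subtype.val (show A.restrict inf_le_left (sf' i) = A.restrict inf_le_right (sf' i')
      from hsf i i')) j
  have hle : ∀ i j, V i ⊓ A.U j ≤ iSup V ⊓ A.U j := fun i j =>
    inf_le_inf_right _ (le_iSup V i)
  have hex : ∀ j, ∃ f : Γ(X, iSup V ⊓ A.U j), ∀ i, rs (hle i j) f = (sf' i).1 j := by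
    intro j
    obtain ⟨f, hf⟩ := exists_function (X := X) (U := iSup V ⊓ A.U j)
      (fun W hW y => ∃ i, ∃ h : W ≤ V i ⊓ A.U j, y = rs h ((sf' i).1 j))
      (by
        rintro W W' hW hW' _ _ ⟨i, h, rfl⟩ ⟨i', h', rfl⟩
        have hWW : W ⊓ W' ≤ (V i ⊓ V i') ⊓ A.U j :=
          le_inf (le_inf (inf_le_left.trans (h.trans inf_le_left))
            (inf_le_right.trans (h'.trans inf_le_left))) (inf_le_left.trans (h.trans inf_le_right))
        have := congrArg (rs hWW) (hcomp i i' j)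
        simpa only [rs_rs] using this)
      (fun p hp => by
        obtain ⟨i, hi⟩ := hcov p hp.1
        exact ⟨V i ⊓ A.U j, hle i j, ⟨hi, hp.2⟩, _, i, le_rfl, rfl⟩)
    exact ⟨f, fun i => hf _ _ _ ⟨i, le_rfl, (rs_refl _ _).symm⟩⟩
  choose f hf using hex
  have hmem : f ∈ A.sections (iSup V) := by
    intro j k
    refine function_ext fun p hp => ?_
    obtain ⟨i, hi⟩ := hcov p hp.1.1
    refine ⟨(V i ⊓ A.U j) ⊓ (V i ⊓ A.U k), inf_le_inf (hle i j) (hle i k),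
      ⟨⟨hi, hp.1.2⟩, ⟨hi, hp.2.2⟩⟩, ?_⟩
    have := (sf' i).2 j k
    rw [← hf, ← hf] at this
    simpa only [map_mul, rs_rs] using this
  refine ⟨(⟨f, hmem⟩ : A.sections (iSup V)), fun i => ?_, fun g hg => ?_⟩
  · exact Subtype.ext (funext fun j => hf j i)
  · let g' : A.sections (iSup V) := g
    refine Subtype.ext (funext fun j => ?_)
    change g'.1 j = f j
    refine function_ext fun p hp => ?_
    obtain ⟨i, hi⟩ := hcov p hp.1
    refine ⟨V i ⊓ A.U j, hle i j, ⟨hi, hp.2⟩, ?_⟩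
    rw [hf]
    exact congrFun (congrArg Subtype.val (show A.restrict (le_iSup V i) g' = sf' i from hg i)) j

instance (W : X.Opensᵒᵖ) : Module (X.ringCatSheaf.obj.obj W) (A.abPresheaf.obj W) :=
  inferInstanceAs (Module Γ(X, W.unop) (A.sections W.unop))

/-- The line bundle defined by a cocycle. -/
def bundle : X.Modules where
  val := PresheafOfModules.ofPresheaf A.abPresheaf fun {W W'} h r f => by
    let f' : A.sections W.unop := f
    let r' : Γ(X, W.unop) := r
    refine Subtype.ext (funext fun j => ?_)
    change rs (inf_le_inf_right (A.U j) h.unop.le) (rs inf_le_left r' * f'.1 j) =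
      rs inf_le_left (rs h.unop.le r') * rs (inf_le_inf_right (A.U j) h.unop.le) (f'.1 j)
    rw [map_mul, rs_rs, rs_rs]
  isSheaf := A.isSheaf_abPresheaf

/-- The components of a section. -/
def bundleEquiv (W : X.Opens) : Γ(A.bundle, W) ≃+ A.sections W where
  toFun x := x
  invFun x := x
  left_inv _ := rfl
  right_inv _ := rfl
  map_add' _ _ := rfl

lemma bundleEquiv_smul {W : X.Opens} (r : Γ(X, W)) (x : Γ(A.bundle, W)) :
    A.bundleEquiv W (r • x) = r • A.bundleEquiv W x := rfl

lemma bundleEquiv_res {W W' : X.Opens} (h : W' ≤ W) (x : Γ(A.bundle, W)) :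
    A.bundleEquiv W' (res A.bundle h x) = A.restrict h (A.bundleEquiv W x) := rfl

/-- The section `t i`, with components `t i / t j`. -/
def t (i : ι) : Γ(A.bundle, ⊤) :=
  (A.bundleEquiv ⊤).symm ⟨fun j => rs inf_le_right (A.a i j), fun j k => by
    have := congrArg (rs (le_inf (inf_le_left.trans inf_le_right) (inf_le_right.trans inf_le_right) :
      (⊤ ⊓ A.U j) ⊓ (⊤ ⊓ A.U k) ≤ A.U j ⊓ A.U k)) (A.mul i j k)
    simpa only [map_mul, rs_rs] using this⟩

lemma bundleEquiv_t (W : X.Opens) (i j : ι) :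
    (A.bundleEquiv W (rt A.bundle W (A.t i))).1 j = rs inf_le_right (A.a i j) := by
  rw [rt, bundleEquiv_res, restrict_val, t, AddEquiv.apply_symm_apply, rs_rs]

lemma rt_t (i j : ι) :
    rt A.bundle (A.U j) (A.t i) = A.a i j • rt A.bundle (A.U j) (A.t j) := by
  apply (A.bundleEquiv _).injective
  refine Subtype.ext (funext fun k => ?_)
  rw [bundleEquiv_smul, smul_val, bundleEquiv_t, bundleEquiv_t, A.mul]

lemma isBasisOn_t (j : ι) :
    IsBasisOn A.bundle (A.U j) fun _ : Unit => rt A.bundle (A.U j) (A.t j) := by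
  intro W hW
  have hval : ∀ (c : Unit → Γ(X, W)) (k : ι), (A.bundleEquiv W (∑ l, c l •
      res A.bundle hW (rt A.bundle (A.U j) (A.t j)))).1 k =
      rs inf_le_left (c ()) * rs inf_le_right (A.a j k) := by
    intro c k
    rw [Fintype.sum_unique, res_rt, bundleEquiv_smul, smul_val, bundleEquiv_t]
  have hWj : W ≤ W ⊓ A.U j := le_inf le_rfl hW
  refine ⟨fun c d h => funext fun _ => ?_, fun x => ?_⟩
  · have h1 : (A.bundleEquiv W _).1 j = (A.bundleEquiv W _).1 j :=
      congrArg (fun y => (A.bundleEquiv W y).1 j) h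
    rw [hval, hval, A.diag, map_one, mul_one, mul_one] at h1
    have h2 := congrArg (rs hWj) h1
    simpa only [rs_rs, rs_refl] using h2
  -- Since `a j j = 1`, the coordinate of a section with respect to `t j` is its `j`-th component.
  · refine ⟨fun _ => rs hWj ((A.bundleEquiv W x).1 j), ?_⟩
    apply (A.bundleEquiv W).injective
    refine Subtype.ext (funext fun k => ?_)
    rw [hval]
    have h1 := congrArg (rs (le_inf (inf_le_left.trans hWj) le_rfl :
      W ⊓ A.U k ≤ (W ⊓ A.U j) ⊓ (W ⊓ A.U k))) ((A.bundleEquiv W x).2 j k)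
    simpa only [map_mul, rs_rs, rs_refl] using h1

lemma isLineBundle : IsLineBundle A.bundle :=
  isLineBundle_of_isBasisOn fun x =>
    let ⟨j, hj⟩ := A.cover x
    ⟨A.U j, hj, _, A.isBasisOn_t j⟩

end Cocycle

end Cocycle

end

end AmpleBundle

namespace AmpleBundle

noncomputable section

/-! ### Closed subschemes defined by local equations. -/

section ClosedSubschemes

variable {X : Scheme.{u}}

lemma comp_app_apply {T Y : Scheme.{u}} (l : T ⟶ Y) (g : Y ⟶ X) (U : X.Opens) (x : Γ(X, U)) :
    (l ≫ g).app U x = l.app (g ⁻¹ᵁ U) (g.app U x) := by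
  rw [Scheme.Hom.comp_app]; rfl

/-- Functions that agree after pulling back along jointly surjective open immersions are equal. -/
lemma function_ext_of_cover {U : X.Opens} {x y : Γ(X, U)}
    (H : ∀ p ∈ U, ∃ (T : Scheme.{u}) (j : T ⟶ X) (_ : IsOpenImmersion j), p ∈ Set.range j ∧
      j.app U x = j.app U y) : x = y := by
  refine function_ext fun p hp => ?_
  obtain ⟨T, j, hj, ⟨q, rfl⟩, hxy⟩ := H p hp
  have key : ∀ z : Γ(X, U), rs (Set.image_preimage_subset j U.1) z =
      (j.appIso (j ⁻¹ᵁ U)).inv (j.app U z) := fun z =>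
    (ConcreteCategory.congr_hom (j.app_appIso_inv U) z).symm
  refine ⟨j ''ᵁ j ⁻¹ᵁ U, Set.image_preimage_subset j U.1, ⟨q, hp, rfl⟩, ?_⟩
  rw [key, key, hxy]

/-- Morphisms can be defined locally on the source. -/
lemma exists_hom_of_local {Y : Scheme.{u}} (Q : ∀ V : X.Opens, (V.toScheme ⟶ Y) → Prop)
    (compat : ∀ V V' g g', Q V g → Q V' g' → ∀ (S : Scheme.{u}) (a : S ⟶ V.toScheme)
      (b : S ⟶ V'.toScheme), a ≫ V.ι = b ≫ V'.ι → a ≫ g = b ≫ g')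
    (loc : ∀ p : X, ∃ V, p ∈ V ∧ ∃ g, Q V g) :
    ∃ G : X ⟶ Y, ∀ V g, Q V g → V.ι ≫ G = g := by
  let I := Σ' V : X.Opens, {g : V.toScheme ⟶ Y // Q V g}
  let c : X.OpenCover := X.openCoverOfIsOpenCover (fun i : I => i.1) (by
    rw [IsOpenCover, eq_top_iff]
    intro p _
    obtain ⟨V, hp, g, hg⟩ := loc p
    exact Opens.mem_iSup.mpr ⟨⟨V, g, hg⟩, hp⟩)
  refine ⟨c.glueMorphisms (fun i => i.2.1) fun i i' => ?_, fun V g hg => ?_⟩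
  · exact compat _ _ _ _ i.2.2 i'.2.2 _ _ _ pullback.condition
  · exact c.ι_glueMorphisms (fun i => i.2.1) _ ⟨V, g, hg⟩

lemma comp_preimage_le {T Y : Scheme.{u}} (l : T ⟶ Y) (g : Y ⟶ X) (U : X.Opens) :
    (l ≫ g) ⁻¹ᵁ U ≤ l ⁻¹ᵁ g ⁻¹ᵁ U := le_rfl

/-- Variant of `comp_app_apply` that keeps track of the two descriptions of the preimage. -/
lemma comp_app_rs {T Y : Scheme.{u}} (l : T ⟶ Y) (g : Y ⟶ X) (U : X.Opens) (x : Γ(X, U)) :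
    (l ≫ g).app U x = rs (comp_preimage_le l g U) (l.app (g ⁻¹ᵁ U) (g.app U x)) := by
  rw [Scheme.Hom.comp_app]; exact (rs_refl _ _).symm

lemma app_of_comp_eq {T Y : Scheme.{u}} {l : T ⟶ Y} {g : Y ⟶ X} {h : T ⟶ X} (w : l ≫ g = h)
    (U : X.Opens) (x : Γ(X, U)) (hU : h ⁻¹ᵁ U ≤ l ⁻¹ᵁ g ⁻¹ᵁ U) :
    h.app U x = rs hU (l.app (g ⁻¹ᵁ U) (g.app U x)) := by
  subst w; exact comp_app_rs l g U x

lemma appTop_comp {T Y : Scheme.{u}} (l : T ⟶ Y) (g : Y ⟶ X) (x : Γ(X, ⊤)) :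
    (l ≫ g).appTop x = l.appTop (g.appTop x) := by
  rw [Scheme.Hom.comp_appTop]; rfl

lemma app_rs_top {T : Scheme.{u}} (g : T ⟶ X) (U : X.Opens) (x : Γ(X, ⊤)) :
    g.app U (rs le_top x) = rs le_top (g.appTop x) := by
  rw [app_rs]; rfl

lemma ofIdealTop_le_ker {T : Scheme.{u}} {S : Set Γ(X, ⊤)} (g : T ⟶ X)
    (hg : ∀ h ∈ S, g.app ⊤ h = 0) : Scheme.IdealSheafData.ofIdealTop (Ideal.span S) ≤ g.ker := by
  rw [Scheme.Hom.ker, Scheme.IdealSheafData.le_ofIdeals_iff]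
  intro V
  rw [Scheme.IdealSheafData.ofIdealTop_ideal, Ideal.map_le_iff_le_comap, Ideal.span_le]
  intro h hh
  change g.app V.1 (rs le_top h) = 0
  rw [app_rs, hg h hh, map_zero]

lemma ofIdealTop_subschemeι {S : Set Γ(X, ⊤)} {h : Γ(X, ⊤)} (hh : h ∈ S) :
    (Scheme.IdealSheafData.ofIdealTop (Ideal.span S)).subschemeι.app ⊤ h = 0 := by
  set I := Scheme.IdealSheafData.ofIdealTop (Ideal.span S)
  refine function_ext fun p _ => ?_
  obtain ⟨_, ⟨V, hV, rfl⟩, hpV, _⟩ :=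
    X.isBasis_affineOpens.exists_subset_of_mem_open (Set.mem_univ (I.subschemeι p)) isOpen_univ
  refine ⟨I.subschemeι ⁻¹ᵁ V, Scheme.Hom.preimage_mono _ (le_top : V ≤ ⊤), hpV, ?_⟩
  rw [map_zero, ← app_rs _ (le_top : V ≤ ⊤)]
  have h1 := I.subschemeι.ideal_ker_le ⟨V, hV⟩
  rw [Scheme.IdealSheafData.ker_subschemeι, Scheme.IdealSheafData.ofIdealTop_ideal] at h1
  exact h1 (Ideal.mem_map_of_mem _ (Ideal.subset_span hh))

/-- The locus in an open subset where a set of functions vanishes. -/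
lemma exists_subscheme_of_open (W : X.Opens) (S : Set Γ(X, W)) :
    ∃ (Z : Scheme.{u}) (i : Z ⟶ W.toScheme), QuasiCompact i ∧
      (∀ h ∈ S, (i ≫ W.ι).app W h = 0) ∧
      ∀ (T : Scheme.{u}) (g : T ⟶ X), Set.range g ⊆ W → (∀ h ∈ S, g.app W h = 0) →
        ∃ l : T ⟶ Z, l ≫ i ≫ W.ι = g := by
  have hW : (⊤ : W.toScheme.Opens) ≤ W.ι ⁻¹ᵁ W := by simp
  let S' : Set Γ(W, ⊤) := (fun h => rs hW (W.ι.app W h)) '' S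
  let I := Scheme.IdealSheafData.ofIdealTop (Ideal.span S')
  refine ⟨I.subscheme, I.subschemeι, inferInstance, fun h hh => ?_, fun T g hgW hg => ?_⟩
  · have h1 := ofIdealTop_subschemeι (S := S') ⟨h, hh, rfl⟩
    have h2 : W.ι.app W h = rs le_top (rs hW (W.ι.app W h)) := by rw [rs_rs, rs_refl]
    rw [comp_app_apply, h2, app_rs, h1]; exact map_zero _
  · let g' : T ⟶ W.toScheme := IsOpenImmersion.lift W.ι g (by simpa using hgW)
    have hg' : g' ≫ W.ι = g := IsOpenImmersion.lift_fac _ _ _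
    have h1 : I ≤ g'.ker := by
      refine ofIdealTop_le_ker g' ?_
      rintro _ ⟨h, hh, rfl⟩
      have h2 := hg h hh
      rw [← hg', comp_app_apply] at h2
      rw [app_rs, h2]; exact map_zero _
    refine ⟨IsClosedImmersion.lift I.subschemeι g'
      (by rwa [Scheme.IdealSheafData.ker_subschemeι]), ?_⟩
    rw [IsClosedImmersion.lift_fac_assoc, hg']

/-- Equations on an open cover, whose solutions over a member of the cover solve all the
equations, define a closed subscheme. -/
lemma exists_closed_subscheme {α : Type*} [Finite α] (W : α → X.Opens)
    (hW : ∀ x, ∃ a, x ∈ W a) (hqc : ∀ a, QuasiCompact (W a).ι) (S : ∀ a, Set Γ(X, W a))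
    (hS : ∀ (a : α) (T : Scheme.{u}) (g : T ⟶ X), Set.range g ⊆ W a →
      (∀ h ∈ S a, g.app (W a) h = 0) → ∀ b, ∀ h ∈ S b, g.app (W b) h = 0) :
    ∃ (Z : Scheme.{u}) (i : Z ⟶ X), IsClosedImmersion i ∧
      (∀ a, ∀ h ∈ S a, i.app (W a) h = 0) ∧
      ∀ (T : Scheme.{u}) (g : T ⟶ X), (∀ a, ∀ h ∈ S a, g.app (W a) h = 0) →
        ∃ l : T ⟶ Z, l ≫ i = g := by
  choose Z j hj hjS hlift using fun a => exists_subscheme_of_open (W a) (S a)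
  let J : ∀ a, Z a ⟶ X := fun a => j a ≫ (W a).ι
  have hJqc : ∀ a, QuasiCompact (J a) := fun a => by
    have := hj a; have := hqc a; infer_instance
  -- Each local solution scheme `Z a` solves the equations on every other member of the cover too.
  have hJ : ∀ a b, ∀ h ∈ S b, (J a).app (W b) h = 0 := fun a => by
    refine hS a _ (J a) ?_ (hjS a)
    rintro _ ⟨x, rfl⟩
    exact (j a x).2
  -- The solution scheme is the scheme-theoretic union of the images of the `Z a`. Quasi-compactness
  -- of `J a` allows its kernel to be computed on affine opens.
  let I : X.IdealSheafData := ⨅ a, (J a).ker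
  have hI : ∀ (V : X.affineOpens) (x : Γ(X, V.1)),
      x ∈ I.ideal V ↔ ∀ a, (J a).app V.1 x = 0 := by
    intro V x
    simp only [I, Scheme.IdealSheafData.ideal_iInf, iInf_apply, Ideal.mem_iInf]
    refine forall_congr' fun a => ?_
    have := hJqc a
    rw [Scheme.Hom.ker_apply]; rfl
  refine ⟨I.subscheme, I.subschemeι, inferInstance, fun b h hh => ?_, fun T g hg => ?_⟩
  · refine function_ext fun p hp => ?_
    obtain ⟨_, ⟨V, hV, rfl⟩, hpV, hVW⟩ :=
      X.isBasis_affineOpens.exists_subset_of_mem_open hp (W b).2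
    refine ⟨I.subschemeι ⁻¹ᵁ V, Scheme.Hom.preimage_mono _ (show V ≤ W b from hVW), hpV, ?_⟩
    rw [map_zero, ← app_rs _ (show V ≤ W b from hVW)]
    have h1 := I.subschemeι.ideal_ker_le ⟨V, hV⟩
    rw [Scheme.IdealSheafData.ker_subschemeι] at h1
    refine h1 ((hI _ _).2 fun a => ?_)
    rw [app_rs, hJ a b h hh, map_zero]
  -- Vanishing is tested on the preimages of the `W a`, where `g` factors through `Z a`.
  · have h1 : I ≤ g.ker := by
      rw [Scheme.Hom.ker, Scheme.IdealSheafData.le_ofIdeals_iff]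
      intro V x hx
      rw [hI] at hx
      change g.app V.1 x = 0
      refine function_ext_of_cover fun p hp => ?_
      obtain ⟨a, ha⟩ := hW (g p)
      let G := g ⁻¹ᵁ W a
      obtain ⟨l, hl⟩ := hlift a G.toScheme (G.ι ≫ g) (by
        rintro _ ⟨y, rfl⟩
        exact y.2) (fun h hh => by
        rw [comp_app_apply, hg a h hh]; exact map_zero _)
      have h2 : (G.ι ≫ g).app V.1 x = 0 := by
        rw [← hl]
        change (l ≫ J a).app V.1 x = 0
        rw [comp_app_apply, hx a]; exact map_zero _
      rw [comp_app_apply] at h2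
      refine ⟨_, G.ι, inferInstance, ⟨⟨p, ha⟩, rfl⟩, h2.trans (map_zero _).symm⟩
    exact ⟨IsClosedImmersion.lift I.subschemeι g
      (by rwa [Scheme.IdealSheafData.ker_subschemeι]), IsClosedImmersion.lift_fac _ _ _⟩

end ClosedSubschemes

end

end AmpleBundle

namespace AmpleBundle

noncomputable section

/-! ### The affine charts of the projective bundle. -/

section Charts

variable {C : Scheme.{u}} {ι : Type u} [Fintype ι] {E : C.Modules} {s : ι → Γ(E, ⊤)}

/-- Functions `a i` on `T` that satisfy the pullbacks of all relations among the sections `s i`. -/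
def Solves (s : ι → Γ(E, ⊤)) {T : Scheme.{u}} (f : T ⟶ C) (a : ι → Γ(T, ⊤)) : Prop :=
  ∀ (U : C.Opens) (c : ι → Γ(C, U)), IsRel E s U c →
    ∑ i, f.app U (c i) * rs le_top (a i) = 0

lemma Solves.comp {T T' : Scheme.{u}} {f : T ⟶ C} {a : ι → Γ(T, ⊤)} (h : Solves s f a)
    (g : T' ⟶ T) : Solves s (g ≫ f) fun i => g.appTop (a i) := by
  intro U c hc
  have h1 := congrArg (rs (le_of_eq rfl : (g ≫ f) ⁻¹ᵁ U ≤ g ⁻¹ᵁ f ⁻¹ᵁ U))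
    (congrArg (g.app (f ⁻¹ᵁ U)) (h U c hc))
  simp only [map_sum, map_zero, map_mul, app_rs_top, rs_rs] at h1
  refine (Finset.sum_congr rfl fun i _ => ?_).trans h1
  rw [comp_app_rs]

/-- If `a = A a` and `c A = 0` for every relation `c`, then `c a = c A a = 0`. All relations are
thus enforced by finitely many equations near each point. -/
lemma solves_of_local {T : Scheme.{u}} {f : T ⟶ C} {a : ι → Γ(T, ⊤)}
    (H : ∀ p : T, ∃ (U : C.Opens) (_ : f p ∈ U) (A : ι → ι → Γ(C, U)),
      (∀ (V : C.Opens) (h : V ≤ U) (c : ι → Γ(C, V)), IsRel E s V c →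
        ∀ l, ∑ i, c i * rs h (A i l) = 0) ∧
      ∀ i, (rs le_top (a i) : Γ(T, f ⁻¹ᵁ U)) = ∑ l, f.app U (A i l) * rs le_top (a l)) :
    Solves s f a := by
  intro U c hc
  refine function_ext fun p hp => ?_
  obtain ⟨U', hp', A, hA, ha⟩ := H p
  refine ⟨f ⁻¹ᵁ (U ⊓ U'), f.preimage_mono inf_le_left, ⟨hp, hp'⟩, ?_⟩
  have h1 : ∀ i, (rs le_top (a i) : Γ(T, f ⁻¹ᵁ (U ⊓ U'))) =
      ∑ l, f.app (U ⊓ U') (rs inf_le_right (A i l)) * rs le_top (a l) := by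
    intro i
    have := congrArg (rs (f.preimage_mono (inf_le_right : U ⊓ U' ≤ U'))) (ha i)
    rw [rs_rs, map_sum] at this
    refine this.trans (Finset.sum_congr rfl fun l _ => ?_)
    rw [map_mul, rs_rs, app_rs]
  have h2 : ∀ i, rs (f.preimage_mono (inf_le_left : U ⊓ U' ≤ U))
      (f.app U (c i) * rs le_top (a i)) =
      ∑ l, f.app (U ⊓ U') (rs inf_le_left (c i) * rs inf_le_right (A i l)) * rs le_top (a l) := by
    intro i
    rw [map_mul, rs_rs, ← app_rs, h1, Finset.mul_sum]
    refine Finset.sum_congr rfl fun l _ => ?_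
    rw [map_mul, mul_assoc]
  rw [map_sum, map_zero, Finset.sum_congr rfl fun i _ => h2 i, Finset.sum_comm]
  refine Finset.sum_eq_zero fun l _ => ?_
  rw [← Finset.sum_mul, ← map_sum, hA _ inf_le_right _ (hc.res inf_le_left) l, map_zero, zero_mul]

/-- The scheme of solutions of the relations among the `s i` whose `j`-th coordinate is one. -/
structure IsChart (s : ι → Γ(E, ⊤)) (j : ι) {Y : Scheme.{u}} (p : Y ⟶ C) (x : ι → Γ(Y, ⊤)) :
    Prop where
  one : x j = 1
  solves : Solves s p x
  exists_lift : ∀ {T : Scheme.{u}} (f : T ⟶ C) (a : ι → Γ(T, ⊤)), a j = 1 → Solves s f a →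
    ∃ g : T ⟶ Y, g ≫ p = f ∧ ∀ i, g.appTop (x i) = a i
  isClosedImmersion : IsClosedImmersion (AffineSpace.homOfVector p x)

/-- The chart is closed in affine space over `C`, so a morphism into it is determined by its
projection to `C` and its coordinates. -/
lemma IsChart.hom_ext {j : ι} {Y : Scheme.{u}} {p : Y ⟶ C} {x : ι → Γ(Y, ⊤)} (h : IsChart s j p x)
    {T : Scheme.{u}} {g g' : T ⟶ Y} (hp : g ≫ p = g' ≫ p)
    (hx : ∀ i, g.appTop (x i) = g'.appTop (x i)) : g = g' := by
  have := h.isClosedImmersion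
  rw [← cancel_mono (AffineSpace.homOfVector p x)]
  rw [AffineSpace.comp_homOfVector, AffineSpace.comp_homOfVector, hp]
  exact congrArg _ (funext hx)

/-- The chart is cut out of `𝔸(ι; C)` by `x j = 1` and by `x = A x` over each open set on which the
presentation splits with matrix `A`. These equations do not depend on the local splitting, because
they amount to solving all relations. -/
lemma exists_isChart [CompactSpace C] [IsLocallyNoetherian C] (hs : IsLocallySplit E s) (j : ι) :
    ∃ (Y : Scheme.{u}) (p : Y ⟶ C) (x : ι → Γ(Y, ⊤)), IsChart s j p x := by
  classical
  choose U hU A hA hA' using hs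
  obtain ⟨t, ht⟩ := CompactSpace.elim_nhds_subcover (fun x => (U x : Set C))
    fun x => (U x).2.mem_nhds (hU x)
  have hcov : ∀ c : C, ∃ y : t, c ∈ U y := by
    intro c
    have : c ∈ ⋃ x ∈ t, (U x : Set C) := by rw [ht]; trivial
    simp only [Set.mem_iUnion] at this
    obtain ⟨y, hy, hc⟩ := this
    exact ⟨⟨y, hy⟩, hc⟩
  let X := 𝔸(ι; C)
  let π : X ⟶ C := 𝔸(ι; C) ↘ C
  let x : ι → Γ(X, ⊤) := AffineSpace.coord C
  let S : ∀ y : t, Set Γ(X, π ⁻¹ᵁ U y) := fun y =>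
    Set.range (fun i => rs le_top (x i) - ∑ l, π.app (U y) (A y i l) * rs le_top (x l)) ∪
      {rs le_top (x j - 1)}
  have hkill : ∀ {T : Scheme.{u}} (g : T ⟶ X) (y : t),
      (∀ h ∈ S y, g.app (π ⁻¹ᵁ U y) h = 0) ↔
        (∀ i, (rs le_top (g.appTop (x i)) : Γ(T, (g ≫ π) ⁻¹ᵁ U y)) =
          ∑ l, (g ≫ π).app (U y) (A y i l) * rs le_top (g.appTop (x l))) ∧
        (rs le_top (g.appTop (x j)) : Γ(T, (g ≫ π) ⁻¹ᵁ U y)) = 1 := by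
    intro T g y
    let e : Γ(T, g ⁻¹ᵁ π ⁻¹ᵁ U y) →+* Γ(T, (g ≫ π) ⁻¹ᵁ U y) := rs (le_of_eq rfl)
    have he : Function.Injective e := fun a b h => by
      have := congrArg (rs (le_of_eq rfl : g ⁻¹ᵁ π ⁻¹ᵁ U y ≤ (g ≫ π) ⁻¹ᵁ U y)) h
      simpa only [e, rs_rs, rs_refl] using this
    have h1 : ∀ i, e (g.app (π ⁻¹ᵁ U y) (rs le_top (x i) -
        ∑ l, π.app (U y) (A y i l) * rs le_top (x l))) = rs le_top (g.appTop (x i)) -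
          ∑ l, (g ≫ π).app (U y) (A y i l) * rs le_top (g.appTop (x l)) := by
      intro i
      simp only [e, map_sub, map_sum, map_mul, app_rs_top, rs_rs, comp_app_rs]
    have h2 : e (g.app (π ⁻¹ᵁ U y) (rs le_top (x j - 1))) = rs le_top (g.appTop (x j)) - 1 := by
      simp only [e, map_sub, map_one, app_rs_top, rs_rs]
    constructor
    · intro h
      refine ⟨fun i => ?_, ?_⟩
      · rw [← sub_eq_zero, ← h1, h _ (Or.inl ⟨i, rfl⟩), map_zero]
      · rw [← sub_eq_zero, ← h2, h _ (Or.inr rfl), map_zero]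
    · rintro ⟨h3, h4⟩ h (⟨i, rfl⟩ | rfl)
      · exact he (((h1 i).trans (sub_eq_zero.mpr (h3 i))).trans (map_zero e).symm)
      · exact he ((h2.trans (sub_eq_zero.mpr h4)).trans (map_zero e).symm)
  have hsolve : ∀ {T : Scheme.{u}} (g : T ⟶ X),
      (∀ p : T, ∃ y : t, (g ≫ π) p ∈ U y ∧ ∀ h ∈ S y, g.app (π ⁻¹ᵁ U y) h = 0) →
        g.appTop (x j) = 1 ∧ Solves s (g ≫ π) fun i => g.appTop (x i) := by
    intro T g H
    refine ⟨function_ext fun p _ => ?_, solves_of_local fun p => ?_⟩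
    · obtain ⟨y, hy, h⟩ := H p
      exact ⟨(g ≫ π) ⁻¹ᵁ U y, le_top, hy, (((hkill g y).1 h).2).trans (map_one _).symm⟩
    · obtain ⟨y, hy, h⟩ := H p
      exact ⟨U y, hy, A y, hA' y, ((hkill g y).1 h).1⟩
  have hkill' : ∀ {T : Scheme.{u}} (g : T ⟶ X), g.appTop (x j) = 1 →
      (Solves s (g ≫ π) fun i => g.appTop (x i)) → ∀ y, ∀ h ∈ S y, g.app (π ⁻¹ᵁ U y) h = 0 := by
    intro T g h1 h2 y
    rw [hkill]
    refine ⟨fun i => ?_, by rw [h1, map_one]⟩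
    -- Row `i` of `1 - A` is itself a relation, so every solution satisfies `a = A a`.
    have h3 : IsRel E s (U y) fun l => (if l = i then 1 else 0) - A y i l := by
      simp only [IsRel, sub_smul, ite_smul, one_smul, zero_smul, Finset.sum_sub_distrib,
        Finset.sum_ite_eq', Finset.mem_univ, if_true]
      rw [← hA y i, sub_self]
    have h4 := h2 _ _ h3
    simp only [map_sub, sub_mul, Finset.sum_sub_distrib] at h4
    rw [sub_eq_zero] at h4
    rw [← h4, Finset.sum_eq_single i]
    · rw [if_pos rfl, map_one, one_mul]
    · intro l _ hl
      rw [if_neg hl, map_zero, zero_mul]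
    · exact fun h => absurd (Finset.mem_univ i) h
  obtain ⟨Y, i, hi, hiS, hlift⟩ := exists_closed_subscheme (fun y : t => π ⁻¹ᵁ U y)
    (fun z => hcov (π z))
    -- Open immersions into the locally Noetherian `C` are quasi-compact, and so are their base
    -- changes.
    (fun y => MorphismProperty.of_isPullback (P := @QuasiCompact)
      (isPullback_morphismRestrict π (U y)) inferInstance) S
    (fun y T g hg h => by
      obtain ⟨h1, h2⟩ := hsolve g fun p => ⟨y, hg ⟨p, rfl⟩, h⟩
      exact hkill' g h1 h2)
  obtain ⟨h1, h2⟩ := hsolve i fun p =>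
    let ⟨y, hy⟩ := hcov ((i ≫ π) p)
    ⟨y, hy, hiS y⟩
  have hvec : AffineSpace.homOfVector (i ≫ π) (fun l => i.appTop (x l)) = i :=
    AffineSpace.hom_ext (AffineSpace.homOfVector_over _ _)
      fun l => AffineSpace.homOfVector_appTop_coord _ _ l
  refine ⟨Y, i ≫ π, fun l => i.appTop (x l), h1, h2, fun {T} f a ha hfa => ?_, by rwa [hvec]⟩
  have h3 : AffineSpace.homOfVector f a ≫ π = f := AffineSpace.homOfVector_over _ _
  have h4 : ∀ l, (AffineSpace.homOfVector f a).appTop (x l) = a l :=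
    AffineSpace.homOfVector_appTop_coord f a
  obtain ⟨g, hg⟩ := hlift T (AffineSpace.homOfVector f a) (hkill' _ ((h4 j).trans ha) (by
    simp only [h4]
    rwa [h3]))
  refine ⟨g, by rw [← Category.assoc, hg, h3], fun l => ?_⟩
  rw [← h4 l, ← hg, appTop_comp]

end Charts

end

end AmpleBundle

namespace AmpleBundle

noncomputable section

/-! ### Gluing schemes along a relation on their points. -/

section Gluing

variable {J : Type u} {Y : J → Scheme.{u}}

/-- Schemes with a compatibility relation on pairs of morphisms into them can be glued. -/
structure GluingRelation (Y : J → Scheme.{u}) where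
  /-- the relation `g ≫ ι j = g' ≫ ι k` -/
  R : ∀ {S : Scheme.{u}} {j k : J}, (S ⟶ Y j) → (S ⟶ Y k) → Prop
  comp : ∀ {S S' : Scheme.{u}} {j k : J} (h : S' ⟶ S) (g : S ⟶ Y j) (g' : S ⟶ Y k),
    R g g' → R (h ≫ g) (h ≫ g')
  refl : ∀ {S : Scheme.{u}} {j : J} (g : S ⟶ Y j), R g g
  symm : ∀ {S : Scheme.{u}} {j k : J} {g : S ⟶ Y j} {g' : S ⟶ Y k}, R g g' → R g' g
  trans : ∀ {S : Scheme.{u}} {j k l : J} {g : S ⟶ Y j} {g' : S ⟶ Y k} {g'' : S ⟶ Y l},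
    R g g' → R g' g'' → R g g''
  eq : ∀ {S : Scheme.{u}} {j : J} {g g' : S ⟶ Y j}, R g g' → g = g'
  /-- the overlap -/
  V : ∀ j _ : J, (Y j).Opens
  /-- the transition map -/
  τ : ∀ j k : J, (V j k).toScheme ⟶ Y k
  rel_τ : ∀ j k, R (V j k).ι (τ j k)
  range : ∀ {S : Scheme.{u}} {j k : J} {g : S ⟶ Y j} {g' : S ⟶ Y k}, R g g' →
    Set.range g ⊆ Set.range (V j k).ι

namespace GluingRelation

variable (G : GluingRelation Y)

/-- The transition map between overlaps. -/
def t (j k : J) : (G.V j k).toScheme ⟶ (G.V k j).toScheme :=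
  IsOpenImmersion.lift (G.V k j).ι (G.τ j k) (G.range (G.symm (G.rel_τ j k)))

lemma t_ι (j k : J) : G.t j k ≫ (G.V k j).ι = G.τ j k := IsOpenImmersion.lift_fac _ _ _

/-- The point of the first chart below a triple overlap. -/
abbrev pt (i j k : J) : pullback (G.V i j).ι (G.V i k).ι ⟶ Y i := pullback.fst _ _ ≫ (G.V i j).ι

/-- The point of the second chart below a triple overlap. -/
abbrev pt' (i j k : J) : pullback (G.V i j).ι (G.V i k).ι ⟶ Y j := pullback.fst _ _ ≫ G.τ i j

lemma rel_pt (i j k : J) : G.R (G.pt i j k) (G.pt' i j k) := G.comp _ _ _ (G.rel_τ i j)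

lemma rel_pt'' (i j k : J) : G.R (G.pt i j k) (pullback.snd (G.V i j).ι (G.V i k).ι ≫ G.τ i k) := by
  rw [pt, pullback.condition]
  exact G.comp _ _ _ (G.rel_τ i k)

/-- The cyclic rotation of triple overlaps. -/
def t' (i j k : J) : pullback (G.V i j).ι (G.V i k).ι ⟶ pullback (G.V j k).ι (G.V j i).ι :=
  pullback.lift
    (IsOpenImmersion.lift (G.V j k).ι (G.pt' i j k)
      (G.range (G.trans (G.symm (G.rel_pt i j k)) (G.rel_pt'' i j k))))
    (IsOpenImmersion.lift (G.V j i).ι (G.pt' i j k) (G.range (G.symm (G.rel_pt i j k))))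
    (by simp only [IsOpenImmersion.lift_fac])

lemma t'_pt (i j k : J) : G.t' i j k ≫ G.pt j k i = G.pt' i j k := by
  rw [pt, t', pullback.lift_fst_assoc, IsOpenImmersion.lift_fac]

/-- The data for gluing the charts. -/
def glueData : Scheme.GlueData where
  J := J
  U := Y
  V jk := (G.V jk.1 jk.2).toScheme
  f j k := (G.V j k).ι
  f_mono _ _ := inferInstance
  f_hasPullback _ _ _ := inferInstance
  f_id j := by
    have : Function.Surjective (G.V j j).ι := by
      intro y
      -- Reflexivity, applied to the identity, makes `V j j` all of `Y j`.
      obtain ⟨z, hz⟩ := G.range (G.refl (𝟙 (Y j))) ⟨y, rfl⟩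
      exact ⟨z, hz⟩
    have : Epi (G.V j j).ι.base := (TopCat.epi_iff_surjective _).2 this
    exact IsOpenImmersion.isIso _
  t := G.t
  t_id j := by
    rw [← cancel_mono (G.V j j).ι, t_ι, Category.id_comp]
    exact (G.eq (G.rel_τ j j)).symm
  t' := G.t'
  t_fac i j k := by
    rw [← cancel_mono (G.V j i).ι, Category.assoc, Category.assoc, t_ι, t',
      pullback.lift_snd_assoc, IsOpenImmersion.lift_fac]
  cocycle i j k := by
    -- Each rotation moves to a related point, so three rotations lead to a point of the same chart
    -- related to the initial one, hence equal to it.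
    have h1 : G.t' i j k ≫ G.t' j k i ≫ G.t' k i j ≫ G.pt i j k = G.pt i j k := by
      rw [t'_pt]
      refine G.eq (G.trans (G.symm (G.trans (G.rel_pt i j k) ?_)) (G.refl _))
      have h2 := G.comp (G.t' i j k) _ _ (G.rel_pt j k i)
      have h3 := G.comp (G.t' i j k ≫ G.t' j k i) _ _ (G.rel_pt k i j)
      rw [t'_pt] at h2
      rw [Category.assoc, t'_pt, Category.assoc] at h3
      exact G.trans h2 h3
    have h2 : G.pt i j k = pullback.snd _ _ ≫ (G.V i k).ι := pullback.condition
    apply pullback.hom_ext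
    · rw [← cancel_mono (G.V i j).ι]
      simpa only [Category.assoc, Category.id_comp] using h1
    · rw [← cancel_mono (G.V i k).ι]
      rw [h2] at h1
      simpa only [Category.assoc, Category.id_comp] using h1
  f_open _ _ := inferInstance

/-- The glued scheme. -/
def glued : Scheme.{u} := G.glueData.glued

/-- The inclusion of a chart. -/
def ι (j : J) : Y j ⟶ G.glued := G.glueData.ι j

instance (j : J) : IsOpenImmersion (G.ι j) := G.glueData.ι_isOpenImmersion j

lemma exists_eq (x : G.glued) : ∃ (j : J) (y : Y j), G.ι j y = x :=
  G.glueData.ι_jointly_surjective x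

lemma τ_ι (j k : J) : G.τ j k ≫ G.ι k = (G.V j k).ι ≫ G.ι j := by
  have := G.glueData.glue_condition j k
  rw [← t_ι, Category.assoc]
  exact this

/-- The overlap `V j k` is the fibre product of the two charts over the glued scheme. Conversely,
related `g` and `g'` give a lift of `g` to `V j k`, and its composite with `τ` is related to `g'`
within one chart. -/
lemma comp_ι_eq_iff {S : Scheme.{u}} {j k : J} (g : S ⟶ Y j) (g' : S ⟶ Y k) :
    g ≫ G.ι j = g' ≫ G.ι k ↔ G.R g g' := by
  constructor
  · intro h
    obtain ⟨l, hl, hl'⟩ := PullbackCone.IsLimit.lift' (G.glueData.vPullbackConeIsLimit j k) g g' h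
    let l' : S ⟶ (G.V j k).toScheme := l
    have h1 : l' ≫ (G.V j k).ι = g := hl
    have h2 : l' ≫ G.t j k ≫ (G.V k j).ι = g' := hl'
    rw [t_ι] at h2
    rw [← h1, ← h2]
    exact G.comp _ _ _ (G.rel_τ j k)
  · intro h
    let l := IsOpenImmersion.lift (G.V j k).ι g (G.range h)
    have hl : l ≫ (G.V j k).ι = g := IsOpenImmersion.lift_fac _ _ _
    have hl' : l ≫ G.τ j k = g' := by
      apply G.eq
      refine G.trans (G.symm ?_) h
      conv_lhs => rw [← hl]
      exact G.comp _ _ _ (G.rel_τ j k)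
    rw [← hl, ← hl', Category.assoc, Category.assoc, τ_ι]

/-- Compatible morphisms out of the charts. -/
lemma exists_desc {Z : Scheme.{u}} (φ : ∀ j, Y j ⟶ Z)
    (h : ∀ {S : Scheme.{u}} {j k : J} (g : S ⟶ Y j) (g' : S ⟶ Y k), G.R g g' →
      g ≫ φ j = g' ≫ φ k) :
    ∃ Φ : G.glued ⟶ Z, ∀ j, G.ι j ≫ Φ = φ j := by
  let c := G.glueData.openCover
  refine ⟨c.glueMorphisms φ fun j k => h _ _ ?_, fun j => c.ι_glueMorphisms φ _ j⟩
  exact (G.comp_ι_eq_iff _ _).1 pullback.condition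

end GluingRelation

end Gluing

end

end AmpleBundle

namespace AmpleBundle

noncomputable section

/-! ### The projective bundle in homogeneous coordinates. -/

section ProjectiveSpectrum

lemma top_le_preimage_ι {X : Scheme.{u}} (U : X.Opens) : (⊤ : U.toScheme.Opens) ≤ U.ι ⁻¹ᵁ U := by
  simp

/-- Functions on an open subset, as global functions on the open subscheme. -/
def secTop {X : Scheme.{u}} (U : X.Opens) : Γ(X, U) →+* Γ(U, ⊤) :=
  (rs (top_le_preimage_ι U)).comp (U.ι.app U).hom

lemma secTop_apply {X : Scheme.{u}} (U : X.Opens) (x : Γ(X, U)) :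
    secTop U x = rs (top_le_preimage_ι U) (U.ι.app U x) := rfl

lemma secTop_rs_top {X : Scheme.{u}} (U : X.Opens) (x : Γ(X, ⊤)) :
    secTop U (rs le_top x) = U.ι.appTop x := by
  rw [secTop_apply, app_rs_top, rs_rs, rs_refl]

lemma app_ι_eq {X : Scheme.{u}} (U : X.Opens) (x : Γ(X, U)) :
    U.ι.app U x = rs le_top (secTop U x) := by
  rw [secTop_apply, rs_rs, rs_refl]

lemma appTop_secTop {X S : Scheme.{u}} (U : X.Opens) (l : S ⟶ U.toScheme) (h : S ⟶ X)
    (w : l ≫ U.ι = h) (hU : ⊤ ≤ h ⁻¹ᵁ U) (x : Γ(X, U)) :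
    l.appTop (secTop U x) = rs hU (h.app U x) := by
  have h1 : h ⁻¹ᵁ U ≤ l ⁻¹ᵁ U.ι ⁻¹ᵁ U := by rw [← w]; rfl
  rw [app_of_comp_eq w U x h1, app_ι_eq, app_rs_top, rs_rs, rs_rs, rs_refl]

lemma isUnit_appTop_basicOpen {X : Scheme.{u}} (r : Γ(X, ⊤)) :
    IsUnit ((X.basicOpen r).ι.appTop r) := by
  rw [← secTop_rs_top]
  exact (RingedSpace.isUnit_res_basicOpen _ r).map (secTop (X.basicOpen r))

lemma range_subset_basicOpen {X S : Scheme.{u}} (g : S ⟶ X) (r : Γ(X, ⊤))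
    (h : IsUnit (g.appTop r)) : Set.range g ⊆ Set.range (X.basicOpen r).ι := by
  rintro _ ⟨y, rfl⟩
  rw [Scheme.Opens.range_ι]
  change y ∈ g ⁻¹ᵁ X.basicOpen r
  rw [Scheme.preimage_basicOpen_top, Scheme.basicOpen_of_isUnit _ h]
  trivial

variable {C : Scheme.{u}} {ι : Type u} [Fintype ι] {E : C.Modules} {s : ι → Γ(E, ⊤)}

lemma Solves.mul {T : Scheme.{u}} {f : T ⟶ C} {a : ι → Γ(T, ⊤)} (h : Solves s f a)
    (r : Γ(T, ⊤)) : Solves s f fun i => a i * r := by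
  intro U c hc
  have := h U c hc
  simp only [map_mul, ← mul_assoc, ← Finset.sum_mul, this, zero_mul]

section

variable {Y : ι → Scheme.{u}} {p : ∀ j, Y j ⟶ C} {x : ∀ j, ι → Γ(Y j, ⊤)}

/-- Dividing all coordinates by the invertible `x j k` makes the `k`-th one equal to `1` and still
solves the relations. -/
lemma exists_transition (hY : ∀ j, IsChart s j (p j) (x j)) (j k : ι) :
    ∃ τ : ((Y j).basicOpen (x j k)).toScheme ⟶ Y k,
      ((Y j).basicOpen (x j k)).ι ≫ p j = τ ≫ p k ∧
      ∀ i, ((Y j).basicOpen (x j k)).ι.appTop (x j i) =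
        τ.appTop (x k i) * ((Y j).basicOpen (x j k)).ι.appTop (x j k) := by
  set V := (Y j).basicOpen (x j k)
  obtain ⟨r, hr⟩ := (isUnit_appTop_basicOpen (x j k)).exists_right_inv
  obtain ⟨τ, hτ, hτ'⟩ := (hY k).exists_lift (V.ι ≫ p j) (fun i => V.ι.appTop (x j i) * r) hr
    (((hY j).solves.comp V.ι).mul r)
  refine ⟨τ, hτ.symm, fun i => ?_⟩
  rw [hτ', mul_assoc, mul_comm r]
  exact ((congrArg _ hr).trans (mul_one _)).symm

/-- Points of the charts `Y j` and `Y k` are identified if they have the same image in the base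
and proportional homogeneous coordinates. -/
def chartRelation (hY : ∀ j, IsChart s j (p j) (x j)) : GluingRelation Y where
  R {_ j k} g g' := g ≫ p j = g' ≫ p k ∧
    ∀ i, g.appTop (x j i) = g'.appTop (x k i) * g.appTop (x j k)
  comp h g g' H := by
    refine ⟨by rw [Category.assoc, H.1, Category.assoc], fun i => ?_⟩
    rw [appTop_comp, H.2 i, map_mul, ← appTop_comp, ← appTop_comp]
  refl {_ j} g := ⟨rfl, fun i => by rw [(hY j).one, map_one, mul_one]⟩
  symm {_ j k g g'} H := by
    refine ⟨H.1.symm, fun i => ?_⟩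
    have h1 := H.2 j
    rw [(hY j).one, map_one] at h1
    rw [H.2 i, mul_assoc, mul_comm (g.appTop _), ← h1, mul_one]
  trans {_ j k l g g' g''} H H' :=
    ⟨H.1.trans H'.1, fun i => by rw [H.2 i, H'.2 i, H.2 l, mul_assoc]⟩
  eq {_ j g g'} H := (hY j).hom_ext H.1 fun i => by rw [H.2 i, (hY j).one, map_one, mul_one]
  V j k := (Y j).basicOpen (x j k)
  τ j k := (exists_transition hY j k).choose
  rel_τ j k := (exists_transition hY j k).choose_spec
  range {_ j k g g'} H := by
    refine range_subset_basicOpen _ _ (IsUnit.of_mul_eq_one (g'.appTop (x k j)) ?_)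
    -- Proportionality at the index `j`, where the coordinate on `Y j` is `1`, exhibits an inverse
    -- of `x j k`.
    have h1 := H.2 j
    rw [(hY j).one, map_one] at h1
    rw [mul_comm, ← h1]

lemma chartRelation_R {hY : ∀ j, IsChart s j (p j) (x j)} {S : Scheme.{u}} {j k : ι}
    {g : S ⟶ Y j} {g' : S ⟶ Y k} : (chartRelation hY).R g g' ↔ g ≫ p j = g' ≫ p k ∧
      ∀ i, g.appTop (x j i) = g'.appTop (x k i) * g.appTop (x j k) := Iff.rfl

variable (hY : ∀ j, IsChart s j (p j) (x j))

/-- The function on the image of the chart `Y j` corresponding to the `i`-th coordinate. -/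
def chartFun (i j : ι) : Γ((chartRelation hY).glued, (chartRelation hY).ι j ''ᵁ ⊤) :=
  (((chartRelation hY).ι j).appIso ⊤).inv (x j i)

lemma app_chartFun {S : Scheme.{u}} {j : ι} (g : S ⟶ Y j) (h : S ⟶ (chartRelation hY).glued)
    (w : g ≫ (chartRelation hY).ι j = h) (i : ι) :
    h.app ((chartRelation hY).ι j ''ᵁ ⊤) (chartFun hY i j) = rs le_top (g.appTop (x j i)) := by
  have h1 : ((chartRelation hY).ι j).app ((chartRelation hY).ι j ''ᵁ ⊤) (chartFun hY i j) =
      rs le_top (x j i) :=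
    ConcreteCategory.congr_hom (((chartRelation hY).ι j).appIso_inv_app ⊤) (x j i)
  rw [app_of_comp_eq w _ _ (by rw [← w]; rfl), h1, app_rs_top, rs_rs]

/-- The cocycle of the tautological bundle. -/
def chartCocycle : Cocycle (chartRelation hY).glued ι where
  U j := (chartRelation hY).ι j ''ᵁ ⊤
  a := chartFun hY
  diag j := by rw [chartFun, (hY j).one, map_one]
  mul i j k := by
    refine function_ext_of_cover fun q hq => ?_
    obtain ⟨⟨y, -, hy⟩, ⟨z, -, hz⟩⟩ := hq
    -- On the fibre product of two charts the cocycle identity is the proportionality of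
    -- coordinates.
    let g := pullback.fst ((chartRelation hY).ι j) ((chartRelation hY).ι k)
    let g' := pullback.snd ((chartRelation hY).ι j) ((chartRelation hY).ι k)
    have hg : g ≫ (chartRelation hY).ι j = g' ≫ (chartRelation hY).ι k := pullback.condition
    refine ⟨_, g ≫ (chartRelation hY).ι j, inferInstance, ?_, ?_⟩
    · rw [IsOpenImmersion.range_pullback_to_base_of_left]
      exact ⟨⟨y, hy⟩, ⟨z, hz⟩⟩
    · have h := ((chartRelation hY).symm (((chartRelation hY).comp_ι_eq_iff _ _).1 hg)).2 i
      rw [map_mul, app_rs, app_rs, app_rs, app_chartFun hY g _ rfl, app_chartFun hY g' _ hg.symm,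
        app_chartFun hY g' _ hg.symm, rs_rs, rs_rs, rs_rs, ← map_mul, ← h]
  cover q :=
    let ⟨j, y, hy⟩ := (chartRelation hY).exists_eq q
    ⟨j, y, trivial, hy⟩

end

/-- The functions of a cocycle satisfy the pullbacks of the relations among the sections `s i`. -/
def Cocycle.Solves (s : ι → Γ(E, ⊤)) {T : Scheme.{u}} (f : T ⟶ C) (B : Cocycle T ι) : Prop :=
  ∀ (j : ι) (U : C.Opens) (c : ι → Γ(C, U)), IsRel E s U c →
    ∑ i, rs inf_le_left (f.app U (c i)) * rs inf_le_right (B.a i j) =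
      (0 : Γ(T, f ⁻¹ᵁ U ⊓ B.U j))

/-- The universal property of the projective bundle, in terms of homogeneous coordinates. -/
structure IsProjOf (s : ι → Γ(E, ⊤)) {P : Scheme.{u}} (π : P ⟶ C) (A : Cocycle P ι) : Prop where
  solves : A.Solves s π
  exists_lift : ∀ {T : Scheme.{u}} (f : T ⟶ C) (B : Cocycle T ι), B.Solves s f →
    ∃ g : T ⟶ P, g ≫ π = f ∧ ∀ j, ∃ h : B.U j ≤ g ⁻¹ᵁ A.U j, ∀ i,
      rs h (g.app (A.U j) (A.a i j)) = B.a i j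
  hom_ext : ∀ {T : Scheme.{u}} {g g' : T ⟶ P}, g ≫ π = g' ≫ π →
    (∀ q : T, ∃ (j : ι) (V : T.Opens) (_ : q ∈ V) (h : V ≤ g ⁻¹ᵁ A.U j) (h' : V ≤ g' ⁻¹ᵁ A.U j),
      ∀ i, rs h (g.app (A.U j) (A.a i j)) = rs h' (g'.app (A.U j) (A.a i j))) → g = g'

section

variable {Y : ι → Scheme.{u}} {p : ∀ j, Y j ⟶ C} {x : ∀ j, ι → Γ(Y j, ⊤)}
  (hY : ∀ j, IsChart s j (p j) (x j))

lemma app_chartCocycle {S : Scheme.{u}} {j : ι} (g : S ⟶ Y j) (h : S ⟶ (chartRelation hY).glued)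
    (w : g ≫ (chartRelation hY).ι j = h) (i : ι) :
    h.app ((chartCocycle hY).U j) ((chartCocycle hY).a i j) = rs le_top (g.appTop (x j i)) :=
  app_chartFun hY g h w i

lemma isAffineOpen_chartCocycle (j : ι) [IsAffine (Y j)] : IsAffineOpen ((chartCocycle hY).U j) :=
  (isAffineOpen_top (Y j)).image_of_isOpenImmersion _

lemma solves_chartCocycle {π : (chartRelation hY).glued ⟶ C}
    (hπ : ∀ j, (chartRelation hY).ι j ≫ π = p j) : (chartCocycle hY).Solves s π := by
  intro j U c hc
  refine function_ext_of_cover fun q hq => ?_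
  obtain ⟨y, -, hy⟩ := hq.2
  refine ⟨_, (chartRelation hY).ι j, inferInstance, ⟨y, hy⟩, ?_⟩
  rw [map_sum, map_zero]
  have h2 : (chartRelation hY).ι j ⁻¹ᵁ (π ⁻¹ᵁ U ⊓ (chartCocycle hY).U j) ≤ p j ⁻¹ᵁ U := by
    rw [← hπ j]
    exact fun z hz => hz.1
  have h3 := congrArg (rs h2) ((hY j).solves U c hc)
  rw [map_sum, map_zero] at h3
  refine (Finset.sum_congr rfl fun i _ => ?_).trans h3
  have h5 := app_chartCocycle hY (𝟙 _) _ (Category.id_comp ((chartRelation hY).ι j)) i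
  rw [map_mul, map_mul, app_rs, app_rs, h5, rs_rs, rs_rs,
    app_of_comp_eq (hπ j) U (c i) (by rw [← hπ j]; rfl), rs_rs]
  simp

/-- Over `B.U j` the functions `B.a i j` are coordinates with `j`-th entry `1`, hence define a map
to `Y j`. The cocycle identity makes these maps agree on overlaps. -/
lemma exists_lift_chartCocycle {π : (chartRelation hY).glued ⟶ C}
    (hπ : ∀ j, (chartRelation hY).ι j ≫ π = p j) {T : Scheme.{u}} (f : T ⟶ C) (B : Cocycle T ι)
    (hB : B.Solves s f) :
    ∃ g : T ⟶ (chartRelation hY).glued, g ≫ π = f ∧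
      ∀ j, ∃ h : B.U j ≤ g ⁻¹ᵁ (chartCocycle hY).U j, ∀ i,
        rs h (g.app ((chartCocycle hY).U j) ((chartCocycle hY).a i j)) = B.a i j := by
  have hsol : ∀ j, Solves s ((B.U j).ι ≫ f) fun i => secTop (B.U j) (B.a i j) := by
    intro j U c hc
    have h1 : ((B.U j).ι ≫ f) ⁻¹ᵁ U ≤ (B.U j).ι ⁻¹ᵁ (f ⁻¹ᵁ U ⊓ B.U j) := fun z hz =>
      ⟨hz, top_le_preimage_ι _ trivial⟩
    have h2 := congrArg (rs h1) (congrArg ((B.U j).ι.app _) (hB j U c hc))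
    rw [map_sum, map_sum, map_zero, map_zero] at h2
    refine (Finset.sum_congr rfl fun i _ => ?_).trans h2
    rw [map_mul, map_mul, app_rs, app_rs, app_ι_eq, rs_rs, rs_rs, rs_rs, comp_app_rs]
  choose l hl hl' using fun j => (hY j).exists_lift _ _
    ((congrArg (secTop (B.U j)) (B.diag j)).trans (map_one _)) (hsol j)
  have hcomp : ∀ (j k : ι) (S : Scheme.{u}) (a : S ⟶ (B.U j).toScheme) (b : S ⟶ (B.U k).toScheme),
      a ≫ (B.U j).ι = b ≫ (B.U k).ι →
      a ≫ l j ≫ (chartRelation hY).ι j = b ≫ l k ≫ (chartRelation hY).ι k := by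
    intro j k S a b hab
    rw [← Category.assoc, ← Category.assoc, (chartRelation hY).comp_ι_eq_iff, chartRelation_R]
    refine ⟨by rw [Category.assoc, Category.assoc, hl, hl, ← Category.assoc, hab, Category.assoc],
      fun i => ?_⟩
    have hj : ⊤ ≤ (a ≫ (B.U j).ι) ⁻¹ᵁ B.U j := fun z _ => (a z).2
    have hk : ⊤ ≤ (a ≫ (B.U j).ι) ⁻¹ᵁ B.U k := by
      rw [hab]; exact fun z _ => (b z).2
    rw [appTop_comp, appTop_comp, appTop_comp, hl', hl', hl', appTop_secTop _ _ _ rfl hj,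
      appTop_secTop _ _ _ rfl hj, appTop_secTop _ _ _ hab.symm hk]
    have hkj : ⊤ ≤ (a ≫ (B.U j).ι) ⁻¹ᵁ (B.U k ⊓ B.U j) := le_inf hk hj
    have h1 := congrArg (rs hkj)
      (congrArg ((a ≫ (B.U j).ι).app _) (B.mul i k j))
    rw [map_mul, map_mul, app_rs, app_rs, app_rs, rs_rs, rs_rs, rs_rs] at h1
    exact h1.symm
  obtain ⟨g, hg⟩ := exists_hom_of_local (X := T) (Y := (chartRelation hY).glued)
    (fun V φ => ∃ (j : ι) (h : V = B.U j), φ = T.homOfLE h.le ≫ l j ≫ (chartRelation hY).ι j)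
    (by
      rintro _ _ _ _ ⟨j, rfl, rfl⟩ ⟨k, rfl, rfl⟩ S a b hab
      simp only [Scheme.homOfLE_rfl, Category.id_comp]
      exact hcomp j k S a b hab)
    (fun q => by
      obtain ⟨j, hj⟩ := B.cover q
      exact ⟨B.U j, hj, _, j, rfl, rfl⟩)
  have hg' : ∀ j, (B.U j).ι ≫ g = l j ≫ (chartRelation hY).ι j := fun j => by
    rw [hg _ _ ⟨j, rfl, rfl⟩, Scheme.homOfLE_rfl, Category.id_comp]
  refine ⟨g, ?_, fun j => ?_⟩
  · let c : T.OpenCover := T.openCoverOfIsOpenCover B.U (by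
      rw [IsOpenCover, eq_top_iff]
      intro q _
      obtain ⟨j, hj⟩ := B.cover q
      exact Opens.mem_iSup.mpr ⟨j, hj⟩)
    have h1 : ∀ j, (B.U j).ι ≫ g ≫ π = (B.U j).ι ≫ f := fun j => by
      rw [← Category.assoc, hg', Category.assoc, hπ, hl]
    exact Scheme.Cover.hom_ext c _ _ h1
  · have h1 : B.U j ≤ g ⁻¹ᵁ (chartCocycle hY).U j := by
      intro q hq
      have h2 : g q = ((B.U j).ι ≫ g) ⟨q, hq⟩ := rfl
      change g q ∈ (chartCocycle hY).U j
      rw [h2, hg']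
      exact ⟨l j ⟨q, hq⟩, trivial, rfl⟩
    refine ⟨h1, fun i => function_ext_of_cover fun q hq => ?_⟩
    refine ⟨_, (B.U j).ι, inferInstance, ⟨⟨q, hq⟩, rfl⟩, ?_⟩
    have h2 := app_chartCocycle hY (l j) _ (hg' j).symm i
    rw [comp_app_rs, hl'] at h2
    rw [app_rs, app_ι_eq]
    have h4 : (B.U j).ι ⁻¹ᵁ B.U j ≤ ((B.U j).ι ≫ g) ⁻¹ᵁ (chartCocycle hY).U j := fun z hz => h1 hz
    have h3 := congrArg (rs h4) h2
    rw [rs_rs, rs_rs] at h3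
    exact h3

/-- Near each point both morphisms factor through one chart, where base point and coordinates
decide. -/
lemma hom_ext_chartCocycle {π : (chartRelation hY).glued ⟶ C}
    (hπ : ∀ j, (chartRelation hY).ι j ≫ π = p j) {T : Scheme.{u}}
    {g g' : T ⟶ (chartRelation hY).glued} (hgg : g ≫ π = g' ≫ π)
    (H : ∀ q : T, ∃ (j : ι) (V : T.Opens) (_ : q ∈ V) (h : V ≤ g ⁻¹ᵁ (chartCocycle hY).U j)
      (h' : V ≤ g' ⁻¹ᵁ (chartCocycle hY).U j), ∀ i,
      rs h (g.app _ ((chartCocycle hY).a i j)) = rs h' (g'.app _ ((chartCocycle hY).a i j))) :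
    g = g' := by
  choose j V hV h h' ha using H
  let c : T.OpenCover := T.openCoverOfIsOpenCover V (by
    rw [IsOpenCover, eq_top_iff]
    exact fun q _ => Opens.mem_iSup.mpr ⟨q, hV q⟩)
  refine Scheme.Cover.hom_ext c _ _ fun q => ?_
  change (V q).ι ≫ g = (V q).ι ≫ g'
  have key : ∀ (k : T ⟶ (chartRelation hY).glued) (_ : V q ≤ k ⁻¹ᵁ (chartCocycle hY).U (j q)),
      ∃ l : (V q).toScheme ⟶ Y (j q), l ≫ (chartRelation hY).ι (j q) = (V q).ι ≫ k := by
    intro k hk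
    refine ⟨IsOpenImmersion.lift ((chartRelation hY).ι (j q)) _ ?_, IsOpenImmersion.lift_fac _ _ _⟩
    rintro _ ⟨z, rfl⟩
    obtain ⟨y, -, hy⟩ := hk z.2
    exact ⟨y, hy⟩
  obtain ⟨l, hl⟩ := key g (h q)
  obtain ⟨l', hl'⟩ := key g' (h' q)
  rw [← hl, ← hl']
  congr 1
  refine (hY (j q)).hom_ext ?_ fun i => ?_
  · rw [← hπ, ← Category.assoc, ← Category.assoc, hl, hl', Category.assoc, Category.assoc, hgg]
  · have coords : ∀ (k : T ⟶ (chartRelation hY).glued) (hk : V q ≤ k ⁻¹ᵁ (chartCocycle hY).U (j q))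
        (l : (V q).toScheme ⟶ Y (j q)), l ≫ (chartRelation hY).ι (j q) = (V q).ι ≫ k →
        l.appTop (x (j q) i) =
          secTop (V q) (rs hk (k.app _ ((chartCocycle hY).a i (j q)))) := by
      intro k hk l hl
      have h2 := app_chartCocycle hY l _ hl i
      rw [comp_app_rs] at h2
      have h3 : (⊤ : (V q).toScheme.Opens) ≤ ((V q).ι ≫ k) ⁻¹ᵁ (chartCocycle hY).U (j q) :=
        fun z _ => hk z.2
      have h4 := congrArg (rs h3) h2
      rw [rs_rs, rs_rs, rs_refl] at h4
      rw [← h4, secTop_apply, app_rs, rs_rs]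
    rw [coords g (h q) l hl, coords g' (h' q) l' hl']
    exact congrArg _ (ha q i)

/-- The projective bundle, in terms of homogeneous coordinates. -/
lemma exists_isProjOf (hY : ∀ j, IsChart s j (p j) (x j)) :
    ∃ (P : Scheme.{u}) (π : P ⟶ C) (A : Cocycle P ι), IsProjOf s π A ∧
      ∀ j, IsAffine (Y j) → IsAffineOpen (A.U j) := by
  obtain ⟨π, hπ⟩ := (chartRelation hY).exists_desc p fun g g' H => H.1
  exact ⟨_, π, chartCocycle hY,
    ⟨solves_chartCocycle hY hπ, exists_lift_chartCocycle hY hπ, hom_ext_chartCocycle hY hπ⟩,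
    fun j _ => isAffineOpen_chartCocycle hY j⟩

end

end ProjectiveSpectrum

end

end AmpleBundle

namespace AmpleBundle

noncomputable section

/-! ### Nonvanishing loci and the cocycle of a generated line bundle. -/

section Coordinates

variable {X : Scheme.{u}} {M : X.Modules}

lemma IsBasisOn.smul_injective {V W : X.Opens} {e : Γ(M, V)} (he : IsBasisOn M V fun _ : Unit => e)
    (h : W ≤ V) {a b : Γ(X, W)} (hab : a • res M h e = b • res M h e) : a = b :=
  congrFun (he.coords_unique h (c := fun _ => a) (d := fun _ => b)
    (by simpa only [Fintype.sum_unique] using hab)) ()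

lemma IsBasisOn.exists_smul {V W : X.Opens} {e : Γ(M, V)} (he : IsBasisOn M V fun _ : Unit => e)
    (h : W ≤ V) (y : Γ(M, W)) : ∃ a : Γ(X, W), y = a • res M h e := by
  obtain ⟨c, hc⟩ := he.exists_coords h y
  exact ⟨c (), by simpa only [Fintype.sum_unique] using hc⟩

lemma isBasisOn_iff {V : X.Opens} {e : Γ(M, V)} : (IsBasisOn M V fun _ : Unit => e) ↔
    ∀ W (h : W ≤ V), Function.Bijective fun a : Γ(X, W) => a • res M h e := by
  refine forall_congr' fun W => forall_congr' fun h => ?_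
  rw [← Function.Bijective.of_comp_iff _ (Equiv.funUnique Unit Γ(X, W)).symm.bijective]
  exact iff_of_eq (congrArg _ (funext fun a => by
    simp))

/-- A section dividing a basis is a basis. -/
lemma IsBasisOn.of_smul {V : X.Opens} {e e' : Γ(M, V)} (he : IsBasisOn M V fun _ : Unit => e)
    {c : Γ(X, V)} (hc : e = c • e') : IsBasisOn M V fun _ : Unit => e' := by
  rw [isBasisOn_iff]
  obtain ⟨d, hd⟩ := he.exists_smul le_rfl e'
  rw [res_refl] at hd
  have hcd : d * c = 1 := by
    apply he.smul_injective le_rfl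
    rw [mul_comm, mul_smul, one_smul, res_refl, ← hd, ← hc]
  intro W h
  have h1 : rs h d * rs h c = 1 := by rw [← map_mul, hcd, map_one]
  constructor
  · intro a b hab
    have h2 : (a * rs h d) • res M h e = (b * rs h d) • res M h e := by
      rw [mul_smul, mul_smul, ← res_smul, ← hd]
      exact hab
    have h3 := congrArg (· * rs h c) (he.smul_injective h h2)
    simpa only [mul_assoc, h1, mul_one] using h3
  · intro y
    obtain ⟨a, ha⟩ := he.exists_smul h y
    refine ⟨a * rs h c, ?_⟩
    change (a * rs h c) • res M h e' = y
    rw [mul_smul, ← res_smul, ← hc, ha]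

lemma mem_nonvanishingLocus_iff {t : Γ(M, ⊤)} {x : X} : x ∈ nonvanishingLocus M t ↔
    ∃ V : X.Opens, x ∈ V ∧ IsBasisOn M V fun _ : Unit => rt M V t := by
  rw [nonvanishingLocus, Opens.mem_sSup]
  constructor
  · rintro ⟨V, hV, hx⟩
    refine ⟨V, hx, isBasisOn_iff.2 fun W h => ?_⟩
    rw [res_rt]
    exact hV W h
  · rintro ⟨V, hx, hV⟩
    refine ⟨V, fun W h => ?_, hx⟩
    have := isBasisOn_iff.1 hV W h
    rw [res_rt] at this
    exact this

lemma le_nonvanishingLocus {t : Γ(M, ⊤)} {V : X.Opens}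
    (hV : IsBasisOn M V fun _ : Unit => rt M V t) : V ≤ nonvanishingLocus M t :=
  fun _ hx => mem_nonvanishingLocus_iff.2 ⟨V, hx, hV⟩

/-- The local quotients `y / t` are unique, so they glue over the whole union of opens on which `t`
is a basis. -/
lemma isBasisOn_nonvanishingLocus (t : Γ(M, ⊤)) :
    IsBasisOn M (nonvanishingLocus M t) fun _ : Unit => rt M (nonvanishingLocus M t) t := by
  have hloc : ∀ {W : X.Opens}, W ≤ nonvanishingLocus M t → ∀ p ∈ W, ∃ (V : X.Opens) (_ : V ≤ W),
      p ∈ V ∧ IsBasisOn M V fun _ : Unit => rt M V t := by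
    intro W h p hp
    obtain ⟨V, hpV, hV⟩ := mem_nonvanishingLocus_iff.1 (h hp)
    refine ⟨V ⊓ W, inf_le_right, ⟨hpV, hp⟩, ?_⟩
    have := hV.restrict (inf_le_left : V ⊓ W ≤ V)
    simpa only [res_rt] using this
  rw [isBasisOn_iff]
  intro W h
  simp only [res_rt]
  constructor
  · intro a b hab
    refine function_ext fun p hp => ?_
    obtain ⟨V, hVW, hpV, hV⟩ := hloc h p hp
    refine ⟨V, hVW, hpV, hV.smul_injective le_rfl ?_⟩
    have := congrArg (res M hVW) hab
    simpa only [res_smul, res_rt] using this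
  · intro y
    obtain ⟨a, ha⟩ := exists_function (U := W)
      (fun V hV c => res M hV y = c • rt M V t ∧ IsBasisOn M V fun _ : Unit => rt M V t)
      (by
        rintro V V' hV hV' c c' ⟨hc, hb⟩ ⟨hc', -⟩
        refine hb.smul_injective inf_le_left ?_
        have h1 := congrArg (res M (inf_le_left : V ⊓ V' ≤ V)) hc
        have h2 := congrArg (res M (inf_le_right : V ⊓ V' ≤ V')) hc'
        simp only [res_smul, res_res] at h1 h2 ⊢
        rw [← h1, ← h2])
      (fun p hp => by
        obtain ⟨V, hVW, hpV, hV⟩ := hloc h p hp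
        obtain ⟨c, hc⟩ := hV.exists_smul le_rfl (res M hVW y)
        rw [res_refl] at hc
        exact ⟨V, hVW, hpV, c, hc, hV⟩)
    refine ⟨a, section_ext fun p hp => ?_⟩
    obtain ⟨V, hVW, hpV, hV⟩ := hloc h p hp
    obtain ⟨c, hc⟩ := hV.exists_smul le_rfl (res M hVW y)
    rw [res_refl] at hc
    refine ⟨V, hVW, hpV, ?_⟩
    rw [res_smul, res_rt, hc, ha V hVW c ⟨hc, hV⟩]

variable {ι : Type u}

/-- The transition functions `B.a i j` are the quotients `t i / t j`. -/
def Cocycle.Adapted (B : Cocycle X ι) (t : ι → Γ(M, ⊤)) : Prop :=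
  ∀ i j, rt M (B.U j) (t i) = B.a i j • rt M (B.U j) (t j)

lemma Cocycle.Adapted.sum {ι : Type u} [Fintype ι] {B : Cocycle X ι} {t : ι → Γ(M, ⊤)}
    (hB : B.Adapted t) {W : X.Opens} (c : ι → Γ(X, W)) (j : ι) :
    res M (inf_le_left : W ⊓ B.U j ≤ W) (∑ i, c i • rt M W (t i)) =
      (∑ i, rs inf_le_left (c i) * rs inf_le_right (B.a i j)) • rt M (W ⊓ B.U j) (t j) := by
  rw [res_sum, Finset.sum_smul]
  refine Finset.sum_congr rfl fun i _ => ?_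
  have := congrArg (res M (inf_le_right : W ⊓ B.U j ≤ B.U j)) (hB i j)
  rw [res_smul, res_rt, res_rt] at this
  rw [res_rt, this, mul_smul]

/-- Generating sections of a line bundle have transition functions. -/
lemma IsLineBundle.exists_cocycle (hM : IsLineBundle M) {t : ι → Γ(M, ⊤)} (ht : IsJointlyEpi M t) :
    ∃ B : Cocycle X ι, B.Adapted t ∧
      (∀ j, IsBasisOn M (B.U j) fun _ : Unit => rt M (B.U j) (t j)) ∧
      ∀ j (V : X.Opens), (IsBasisOn M V fun _ : Unit => rt M V (t j)) → V ≤ B.U j := by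
  have hb : ∀ j, _ := fun j => isBasisOn_nonvanishingLocus (t j)
  choose a ha using fun i j => (hb j).exists_smul le_rfl (rt M (nonvanishingLocus M (t j)) (t i))
  simp only [res_refl] at ha
  -- Taking the largest possible loci gives the maximality clause, which uniqueness of classifying
  -- maps relies on.
  refine ⟨⟨fun j => nonvanishingLocus M (t j), a, fun j => ?_, fun i j k => ?_, fun x => ?_⟩,
    ha, hb, fun j V hV => le_nonvanishingLocus hV⟩
  · apply (hb j).smul_injective le_rfl
    rw [res_rt, ← ha, one_smul]
  · apply (hb k).smul_injective inf_le_right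
    have h1 := congrArg (res M (inf_le_left : nonvanishingLocus M (t j) ⊓
      nonvanishingLocus M (t k) ≤ _)) (ha i j)
    have h2 := congrArg (res M (inf_le_right : nonvanishingLocus M (t j) ⊓
      nonvanishingLocus M (t k) ≤ _)) (ha j k)
    have h3 := congrArg (res M (inf_le_right : nonvanishingLocus M (t j) ⊓
      nonvanishingLocus M (t k) ≤ _)) (ha i k)
    simp only [res_smul, res_rt] at h1 h2 h3 ⊢
    rw [mul_smul, ← h2, ← h1, h3]
  · obtain ⟨V, hV, i, hi⟩ := hM.exists_isBasisOn_of_isJointlyEpi ht x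
    exact ⟨i, le_nonvanishingLocus hi hV⟩

variable [Fintype ι]

/-- Over `B.U j` every `t i` is a multiple of `t j`, so relations among sections can be exchanged
for relations among quotients; `Cocycle.Adapted.sum_eq_zero` is the converse direction. -/
lemma Cocycle.Adapted.isRel {B : Cocycle X ι} {t : ι → Γ(M, ⊤)}
    (hB : B.Adapted t) {W : X.Opens} (c : ι → Γ(X, W))
    (h : ∀ j, ∑ i, rs inf_le_left (c i) * rs inf_le_right (B.a i j) = (0 : Γ(X, W ⊓ B.U j))) :
    IsRel M t W c := by
  refine section_ext fun p hp => ?_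
  obtain ⟨j, hj⟩ := B.cover p
  refine ⟨W ⊓ B.U j, inf_le_left, ⟨hp, hj⟩, ?_⟩
  rw [hB.sum, h, zero_smul, map_zero]

lemma Cocycle.Adapted.sum_eq_zero {B : Cocycle X ι} {t : ι → Γ(M, ⊤)}
    (hB : B.Adapted t) (hb : ∀ j, IsBasisOn M (B.U j) fun _ : Unit => rt M (B.U j) (t j))
    {W : X.Opens} {c : ι → Γ(X, W)} (h : IsRel M t W c) (j : ι) :
    ∑ i, rs inf_le_left (c i) * rs inf_le_right (B.a i j) = (0 : Γ(X, W ⊓ B.U j)) := by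
  apply (hb j).smul_injective inf_le_right
  rw [res_rt, ← hB.sum, show ∑ i, c i • rt M W (t i) = 0 from h, map_zero, zero_smul]

lemma isGen_of_isBasisOn {B : Cocycle X ι} {t : ι → Γ(M, ⊤)}
    (hb : ∀ j, IsBasisOn M (B.U j) fun _ : Unit => rt M (B.U j) (t j)) : IsGen M t := by
  classical
  intro U y p hp
  obtain ⟨j, hj⟩ := B.cover p
  obtain ⟨c, hc⟩ := (hb j).exists_smul (inf_le_right : U ⊓ B.U j ≤ B.U j) (res M inf_le_left y)
  refine ⟨U ⊓ B.U j, inf_le_left, ⟨hp, hj⟩, fun i => if i = j then c else 0, ?_⟩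
  rw [hc, res_rt]
  simp [ite_smul]

lemma Cocycle.isGen_t (A : Cocycle X ι) : IsGen A.bundle A.t :=
  isGen_of_isBasisOn A.isBasisOn_t

end Coordinates

end

end AmpleBundle

namespace AmpleBundle

noncomputable section

/-! ### The universal property of the projective bundle. -/

section UniversalProperty

variable {C : Scheme.{u}} {ι : Type u} {E : C.Modules} {s : ι → Γ(E, ⊤)}
  {P : Scheme.{u}} {π : P ⟶ C} {A : Cocycle P ι}

lemma Cocycle.adapted_t (A : Cocycle P ι) : A.Adapted A.t := A.rt_t

lemma pullSec_smul {X Y : Scheme.{u}} (f : X ⟶ Y) {E : Y.Modules} {M : X.Modules}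
    (q : (Scheme.Modules.pullback f).obj E ⟶ M) {U : Y.Opens} (r : Γ(Y, U)) (y : Γ(E, U)) :
    pullSec f q U (r • y) = f.app U r • pullSec f q U y := by
  simpa using pullSec_sum f q {()} (fun _ => r) (fun _ => y)

lemma rt_pullTop_t {T : Scheme.{u}} (g : T ⟶ P) {M : T.Modules}
    (q : (Scheme.Modules.pullback g).obj A.bundle ⟶ M) (i j : ι) :
    rt M (g ⁻¹ᵁ A.U j) (pullTop g q (A.t i)) =
      g.app (A.U j) (A.a i j) • rt M (g ⁻¹ᵁ A.U j) (pullTop g q (A.t j)) := by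
  rw [← res_pullSec, ← res_pullSec, A.rt_t i j, pullSec_smul]

variable [Fintype ι]

/-- The tautological quotient. -/
lemma IsProjOf.exists_quot (h : IsProjOf s π A) (hs : IsGen E s) :
    ∃ q : (Scheme.Modules.pullback π).obj E ⟶ A.bundle, Epi q ∧
      ∀ i, pullTop π q (s i) = A.t i := by
  obtain ⟨q, hq⟩ := exists_pullback_hom π hs A.t fun U c hc =>
    A.adapted_t.isRel _ fun j => h.solves j U c hc
  refine ⟨q, IsJointlyEpi.epi (s := s) q ?_, hq⟩
  simp only [hq]
  exact A.isGen_t.isJointlyEpi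

/-- A morphism that pulls back homogeneous coordinates pulls back the tautological bundle. -/
lemma exists_pullback_iso {T : Scheme.{u}} (g : T ⟶ P) {M : T.Modules} {t : ι → Γ(M, ⊤)}
    {B : Cocycle T ι} (hB : B.Adapted t)
    (hb : ∀ j, IsBasisOn M (B.U j) fun _ : Unit => rt M (B.U j) (t j))
    (hU : ∀ j, B.U j ≤ g ⁻¹ᵁ A.U j)
    (ha : ∀ i j, rs (hU j) (g.app (A.U j) (A.a i j)) = B.a i j) :
    ∃ e : (Scheme.Modules.pullback g).obj A.bundle ≅ M, ∀ i, pullTop g e.hom (A.t i) = t i := by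
  obtain ⟨e, he⟩ := exists_pullback_hom g A.isGen_t t fun U c hc =>
    hB.isRel _ fun j => by
      have h1 : g ⁻¹ᵁ U ⊓ B.U j ≤ g ⁻¹ᵁ (U ⊓ A.U j) := inf_le_inf le_rfl (hU j)
      have h2 := congrArg (rs h1) (congrArg (g.app _) (A.adapted_t.sum_eq_zero A.isBasisOn_t hc j))
      rw [map_sum, map_sum, map_zero, map_zero] at h2
      refine (Finset.sum_congr rfl fun i _ => ?_).trans h2
      rw [map_mul, map_mul, app_rs, app_rs, rs_rs, rs_rs, ← ha, rs_rs]
  -- The `v i` are the pulled-back generators. The inverse sends `t i` to `v i`, and both composites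
  -- fix the generators.
  let v : ι → Γ((Scheme.Modules.pullback g).obj A.bundle, ⊤) := fun i => pullTop g (𝟙 _) (A.t i)
  have hv : B.Adapted v := by
    intro i j
    have := congrArg (res _ (hU j)) (rt_pullTop_t g (𝟙 _) i j)
    rwa [res_smul, res_rt, res_rt, ha] at this
  obtain ⟨e', he'⟩ := (isGen_of_isBasisOn hb).exists_hom v fun W c hc =>
    hv.isRel _ fun j => hB.sum_eq_zero hb hc j
  refine ⟨⟨e, e', ?_, ?_⟩, he⟩
  · refine A.isGen_t.isJointlyEpi.pullback_hom_ext fun i => ?_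
    rw [pullTop_comp, he, he']
  · refine (isGen_of_isBasisOn hb).hom_ext fun i => ?_
    have h1 : e.app ⊤ (v i) = t i := by
      rw [← he, ← Category.id_comp e, pullTop_comp, Category.id_comp]
    change e.app ⊤ (e'.app ⊤ (t i)) = t i
    rw [he', h1]

/-- This reduces the diagram in `ProjectiveBundle` to equalities of global sections, the form in
which existence and uniqueness are proved. -/
lemma pullback_compatible_iff {T : Scheme.{u}} (g : T ⟶ P) (f : T ⟶ C) (w : g ≫ π = f)
    {M : T.Modules} (hs : IsGen E s) (p : (Scheme.Modules.pullback π).obj E ⟶ A.bundle)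
    (hp : ∀ i, pullTop π p (s i) = A.t i)
    (q : (Scheme.Modules.pullback f).obj E ⟶ M)
    (e : (Scheme.Modules.pullback g).obj A.bundle ⟶ M) :
    (Scheme.Modules.pullback g).map p ≫ e = (Scheme.Modules.pullbackComp g π).hom.app E ≫
      (Scheme.Modules.pullbackCongr w).hom.app E ≫ q ↔
      ∀ i, pullTop g e (A.t i) = pullTop f q (s i) := by
  subst w
  have h1 : (Scheme.Modules.pullbackCongr (rfl : g ≫ π = g ≫ π)).hom.app E = 𝟙 _ := by
    simp [Scheme.Modules.pullbackCongr]
  rw [h1, Category.id_comp, pullTop_pullbackComp g π p e q hs.isJointlyEpi]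
  simp only [hp]

/-- A scheme with homogeneous coordinates is the projective bundle. -/
lemma IsProjOf.isAmple (h : IsProjOf s π A) (hs : IsGen E s)
    (hA : IsAmpleLineBundle A.bundle) : IsAmple E := by
  obtain ⟨p, hp, hpt⟩ := h.exists_quot hs
  refine ⟨⟨P, π, A.bundle, A.isLineBundle, p, hp, fun {T} f M hM q hq => ?_⟩, hA⟩
  have hu : IsJointlyEpi M fun i => pullTop f q (s i) := hs.isJointlyEpi.of_epi q
  -- The images in `M` of the generators of `E` supply the homogeneous coordinates of the
  -- classifying map.
  obtain ⟨B, hB, hb, hmax⟩ := hM.exists_cocycle hu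
  obtain ⟨g, hg, hgB⟩ := h.exists_lift f B fun j U c hc =>
    hB.sum_eq_zero hb (IsRel.pullTop q hc) j
  choose hU ha using hgB
  obtain ⟨e, he⟩ := exists_pullback_iso g hB hb hU fun i j => ha j i
  refine ⟨g, ⟨hg, e, (pullback_compatible_iff g f hg hs p hpt q e.hom).2 he⟩, ?_⟩
  rintro g' ⟨hg', e', hge'⟩
  rw [pullback_compatible_iff g' f hg' hs p hpt] at hge'
  refine h.hom_ext (hg'.trans hg.symm) fun x => ?_
  obtain ⟨j, hj⟩ := A.cover (g' x)
  obtain ⟨V, hxV, i, hi⟩ := hM.exists_isBasisOn_of_isJointlyEpi hu x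
  have hrel : ∀ i, rt M (V ⊓ g' ⁻¹ᵁ A.U j) (pullTop f q (s i)) =
      rs (inf_le_right : V ⊓ g' ⁻¹ᵁ A.U j ≤ _) (g'.app (A.U j) (A.a i j)) •
        rt M (V ⊓ g' ⁻¹ᵁ A.U j) (pullTop f q (s j)) := by
    intro i
    have := congrArg (res M (inf_le_right : V ⊓ g' ⁻¹ᵁ A.U j ≤ _)) (rt_pullTop_t g' e'.hom i j)
    rwa [hge', hge', res_smul, res_rt, res_rt] at this
  -- For a competing `g'`, the `j`-th section divides a local basis, so it is itself a basis here.
  -- By maximality this open set lies in `B.U j`, where both maps have the quotients by the `j`-th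
  -- section as coordinates.
  have hbas : IsBasisOn M (V ⊓ g' ⁻¹ᵁ A.U j) fun _ : Unit =>
      rt M (V ⊓ g' ⁻¹ᵁ A.U j) (pullTop f q (s j)) := by
    have h1 := hi.restrict (inf_le_left : V ⊓ g' ⁻¹ᵁ A.U j ≤ V)
    simp only [res_rt] at h1
    exact h1.of_smul (hrel i)
  have hle := hmax j _ hbas
  refine ⟨j, V ⊓ g' ⁻¹ᵁ A.U j, ⟨hxV, hj⟩, inf_le_right, hle.trans (hU j), fun l => ?_⟩
  have h2 := congrArg (rs hle) (ha j l)
  rw [rs_rs] at h2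
  rw [h2]
  apply hbas.smul_injective le_rfl
  rw [res_refl, ← hrel]
  have h3 := congrArg (res M hle) (hB l j)
  rwa [res_smul, res_rt, res_rt] at h3

end UniversalProperty

end

end AmpleBundle

namespace AmpleBundle

noncomputable section

/-! ### The first tensor power and nonvanishing loci. -/

section TensorPower

open MonoidalCategory

variable {X : Scheme.{u}}

/-- The category of presheaves of modules over the structure sheaf. -/
abbrev PresheafModules (X : Scheme.{u}) :=
  _root_.PresheafOfModules.{u} (X.presheaf ⋙ forget₂ CommRingCat.{u} RingCat.{u})

/-- The presheaf underlying a sheaf of modules. -/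
def toPresheafModules (L : X.Modules) : PresheafModules X := L.val

/-- The unit law for presheaves of modules. -/
def presheafLeftUnitor (M : PresheafModules X) : 𝟙_ (PresheafModules X) ⊗ M ≅ M := λ_ M

/-- A sheaf of modules is its own sheafification. -/
def sheafificationSelfIso (L : X.Modules) :
    (PresheafOfModules.sheafification (𝟙 X.ringCatSheaf.obj)).obj L.val ≅ L :=
  (PresheafOfModules.sheafification (𝟙 X.ringCatSheaf.obj)).mapIso
   (show L.val ≅ (PresheafOfModules.restrictScalars (𝟙 X.ringCatSheaf.obj)).obj L.val
    from Iso.refl _) ≪≫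
    (asIso (PresheafOfModules.sheafificationAdjunction (R := X.ringCatSheaf)
      (𝟙 X.ringCatSheaf.obj)).counit).app L

/-- The first tensor power. -/
def tensorPowerOneIso (L : X.Modules) : tensorPower L 1 ≅ L :=
  show (PresheafOfModules.sheafification (𝟙 X.ringCatSheaf.obj)).obj (presheafTensorPower L 1) ≅ L
  from (PresheafOfModules.sheafification (𝟙 X.ringCatSheaf.obj)).mapIso
    (presheafLeftUnitor (toPresheafModules L)) ≪≫ sheafificationSelfIso L

lemma IsBasisOn.map_iso {M N : X.Modules} (φ : M ≅ N) {V : X.Opens} {κ : Type*} [Fintype κ]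
    {e : κ → Γ(M, V)} (he : IsBasisOn M V e) : IsBasisOn N V fun k => φ.hom.app V (e k) := by
  intro W h
  have h1 : ∀ y : Γ(M, W), φ.inv.app W (φ.hom.app W y) = y := fun y => by
    change (φ.hom ≫ φ.inv).app W y = y
    rw [φ.hom_inv_id]; rfl
  have h2 : ∀ y : Γ(N, W), φ.hom.app W (φ.inv.app W y) = y := fun y => by
    change (φ.inv ≫ φ.hom).app W y = y
    rw [φ.inv_hom_id]; rfl
  have h3 : (fun c : κ → Γ(X, W) => ∑ k, c k • res N h (φ.hom.app V (e k))) =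
      φ.hom.app W ∘ fun c : κ → Γ(X, W) => ∑ k, c k • res M h (e k) := by
    funext c
    change _ = φ.hom.app W (∑ k, c k • res M h (e k))
    rw [app_sum]
    simp only [app_res]
  rw [h3]
  exact Function.Bijective.comp
    (Function.bijective_iff_has_inverse.2 ⟨φ.inv.app W, h1, h2⟩) (he W h)

lemma nonvanishingLocus_iso {M N : X.Modules} (φ : M ≅ N) (t : Γ(N, ⊤)) :
    nonvanishingLocus M (φ.inv.app ⊤ t) = nonvanishingLocus N t := by
  have key : ∀ {M N : X.Modules} (φ : M ≅ N) (t : Γ(N, ⊤)),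
      nonvanishingLocus N t ≤ nonvanishingLocus M (φ.inv.app ⊤ t) := by
    intro M N φ t
    refine le_nonvanishingLocus ?_
    have := (isBasisOn_nonvanishingLocus t).map_iso φ.symm
    simp only [Iso.symm_hom, app_rt] at this
    exact this
  have h1 : φ.hom.app ⊤ (φ.inv.app ⊤ t) = t := by
    change (φ.inv ≫ φ.hom).app ⊤ t = t
    rw [φ.inv_hom_id]; rfl
  refine le_antisymm ?_ (key φ t)
  have := key φ.symm (φ.inv.app ⊤ t)
  rwa [Iso.symm_inv, h1] at this

end TensorPower

/-! ### Ampleness of the tautological bundle when the charts are affine. -/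

section Ample

variable {C : Scheme.{u}} {ι : Type u} [Fintype ι] {E : C.Modules} {s : ι → Γ(E, ⊤)}
  {P : Scheme.{u}} {π : P ⟶ C} {A : Cocycle P ι}

/-- The maximal cocycle `B` of the tautological bundle is classified by a map `P ⟶ P` over `C`,
which uniqueness forces to be the identity. So the nonvanishing locus of `t j` is no larger than the
chart. -/
lemma IsProjOf.nonvanishingLocus_t (h : IsProjOf s π A) (j : ι) :
    nonvanishingLocus A.bundle (A.t j) = A.U j := by
  obtain ⟨B, hB, hb, hmax⟩ := A.isLineBundle.exists_cocycle A.isGen_t.isJointlyEpi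
  obtain ⟨g, hg, hgB⟩ := h.exists_lift π B fun k U c hc =>
    hB.sum_eq_zero hb (A.adapted_t.isRel _ fun j => h.solves j U c hc) k
  choose hU ha using hgB
  have hgid : g = 𝟙 P := by
    refine h.hom_ext (hg.trans (Category.id_comp π).symm) fun x => ?_
    obtain ⟨k, hk⟩ := A.cover x
    have hle := hmax k _ (A.isBasisOn_t k)
    refine ⟨k, A.U k, hk, hle.trans (hU k), le_rfl, fun l => ?_⟩
    have h2 := congrArg (rs hle) (ha k l)
    rw [rs_rs] at h2
    rw [h2]
    apply (A.isBasisOn_t k).smul_injective le_rfl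
    have h3 := congrArg (res A.bundle hle) (hB l k)
    rw [res_smul, res_rt, res_rt] at h3
    rw [res_refl, ← h3, A.rt_t l k]
    exact congrArg (· • rt A.bundle (A.U k) (A.t k)) (rs_refl le_rfl (A.a l k)).symm
  refine le_antisymm ((hmax j _ (isBasisOn_nonvanishingLocus _)).trans ?_)
    (le_nonvanishingLocus (A.isBasisOn_t j))
  have := hU j
  rw [hgid] at this
  exact this

lemma IsProjOf.isAmpleLineBundle (h : IsProjOf s π A) (hA : ∀ j, IsAffineOpen (A.U j)) :
    IsAmpleLineBundle A.bundle where
  isLineBundle := A.isLineBundle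
  compactSpace := by
    refine ⟨?_⟩
    have : (Set.univ : Set P) = ⋃ j, (A.U j : Set P) := by
      refine (Set.eq_univ_of_forall fun x => ?_).symm
      obtain ⟨j, hj⟩ := A.cover x
      exact Set.mem_iUnion.mpr ⟨j, hj⟩
    rw [this]
    exact isCompact_iUnion fun j => (hA j).isCompact
  exists_affine x := by
    obtain ⟨j, hj⟩ := A.cover x
    -- The power `n = 1` is enough: the affine charts are the nonvanishing loci of the tautological
    -- sections.
    refine ⟨1, one_pos, (tensorPowerOneIso A.bundle).inv.app ⊤ (A.t j), ?_⟩
    rw [nonvanishingLocus_iso, h.nonvanishingLocus_t]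
    exact ⟨hj, hA j⟩

end Ample

end

end AmpleBundle

namespace AmpleBundle

noncomputable section

/-! ### Splitting off the structure sheaf. -/

section Retract

variable {X : Scheme.{u}}

/-- The morphism of abelian sheaves underlying a morphism of sheaves of modules. -/
def toAbSheafMap {M N : X.Modules} (φ : M ⟶ N) : toAbSheaf M ⟶ toAbSheaf N := ⟨φ.mapPresheaf⟩

lemma toAbSheafMap_comp {M N : X.Modules} (φ : M ⟶ N) (ψ : N ⟶ M) (h : φ ≫ ψ = 𝟙 M) :
    toAbSheafMap φ ≫ toAbSheafMap ψ = 𝟙 _ := by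
  apply Sheaf.hom_ext
  change φ.mapPresheaf ≫ ψ.mapPresheaf = 𝟙 _
  exact congrArg Scheme.Modules.Hom.mapPresheaf h

lemma subsingleton_cohomology_of_retract {M N : X.Modules} (φ : M ⟶ N) (ψ : N ⟶ M)
    (h : φ ≫ ψ = 𝟙 M) (n : ℕ) (hN : Subsingleton (Cohomology N n)) :
    Subsingleton (Cohomology M n) := by
  refine ⟨fun x y => ?_⟩
  have key : ∀ z : Sheaf.H (toAbSheaf M) n,
      Sheaf.H.map (toAbSheafMap ψ) n (Sheaf.H.map (toAbSheafMap φ) n z) = z := by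
    intro z
    rw [← Sheaf.H.map_comp_apply, toAbSheafMap_comp φ ψ h, Sheaf.H.map_id_apply]
  have h1 : Sheaf.H.map (toAbSheafMap φ) n x = Sheaf.H.map (toAbSheafMap φ) n y := hN.elim _ _
  exact (key x).symm.trans ((congrArg _ h1).trans (key y))

lemma isGen_structureModule : IsGen (structureModule X)
    fun _ : Unit => (unitEquiv X ⊤).symm 1 := by
  intro U y p hp
  refine ⟨U, le_rfl, hp, fun _ => unitEquiv X U y, ?_⟩
  rw [Fintype.sum_unique, res_refl, rt, unitEquiv_symm_res, unitEquiv_symm_smul, map_one, mul_one]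
  rfl

lemma exists_hom_structureModule {M : X.Modules} (t : Γ(M, ⊤)) :
    ∃ φ : structureModule X ⟶ M, φ.app ⊤ ((unitEquiv X ⊤).symm 1) = t := by
  obtain ⟨φ, hφ⟩ := (isGen_structureModule (X := X)).exists_hom (fun _ => t) fun U c hc => by
    rw [IsRel, Fintype.sum_unique, rt, unitEquiv_symm_res, unitEquiv_symm_smul, map_one,
      mul_one] at hc
    have h1 : c default = 0 := (unitEquiv X U).symm.injective (hc.trans (map_zero _).symm)
    rw [IsRel, Fintype.sum_unique, h1, zero_smul]
  exact ⟨φ, hφ ()⟩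

/-- A section mapping to `1` defines a morphism from `𝒪` that splits `φ`. Then `H^1(𝒪)` is a retract
of `H^1(M) = 0` and the genus vanishes. This is where the cohomological hypotheses enter. -/
lemma hom_structureModule_ne_one {k : Type u} [Field k] (f : X ⟶ Spec (.of k)) (hg : 1 ≤ genus f)
    {M : X.Modules} (hM : Subsingleton (Cohomology M 1)) (φ : M ⟶ structureModule X)
    (t : Γ(M, ⊤)) : φ.app ⊤ t ≠ (unitEquiv X ⊤).symm 1 := by
  intro h
  obtain ⟨ψ, hψ⟩ := exists_hom_structureModule t
  have h1 : ψ ≫ φ = 𝟙 _ := isGen_structureModule.hom_ext fun i => by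
    change φ.app ⊤ (ψ.app ⊤ _) = _
    rw [hψ, h]
    rfl
  have h2 := subsingleton_cohomology_of_retract ψ φ h1 1 hM
  let _ : Module k (Cohomology (structureModule X) 1) := Module.compHom _ (scalarMap f)
  have h3 : genus f = 0 := Module.finrank_zero_of_subsingleton
  omega

end Retract

/-! ### Closed subsets of curves. -/

section Curve

/-- Proper closed subsets of irreducible Noetherian spaces of dimension one are finite. -/
lemma finite_of_isClosed {X : Type*} [TopologicalSpace X] [T0Space X] [IrreducibleSpace X] [NoetherianSpace X]
    [QuasiSober X] (hX : topologicalKrullDim X = 1) {F : Set X} (hF : IsClosed F)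
    (hF' : F ≠ Set.univ) : F.Finite := by
  obtain ⟨S, hSf, hSc, hSi, hS⟩ := NoetherianSpace.exists_finite_set_isClosed_irreducible hF
  rw [hS]
  refine hSf.sUnion fun W hW => ?_
  have hWF : W ⊆ F := hS ▸ Set.subset_sUnion_of_mem hW
  obtain ⟨η, hη⟩ := QuasiSober.sober (hSi W hW) (hSc W hW)
  refine (Set.finite_singleton η).subset fun y hy => ?_
  by_contra hne
  -- A non-generic point `y` of a component `W` of `F` would give the chain `closure {y} < W <
  -- univ`, too long for dimension one. So each component is a single point.
  let a : IrreducibleCloseds X := ⟨closure {y}, isIrreducible_singleton.closure, isClosed_closure⟩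
  let b : IrreducibleCloseds X := ⟨W, hSi W hW, hSc W hW⟩
  let c : IrreducibleCloseds X := ⟨Set.univ, IrreducibleSpace.isIrreducible_univ X, isClosed_univ⟩
  have hab : a < b := lt_of_le_of_ne ((hSc W hW).closure_subset_iff.mpr
    (Set.singleton_subset_iff.mpr hy)) fun h => hne ?_
  · have hbc : b < c := lt_of_le_of_ne (Set.subset_univ W) fun h =>
      hF' (Set.univ_subset_iff.mp ((congrArg SetLike.coe h).symm.subset.trans hWF))
    let l : LTSeries (IrreducibleCloseds X) :=
      { length := 2
        toFun := ![a, b, c]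
        step := fun i => by
          fin_cases i
          · exact hab
          · exact hbc }
    have hl : ((2 : ℕ) : WithBot ℕ∞) ≤ 1 := (Order.LTSeries.length_le_krullDim l).trans_eq hX
    exact absurd hl (by decide)
  · have h1 : IsGenericPoint y W := congrArg SetLike.coe h
    exact h1.eq hη

end Curve

end

end AmpleBundle

namespace AmpleBundle

noncomputable section

/-! ### Properness, and finite sets in affine opens. -/

section Projective

variable (k : Type u) [Field k] (n : ℕ)

local notation "𝒮" => MvPolynomial.homogeneousSubmodule (Fin (n + 1)) k

/-- Forms of degree zero are constants. Hence `Spec` of the degree-zero part is closed in `Spec k`,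
and properness of `Proj` over the former gives properness over `k`. -/
lemma algebraMap_homogeneousSubmodule_zero_surjective :
    Function.Surjective (algebraMap k (𝒮 0)) := by
  rintro ⟨p, hp⟩
  refine ⟨p.coeff 0, Subtype.ext ?_⟩
  have h : p.totalDegree = 0 := Nat.le_zero.mp (MvPolynomial.IsHomogeneous.totalDegree_le hp)
  exact (MvPolynomial.totalDegree_eq_zero_iff_eq_C.mp h).symm

instance : IsScalarTower k (𝒮 0) (MvPolynomial (Fin (n + 1)) k) :=
  ⟨fun a b c => Algebra.smul_mul_assoc a b.1 c⟩

instance : Algebra.FiniteType (𝒮 0) (MvPolynomial (Fin (n + 1)) k) :=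
  Algebra.FiniteType.of_restrictScalars_finiteType k _ _

instance : IsProper (projectiveSpaceToSpec k n) := by
  have : IsClosedImmersion (Spec.map (CommRingCat.ofHom (algebraMap k (𝒮 0)))) :=
    IsClosedImmersion.spec_of_surjective _ (algebraMap_homogeneousSubmodule_zero_surjective k n)
  have h : IsProper (Proj.toSpecZero 𝒮) := inferInstance
  exact MorphismProperty.comp_mem @IsProper _ _ h inferInstance

/-- Over an infinite field some hyperplane avoids all the given points, because a vector space is
not a finite union of proper subspaces. Its complement is affine. -/
lemma exists_isAffineOpen_projectiveSpace [Infinite k] {F : Set (projectiveSpace k n)}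
    (hF : F.Finite) : ∃ U : (projectiveSpace k n).Opens, IsAffineOpen U ∧ F ⊆ U := by
  let p : F → Submodule k (𝒮 1) := fun y =>
    Submodule.comap (𝒮 1).subtype (y.1.asHomogeneousIdeal.toIdeal.restrictScalars k)
  have hp : ⋃ y, (p y : Set (𝒮 1)) ≠ Set.univ := by
    intro h
    have := hF.to_subtype
    obtain ⟨y, hy⟩ := Subspace.exists_eq_top_of_iUnion_eq_univ h
    -- The variables generate the polynomial ring over its degree-zero part, so they do not all
    -- vanish at `y`: the linear forms vanishing there form a proper subspace.
    have h1 := Proj.iSup_basicOpen_eq_top' 𝒮 (MvPolynomial.X : Fin (n + 1) → _)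
      (fun i => ⟨1, MvPolynomial.isHomogeneous_X k i⟩) (by
        refine eq_top_iff.mpr fun q _ => ?_
        induction q using MvPolynomial.induction_on with
        | C a =>
          exact Subalgebra.algebraMap_mem _
            (⟨MvPolynomial.C a, MvPolynomial.isHomogeneous_C _ a⟩ : 𝒮 0)
        | add q r hq hr => exact add_mem (hq trivial) (hr trivial)
        | mul_X q i hq => exact mul_mem (hq trivial) (Algebra.subset_adjoin ⟨i, rfl⟩))
    have h2 : y.1 ∈ ⨆ i, Proj.basicOpen 𝒮 (MvPolynomial.X i) := h1 ▸ trivial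
    obtain ⟨i, hi⟩ := Opens.mem_iSup.mp h2
    have h3 : (⟨MvPolynomial.X i, MvPolynomial.isHomogeneous_X k i⟩ : 𝒮 1) ∈ p y := hy ▸ trivial
    exact hi h3
  obtain ⟨l, hl⟩ := (Set.ne_univ_iff_exists_notMem _).mp hp
  refine ⟨Proj.basicOpen 𝒮 l.1, Proj.isAffineOpen_basicOpen 𝒮 l.1 l.2 one_pos, fun y hy hly => ?_⟩
  exact hl (Set.mem_iUnion.mpr ⟨⟨y, hy⟩, hly⟩)

end Projective

section

variable {k : Type u} [Field k] {X : Scheme.{u}} {f : X ⟶ Spec (.of k)}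

lemma IsProjective.isProper (h : IsProjective f) : IsProper f := by
  obtain ⟨n, i, hi, rfl⟩ := h
  infer_instance

lemma IsProjective.isNoetherian (h : IsProjective f) : IsNoetherian X := by
  have := h.isProper
  have : CompactSpace X := ⟨f.isCompact_preimage (U := ⊤) isCompact_univ⟩
  have : IsLocallyNoetherian X := LocallyOfFiniteType.isLocallyNoetherian f
  exact {}

lemma IsProjective.exists_isAffineOpen [Infinite k] (h : IsProjective f) {F : Set X}
    (hF : F.Finite) : ∃ U : X.Opens, IsAffineOpen U ∧ F ⊆ U := by
  obtain ⟨n, i, hi, -⟩ := h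
  obtain ⟨U, hU, hFU⟩ := exists_isAffineOpen_projectiveSpace k n (hF.image i)
  exact ⟨i ⁻¹ᵁ U, hU.preimage i, fun x hx => hFU ⟨x, hx, rfl⟩⟩

end

end

end AmpleBundle

namespace AmpleBundle

noncomputable section

/-! ### The projection from a chart to affine space over the field. -/

section ClosedMap

variable {k : Type u} [Field k] {ι : Type u} {C Y : Scheme.{u}}

lemma comp_scalarMap (p : Y ⟶ C) (f : C ⟶ Spec (.of k)) (a : k) :
    p.appTop (scalarMap f a) = scalarMap (p ≫ f) a := rfl

lemma toSpecΓ_scalarMap (f : Y ⟶ Spec (.of k)) :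
    Y.toSpecΓ ≫ Spec.map (CommRingCat.ofHom (scalarMap f)) = f := by
  have h : CommRingCat.ofHom (scalarMap f) = (Scheme.ΓSpecIso (.of k)).inv ≫ f.appTop := rfl
  rw [h, Spec.map_comp, ← Scheme.toSpecΓ_naturality_assoc, ← Scheme.isoSpec_Spec_inv]
  exact (congrArg (f ≫ ·) (Scheme.isoSpec (Spec (.of k))).hom_inv_id).trans (Category.comp_id _)

/-- `θ` is the closed immersion into `𝔸(ι; C)` followed by the projection to `𝔸(ι; k)`, which is a
base change of the universally closed `f`. -/
lemma exists_isClosedMap (f : C ⟶ Spec (.of k)) [UniversallyClosed f] (p : Y ⟶ C)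
    (x : ι → Γ(Y, ⊤)) [IsClosedImmersion (AffineSpace.homOfVector p x)] :
    ∃ θ : Y ⟶ Spec (.of (MvPolynomial ι k)), IsClosedMap θ ∧ ∀ g : MvPolynomial ι k,
      θ ⁻¹ᵁ PrimeSpectrum.basicOpen g =
        Y.basicOpen (MvPolynomial.eval₂Hom (scalarMap (p ≫ f)) x g) := by
  let Φ : MvPolynomial ι k →+* Γ(Y, ⊤) := MvPolynomial.eval₂Hom (scalarMap (p ≫ f)) x
  let θ : Y ⟶ Spec (.of (MvPolynomial ι k)) := Y.toSpecΓ ≫ Spec.map (CommRingCat.ofHom Φ)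
  have hθ : θ ≫ (AffineSpace.SpecIso ι (.of k)).inv =
      AffineSpace.homOfVector p x ≫ AffineSpace.map ι f := by
    refine AffineSpace.hom_ext ?_ fun i => ?_
    · rw [Category.assoc, Category.assoc, Category.assoc, AffineSpace.SpecIso_inv_over,
        AffineSpace.map_over, AffineSpace.homOfVector_over_assoc, ← Spec.map_comp,
        ← CommRingCat.ofHom_comp, MvPolynomial.eval₂Hom_comp_C]
      exact toSpecΓ_scalarMap (p ≫ f)
    · rw [appTop_comp, appTop_comp (AffineSpace.homOfVector p x), AffineSpace.map_appTop_coord,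
        AffineSpace.homOfVector_appTop_coord, AffineSpace.SpecIso_inv_appTop_coord, appTop_comp]
      have h := ConcreteCategory.congr_hom
        (Scheme.ΓSpecIso_inv_naturality (CommRingCat.ofHom Φ)) (MvPolynomial.X i)
      refine (congrArg Y.toSpecΓ.appTop h.symm).trans ?_
      rw [Scheme.toSpecΓ_appTop]
      exact (Iso.inv_hom_id_apply (Scheme.ΓSpecIso Γ(Y, ⊤)) _).trans (MvPolynomial.eval₂_X _ _ _)
  have h1 : UniversallyClosed (AffineSpace.map ι f) :=
    MorphismProperty.of_isPullback (P := @UniversallyClosed)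
      (AffineSpace.isPullback_map f).flip inferInstance
  have h2 : UniversallyClosed θ := by
    rw [← Category.comp_id θ, ← (AffineSpace.SpecIso ι (.of k)).inv_hom_id, ← Category.assoc, hθ]
    infer_instance
  exact ⟨θ, θ.isClosedMap, fun g => Y.toSpecΓ_preimage_basicOpen (Φ g)⟩

end ClosedMap

/-! ### Affineness of the charts. -/

section Criterion

variable {k : Type u} [Field k] [IsAlgClosed k] {ι : Type u} [Fintype ι] {C Y : Scheme.{u}}

/-- By the Nullstellensatz every maximal ideal of the polynomial ring is a point `a`, so the
polynomials with affine basic open preimage generate the unit ideal. -/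
lemma isAffine_of_polynomial (Φ : MvPolynomial ι k →+* Γ(Y, ⊤))
    (H : ∀ a : ι → k, ∃ g, MvPolynomial.eval a g ≠ 0 ∧ IsAffineOpen (Y.basicOpen (Φ g))) :
    IsAffine Y := by
  let S : Set (MvPolynomial ι k) := {g | IsAffineOpen (Y.basicOpen (Φ g))}
  have hS : Ideal.span S = ⊤ := by
    by_contra h
    obtain ⟨m, hm, hSm⟩ := Ideal.exists_le_maximal _ h
    obtain ⟨a, rfl⟩ := MvPolynomial.isMaximal_iff_eq_vanishingIdeal_singleton.mp hm
    obtain ⟨g, hg, hg'⟩ := H a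
    exact hg ((MvPolynomial.mem_vanishingIdeal_singleton_iff a g).mp
      (hSm (Ideal.subset_span hg')))
  refine isAffine_of_isAffineOpen_basicOpen (Φ '' S) ?_ ?_
  · rw [← Ideal.map_span, hS, Ideal.map_top]
  · rintro _ ⟨g, hg, rfl⟩
    exact hg

/-- In the local ring at `y` a combination of nonunits is a nonunit. -/
lemma exists_mem_basicOpen {U : Y.Opens} {y : Y} (b c : ι → Γ(Y, U))
    (hy : y ∈ Y.basicOpen (∑ i, b i * c i)) : ∃ i, y ∈ Y.basicOpen (c i) := by
  have hyU : y ∈ U := Y.basicOpen_le _ hy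
  by_contra! h
  rw [Scheme.mem_basicOpen _ _ _ hyU, map_sum] at hy
  refine (IsLocalRing.mem_maximalIdeal _).mp (Ideal.sum_mem _ fun i _ => ?_) hy
  rw [map_mul]
  refine Ideal.mul_mem_left _ _ ((IsLocalRing.mem_maximalIdeal _).mpr ?_)
  exact fun hu => h i ((Scheme.mem_basicOpen _ _ _ hyU).mpr hu)

variable {E : C.Modules} {s : ι → Γ(E, ⊤)}

lemma isRel_structureModule (a : ι → Γ(C, ⊤)) {U : C.Opens} (c : ι → Γ(C, U)) :
    IsRel (structureModule C) (fun i => (unitEquiv C ⊤).symm (a i)) U c ↔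
      ∑ i, c i * rs le_top (a i) = 0 := by
  have h : ∀ i, c i • rt _ U ((unitEquiv C ⊤).symm (a i)) =
      (unitEquiv C U).symm (c i * rs le_top (a i)) := fun i => by
    rw [rt, unitEquiv_symm_res, unitEquiv_symm_smul]
  rw [IsRel, Finset.sum_congr rfl fun i _ => h i, ← map_sum]
  exact (unitEquiv C U).symm.map_eq_zero_iff

/-- The charts of a projective bundle over a curve are affine if no map to the structure sheaf
sends the dehomogenizing section to `1`. -/
lemma IsChart.isAffine (f : C ⟶ Spec (.of k)) [UniversallyClosed f] [IsIntegral C]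
    (hC : ∀ F : Set C, IsClosed F → F ≠ Set.univ → ∃ U : C.Opens, IsAffineOpen U ∧ F ⊆ U)
    (hs : IsGen E s) {j : ι} {p : Y ⟶ C} {x : ι → Γ(Y, ⊤)} (hY : IsChart s j p x)
    (hj : ∀ φ : E ⟶ structureModule C, φ.app ⊤ (s j) ≠ (unitEquiv C ⊤).symm 1) : IsAffine Y := by
  have := hY.isClosedImmersion
  have hp : IsAffineHom p := by
    rw [← AffineSpace.homOfVector_over p x]
    infer_instance
  obtain ⟨θ, hθ, hθ'⟩ := exists_isClosedMap f p x
  refine isAffine_of_polynomial (MvPolynomial.eval₂Hom (scalarMap (p ≫ f)) x) fun a => ?_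
  -- Since `x j = 1` on the chart, the polynomial `X j - 1` handles points with `a j ≠ 1`: its basic
  -- open preimage is empty.
  by_cases haj : a j = 1
  swap
  · refine ⟨MvPolynomial.X j - 1, ?_, ?_⟩
    · rw [map_sub, map_one, MvPolynomial.eval_X]
      exact sub_ne_zero.mpr haj
    · rw [map_sub, map_one, MvPolynomial.coe_eval₂Hom, MvPolynomial.eval₂_X, hY.one, sub_self,
        Scheme.basicOpen_zero]
      exact isAffineOpen_bot _
  -- If the constants `a i` satisfied every relation, `s i ↦ a i` would be a morphism to the
  -- structure sheaf sending `s j` to `1`.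
  have h1 : ∃ (U : C.Opens) (c : ι → Γ(C, U)), IsRel E s U c ∧
      ∑ i, c i * rs le_top (scalarMap f (a i)) ≠ 0 := by
    by_contra! h
    obtain ⟨φ, hφ⟩ := hs.exists_hom (fun i => (unitEquiv C ⊤).symm (scalarMap f (a i)))
      fun U c hc => (isRel_structureModule _ c).mpr (h U c hc)
    exact hj φ (by rw [hφ, haj, map_one])
  obtain ⟨U, c, hc, hne⟩ := h1
  set h := ∑ i, c i * rs le_top (scalarMap f (a i)) with hh
  -- On an integral scheme a nonzero function has nonempty basic open set.
  have hD : ((C.basicOpen h : Set C))ᶜ ≠ Set.univ := by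
    intro hD
    have : C.basicOpen h = ⊥ := SetLike.coe_injective (by simpa using hD)
    exact hne ((basicOpen_eq_bot_iff h).mp this)
  obtain ⟨U₀, hU₀, hDU⟩ := hC _ (C.basicOpen h).2.isClosed_compl hD
  -- The coordinates satisfy `∑ c_i x_i = 0`, so subtracting this writes `h` as a combination of the
  -- `a_i - x_i`.
  have hph : p.app U h = ∑ i, p.app U (c i) *
      rs le_top (scalarMap (p ≫ f) (a i) - x i) := by
    have h2 := hY.solves U c hc
    rw [hh, map_sum, ← sub_zero (∑ i, _), ← h2, ← Finset.sum_sub_distrib]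
    refine Finset.sum_congr rfl fun i _ => ?_
    rw [map_mul, app_rs_top, comp_scalarMap, map_sub, mul_sub]
  let m : PrimeSpectrum (MvPolynomial ι k) :=
    ⟨MvPolynomial.vanishingIdeal k {a}, inferInstance⟩
  have hm : ∀ g, m ∈ PrimeSpectrum.basicOpen g ↔ MvPolynomial.eval a g ≠ 0 := fun g =>
    (MvPolynomial.mem_vanishingIdeal_singleton_iff a g).not
  have hcl : IsClosed (θ '' (p ⁻¹' (U₀ : Set C)ᶜ)) :=
    hθ _ (U₀.2.isClosed_compl.preimage p.continuous)
  have hmcl : m ∉ θ '' (p ⁻¹' (U₀ : Set C)ᶜ) := by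
    rintro ⟨y, hy, hym⟩
    -- A point outside the preimage of `U₀` lies over `D(h)`, so some `a_i - x_i` is nonzero there
    -- and the point is not in the fibre over `a`.
    have hyD : y ∈ p ⁻¹ᵁ C.basicOpen h := by
      by_contra hyD
      exact hy (hDU hyD)
    rw [Scheme.preimage_basicOpen, hph] at hyD
    obtain ⟨i, hi⟩ := exists_mem_basicOpen _ _ hyD
    have h3 : y ∈ Y.basicOpen (MvPolynomial.eval₂Hom (scalarMap (p ≫ f)) x
        (MvPolynomial.C (a i) - MvPolynomial.X i)) := by
      rw [map_sub, MvPolynomial.coe_eval₂Hom, MvPolynomial.eval₂_X, MvPolynomial.eval₂_C]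
      exact ((Y.basicOpen_res _ _).le hi).2
    rw [← hθ'] at h3
    have h4 : m ∈ PrimeSpectrum.basicOpen (MvPolynomial.C (a i) - MvPolynomial.X i) := hym ▸ h3
    rw [hm] at h4
    exact h4 (by simp)
  obtain ⟨_, ⟨g, rfl⟩, hmg, hg⟩ := PrimeSpectrum.isTopologicalBasis_basic_opens
    |>.exists_subset_of_mem_open (show m ∈ _ from hmcl) hcl.isOpen_compl
  refine ⟨g, (hm g).mp hmg, ?_⟩
  have hle : Y.basicOpen (MvPolynomial.eval₂Hom (scalarMap (p ≫ f)) x g) ≤ p ⁻¹ᵁ U₀ := by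
    intro y hy
    rw [← hθ'] at hy
    by_contra hyU
    exact hg hy ⟨y, hyU, rfl⟩
  -- The basic open set of `g` lies in the affine preimage of `U₀`, so it is a basic open set of an
  -- affine scheme.
  have h5 := (hU₀.preimage p).basicOpen
    (rs le_top (MvPolynomial.eval₂Hom (scalarMap (p ≫ f)) x g))
  have h6 := (Y.basicOpen_res (MvPolynomial.eval₂Hom (scalarMap (p ≫ f)) x g)
    (homOfLE (le_top : p ⁻¹ᵁ U₀ ≤ ⊤)).op).trans (inf_eq_right.mpr hle)
  exact h6 ▸ h5

end Criterion

end

end AmpleBundle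

/-! ### The theorem for curves. -/

namespace AmpleBundle

/-- A globally generated vector bundle with vanishing first cohomology on a smooth projective
curve of positive genus is ample. -/
theorem IsSmoothProjectiveCurve.isAmple {k : Type u} [Field k] [IsAlgClosed k] {C : Scheme.{u}}
    {f : C ⟶ Spec (.of k)} (hC : IsSmoothProjectiveCurve f) (hg : 1 ≤ genus f) {E : C.Modules}
    (hE : IsVectorBundle E) (hgen : IsGloballyGenerated E)
    (hH1 : Subsingleton (Cohomology E 1)) : IsAmple E := by
  have := hC.isIntegral
  have := hC.isProjective.isProper
  have := hC.isProjective.isNoetherian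
  obtain ⟨I, s, hs⟩ := hgen.exists_isJointlyEpi
  obtain ⟨J, hgenJ, hsplit⟩ := hE.exists_finite_generators hs
  choose Y p x hY using exists_isChart hsplit
  obtain ⟨P, π, A, hP, hA⟩ := exists_isProjOf hY
  have hfin : ∀ F : Set C, IsClosed F → F ≠ Set.univ →
      ∃ U : C.Opens, IsAffineOpen U ∧ F ⊆ U := fun F hF hF' =>
    hC.isProjective.exists_isAffineOpen (finite_of_isClosed hC.dimension hF hF')
  refine hP.isAmple hgenJ (hP.isAmpleLineBundle fun j => hA j ?_)
  exact (hY j).isAffine f hfin hgenJ fun φ => hom_structureModule_ne_one f hg hH1 φ _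

end AmpleBundle

theorem mainTheorem9 {k : Type u} [Field k] [IsAlgClosed k]
    {C : AlgebraicGeometry.Scheme.{u}} (f : C ⟶ AlgebraicGeometry.Spec (.of k))
    (hC : AmpleBundle.IsSmoothProjectiveCurve f) (hg : 1 ≤ AmpleBundle.genus f)
    (E : C.Modules) (hE : AmpleBundle.IsVectorBundle E)
    (hgen : AmpleBundle.IsGloballyGenerated E)
    (hH1 : Subsingleton (AmpleBundle.Cohomology E 1)) :
    AmpleBundle.IsAmple E :=
  hC.isAmple hg hE hgen hH1
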